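/- **Simplified counter machine (SCM).** Let $S=\{s_1,\dots,s_m\}$, $\alpha:S\times\{0,1\}^2\to S$ and $\beta:S\to\{(-1,0),(0,-1),(0,0),(1,0),(0,1)\}$. A configuration $(s,z_1,z_2)\in S\times\mathbb Z_{\ge0}^2$ is updated to $(s',(z_1,z_2)+\beta(s'))$, where $s'=\alpha(s,1\{z_1>0\},1\{z_2>0\})$. It is assumed that a counter equal to zero is never decremented: if $\beta(\alpha(s,b_1,b_2))$ has $i$-th entry $-1$, then $b_i=1$. The SCM starts in $(s^*,0,0)$. **Networks.** A deterministic multiclass queueing network consists of single servers and job classes; each class has a server, a service time, a buffer of given capacity, at most one next class and possibly external arrivals at times $an+b$ ($n=0,1,\dots$). Each server works non-preemptively and without idling, and on completing a service it selects the head of the nonempty queue of highest priority (1 is the highest; ties between equal priorities are broken arbitrarily). A completed job moves instantly to its next class or leaves the network. A job arriving at a class with capacity $0$ is accepted iff its service can begin at once, and otherwise it is dropped. $Q_c(s)$ is the number of class-$c$ jobs (waiting or in service) at time $s\ge0$, after the events of time $s$. The state at time $0$ is given, so only external arrivals at positive times occur. Simultaneous events happen one after the other in arbitrary order, except that a job with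 zero service time does not occupy its server: once its service begins, it completes before any other arrival and before any completion of a service of positive length. **The network of the SCM.** Subnetworks $SN_i$, $i=1,2$ (service time $0$ where none is given; "exit" = leaves the network): | server | class | next | service time | priority | capacity | external arrivals | |---|---|---|---|---|---|---| | $S_{i1}$ | $i11$ | $i21$ | | 2 | $\infty$ | | | | $i12$ | exit | 0.5 | 1 | $\infty$ | | | | $i13$ | $i31$ | | 3 | 0 | $3n+1.6$ | | | $i14$ | $i31$ | | 4 | 0 | $3n+2.6$ | | $S_{i2}$ | $i21$ | exit | 0.5 | 1 | $\infty$ | | | | $i22$ | $i12$ | | 2 | $\infty$ | $n$ | | | $i23$ | $i31$ | | 3 | 0 | $3n+2.1$ | | $S_{i3}$ | $i31$ | exit | 0.04 | 2 | $\infty$ | | | | $i32$ | exit | 1.1 | 1 | $\infty$ | $3n+1.5$ | | | $i33$ | $01i$ | | 3 | 0 | $3n+2.7$ | | $S_{i4}$ | $i41$ | exit | 0.2 | 1 | $\infty$ | | | | $i42$ | $i11$ | | 2 | 0 | $n+0.02$ | | $S_{i5}$ | $i51$ | $i11$ | 0.02 | 1 | $\infty$ | | Main network $MN$ ($j,k=1,\dots,m$):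 | server | class | next | service time | priority | capacity | external arrivals | |---|---|---|---|---|---|---| | $S_{01}$ | $011$ | exit | 0.09 | 1 | $\infty$ | | | | $012$ | exit | 0.18 | 2 | $\infty$ | | | | $03k$ | $3k1$ | | 3 | $\infty$ | | | $S_{02}$ | $02k$ | $03k$ | 2.71 | 1 | $\infty$ | | | $S_{3j}$ | $3k1$, for $\alpha(s_k,1,1)=s_j$ | $3k2$ | 0.09 | 1 | $\infty$ | | | | $3k2$, for $\alpha(s_k,0,1)=s_j$ | $3k3$ | 0.09 | 1 | $\infty$ | | | | $3k3$, for $\alpha(s_k,1,0)=s_j$ | $3k4$ | 0.09 | 1 | $\infty$ | | | | $3k4$, for $\alpha(s_k,0,0)=s_j$ | exit | 0.09 | 1 | $\infty$ | | | | $3j5$ | $4j1$ | | 2 | 0 | $3n-0.01$ | | $S_{4j}$ | $4j1$ | exit | 0.02 | 1 | $\infty$ | | | | $4j2$ | $02j$ | | 2 | 0 | $3n$ | | | $4j3$ | see below | | 3 | 0 | $3n$ | Jobs leaving $4j3$ go to $141$, $151$, $241$, $251$ if $\beta(s_j)=(-1,0),(1,0),(0,-1),(0,1)$ respectively, and exit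 if $\beta(s_j)=(0,0)$. At time $0$ the server $S_{02}$ starts to work on a job of class $02j$, where $s_j=s^*$, and there are no other jobs in the network. **Statuses.** $Status_{MN}(t)=k$ if at time $t-1$ the server $S_{02}$ started to work on a job in class $02k$ and this is the only job in $MN$ at time $t$; if there is no such $k$, $Status_{MN}(t)=-1$. Let $W_i(s)=W_{i12}(s)+W_{i21}(s)+0.5\,Q_{i22}(s)+0.5\,Q_{i11}(s)$, where $W_c(s)$ is the time required to process the jobs which are in class $c$ at time $s$. $Status_{SN_i}(t)=2W_i(t^-)$ if $Q_{i12}(t)Q_{i21}(t)=0$ and at time $t$ there are no jobs in $SN_i$ outside the Rybko–Stolyar classes $i11,i12,i21,i22$; otherwise $Status_{SN_i}(t)=-1$. **Theorem 4.** The network has an evolution from this initial state, and every such evolution satisfies: for every integer $t\ge0$, if the configuration of the SCM after $t$ steps is $(s_q,z_1,z_2)$, then $Status_{MN}(3t+1)=q$ and $Status_{SN_i}(3t+1)=z_i$ for $i=1,2$. -/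

import Mathlib

open scoped Topology

noncomputable section

/-! ## Simplified counter machines -/

/-- A simplified counter machine (SCM) with states `s_1, …, s_m` (indexed by `Fin m`) and two
counters (indexed by `Fin 2`). In state `s`, with `b i = true` iff counter `i` is positive, the new
state is `α s b`, and the counters change by `β (α s b)`. -/
structure SCM (m : ℕ) where
  α : Fin m → (Fin 2 → Bool) → Fin m
  β : Fin m → Fin 2 → ℤ
  /-- at most one counter is changed, by at most one -/
  β_mem : ∀ s, β s ∈ ({![-1, 0], ![0, -1], ![0, 0], ![1, 0], ![0, 1]} : Set (Fin 2 → ℤ))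
  /-- the update function never attempts to decrement a counter which is equal to zero -/
  consistent : ∀ s b i, β (α s b) i = -1 → b i = true

namespace SCM

variable {m : ℕ} (M : SCM m)

/-- The configuration update function `Γ`. -/
def Γ (s : Fin m) (b : Fin 2 → Bool) : Fin m × (Fin 2 → ℤ) := (M.α s b, M.β (M.α s b))

/-- One step `(s, z) ↦ (s', z')` of the machine. -/
def step (c : Fin m × (Fin 2 → ℕ)) : Fin m × (Fin 2 → ℕ) :=
  let g := M.Γ c.1 (fun i => decide (0 < c.2 i))
  (g.1, fun i => ((c.2 i : ℤ) + g.2 i).toNat)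

/-- The configuration after `t` steps, starting from `(s₀, 0, 0)`. -/
def run (s₀ : Fin m) (t : ℕ) : Fin m × (Fin 2 → ℕ) := M.step^[t] (s₀, fun _ => 0)

/-- The truncation `toNat` in `step` is never active: counters are never driven below zero. -/
theorem step_counter (c : Fin m × (Fin 2 → ℕ)) (i : Fin 2) :
    (((M.step c).2 i : ℕ) : ℤ)
      = (c.2 i : ℤ) + (M.Γ c.1 (fun i => decide (0 < c.2 i))).2 i := by
  set b : Fin 2 → Bool := fun i => decide (0 < c.2 i) with hb
  have hmem := M.β_mem (M.α c.1 b)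
  have hcon := M.consistent c.1 b i
  have hge : -1 ≤ M.β (M.α c.1 b) i := by
    simp only [Set.mem_insert_iff, Set.mem_singleton_iff] at hmem
    rcases hmem with h | h | h | h | h <;> rw [h] <;> fin_cases i <;> simp
  have hpos : 0 ≤ (c.2 i : ℤ) + M.β (M.α c.1 b) i := by
    by_cases h : M.β (M.α c.1 b) i = -1
    · have := hcon h
      simp only [hb, decide_eq_true_eq] at this
      omega
    · omega
  exact Int.toNat_of_nonneg hpos

end SCM

/-! ## Deterministic multiclass queueing networks under static buffer priority policies -/

/-- A deterministic multiclass queueing network with single servers `S` and job classes `C`,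
together with a static buffer priority policy. -/
structure QNetwork (S C : Type*) where
  /-- the server which processes the given class -/
  server : C → S
  /-- the (deterministic) service time of the class -/
  service : C → ℚ≥0
  /-- the priority within the server; the smallest number is the highest priority -/
  priority : C → ℕ
  /-- how many jobs can wait in the buffer of the class, not including the job in service -/
  capacity : C → ℕ∞
  /-- the class to which jobs are routed after service; `none` means that they leave -/
  next : C → Option C
  /-- `some (a, b)`: external arrivals at times `a * n + b`, `n = 0, 1, …`; `none`: no arrivals -/
  arrival : C → Option (ℚ × ℚ)

/-- A state of a network: for every class the number of waiting jobs, and for every server the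
class and the remaining service time of the job in service, if any. -/
@[ext]
structure QState (S C : Type*) where
  waiting : C → ℕ
  serving : S → Option (C × ℝ)

namespace QState

variable {S C : Type*}

/-- Passage of `d` units of time during which nothing happens except service. -/
def flow (d : ℝ) (x : QState S C) : QState S C where
  waiting := x.waiting
  serving := fun s => (x.serving s).map (fun p => (p.1, p.2 - d))

end QState

namespace QNetwork

variable {S C : Type*} [DecidableEq S] [DecidableEq C] (N : QNetwork S C)

open Classical in
/-- The queue length of class `c`: the waiting jobs and the job in service, if any. -/
def queue (x : QState S C) (c : C) : ℕ :=
  x.waiting c + if ∃ r, x.serving (N.server c) = some (c, r) then 1 else 0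

open Classical in
/-- The time required to process the jobs which are currently in class `c`, at this class. -/
def workload (x : QState S C) (c : C) : ℝ :=
  x.waiting c * (N.service c : ℝ) +
    match x.serving (N.server c) with
    | none => 0
    | some (c', r) => if c' = c then r else 0

/-- The server of class `c` starts to work on a new job of class `c`. -/
def startJob (c : C) (x : QState S C) : QState S C where
  waiting := x.waiting
  serving := Function.update x.serving (N.server c) (some (c, (N.service c : ℝ)))

/-- An arriving job of class `c` can begin service at once: its server is idle, and no waiting job
has to be taken before it. -/
def CanBegin (c : C) (x : QState S C) : Prop :=
  x.serving (N.server c) = none ∧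
    ∀ c', N.server c' = N.server c → 0 < x.waiting c' → N.priority c < N.priority c'

open Classical in
/-- A job arrives to class `c`: it begins service at once if it can, otherwise it is put into the
buffer if there is room, and otherwise it is dropped from the network. In particular, for capacity
zero the job is accepted iff its service can begin immediately. -/
def join (c : C) (x : QState S C) : QState S C :=
  if N.CanBegin c x then N.startJob c x
  else if (x.waiting c : ℕ∞) < N.capacity c then
    { x with waiting := Function.update x.waiting c (x.waiting c + 1) }
  else x

/-- The job which was just served in class `c` moves to the next class or leaves the network. -/
def route (c : C) (x : QState S C) : QState S C :=
  match N.next c with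
  | none => x
  | some d => N.join d x

/-- The server `s` stops working on its job. -/
def free (s : S) (x : QState S C) : QState S C where
  waiting := x.waiting
  serving := Function.update x.serving s none

/-- After a service completion at `s`: if `s` is not working, it selects the head of a nonempty
queue with the highest priority (ties between classes of equal priority are broken arbitrarily), or
remains idle if all its queues are empty. -/
inductive Select (s : S) (x : QState S C) : QState S C → Prop
  | busy (h : x.serving s ≠ none) : Select s x x
  | idle (h : x.serving s = none) (hw : ∀ c, N.server c = s → x.waiting c = 0) : Select s x x
  | start (h : x.serving s = none) (c : C) (hc : N.server c = s) (hw : 0 < x.waiting c)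
      (hp : ∀ c', N.server c' = s → 0 < x.waiting c' → N.priority c ≤ N.priority c') :
      Select s x (N.startJob c
        { x with waiting := Function.update x.waiting c (x.waiting c - 1) })

/-- Some server holds a job with zero service time. -/
def Passing (x : QState S C) : Prop :=
  ∃ s c r, x.serving s = some (c, r) ∧ N.service c = 0

/-- A single event at a fixed time instant. The second component is the set of classes whose
external arrival at this instant has not been carried out yet.

Simultaneous events happen one after the other, in arbitrary order, except that a job with zero
service time does not occupy its server: once its service begins, it completes before any other
arrival, and before the completion of any service of positive length. -/
inductive Event : QState S C × Set C → QState S C × Set C → Prop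
  | finish (x y : QState S C) (P : Set C) (s : S) (c : C) (hs : x.serving s = some (c, 0))
      (hu : N.service c = 0 ∨ ¬ N.Passing x) (hy : N.Select s (N.route c (free s x)) y) :
      Event (x, P) (y, P)
  | arrive (x : QState S C) (P : Set C) (c : C) (hc : c ∈ P) (hu : ¬ N.Passing x) :
      Event (x, P) (N.join c x, P \ {c})

/-- The classes with an external arrival at time `u`. -/
def arrivals (u : ℝ) : Set C :=
  {c | ∃ a b : ℚ, N.arrival c = some (a, b) ∧ ∃ n : ℕ, u = (a : ℝ) * n + (b : ℝ)}

/-- `y` results from `x` by carrying out all the events of time `u`: every external arrival of this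
instant has happened, and no service which is due remains uncompleted. -/
def Settles (u : ℝ) (x y : QState S C) : Prop :=
  Relation.ReflTransGen N.Event (x, N.arrivals u) (y, ∅) ∧ ∀ s c, y.serving s ≠ some (c, 0)

/-- `X` is an evolution of the network from the state `x₀` at time `0`. Here `X u` is the state at
time `u ≥ 0`, after all the events of time `u`. Between events, only the remaining service times
change. Since `x₀` is the state at time `0`, external arrivals are those at positive times. -/
structure IsEvolution (x₀ : QState S C) (X : ℝ → QState S C) : Prop where
  init : X 0 = x₀
  right : ∀ s, 0 ≤ s → ∃ v, s < v ∧ ∀ r ∈ Set.Ico s v, X r = (X s).flow (r - s)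
  left : ∀ u, 0 < u → ∃ s, 0 ≤ s ∧ s < u ∧ (∀ r ∈ Set.Ico s u, X r = (X s).flow (r - s)) ∧
    N.Settles u ((X s).flow (u - s)) (X u)

end QNetwork

/-! ## The network which simulates an SCM -/

/-- The servers: `sub i j` is `S_{(i+1)(j+1)}` of the subnetwork `SN_{i+1}`; `S01`, `S02`, `S3 j`,
`S4 j` form the main network. -/
inductive Srv (m : ℕ)
  | sub (i : Fin 2) (j : Fin 5)
  | S01
  | S02
  | S3 (j : Fin m)
  | S4 (j : Fin m)
  deriving DecidableEq

/-- The job classes. For `i : Fin 2`, the classes `cjk i` belong to the subnetwork `SN_{i+1}`;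
the classes `m01 i`, and `mjk k` with `k : Fin m`, belong to the main network. -/
inductive Cls (m : ℕ)
  | c11 (i : Fin 2) | c12 (i : Fin 2) | c13 (i : Fin 2) | c14 (i : Fin 2)
  | c21 (i : Fin 2) | c22 (i : Fin 2) | c23 (i : Fin 2)
  | c31 (i : Fin 2) | c32 (i : Fin 2) | c33 (i : Fin 2)
  | c41 (i : Fin 2) | c42 (i : Fin 2)
  | c51 (i : Fin 2)
  | m01 (i : Fin 2)
  | m02 (k : Fin m) | m03 (k : Fin m)
  | m31 (k : Fin m) | m32 (k : Fin m) | m33 (k : Fin m) | m34 (k : Fin m) | m35 (k : Fin m)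
  | m41 (k : Fin m) | m42 (k : Fin m) | m43 (k : Fin m)
  deriving DecidableEq

namespace SCM

variable {m : ℕ} (M : SCM m)

/-- Server of each class. -/
def srv : Cls m → Srv m
  | .c11 i => .sub i 0 | .c12 i => .sub i 0 | .c13 i => .sub i 0 | .c14 i => .sub i 0
  | .c21 i => .sub i 1 | .c22 i => .sub i 1 | .c23 i => .sub i 1
  | .c31 i => .sub i 2 | .c32 i => .sub i 2 | .c33 i => .sub i 2
  | .c41 i => .sub i 3 | .c42 i => .sub i 3
  | .c51 i => .sub i 4
  | .m01 _ => .S01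
  | .m02 _ => .S02
  | .m03 _ => .S01
  | .m31 k => .S3 (M.α k ![true, true])
  | .m32 k => .S3 (M.α k ![false, true])
  | .m33 k => .S3 (M.α k ![true, false])
  | .m34 k => .S3 (M.α k ![false, false])
  | .m35 j => .S3 j
  | .m41 j => .S4 j | .m42 j => .S4 j | .m43 j => .S4 j

/-- Service times. -/
def srvTime : Cls m → ℚ≥0
  | .c12 _ => 1 / 2
  | .c21 _ => 1 / 2
  | .c31 _ => 4 / 100
  | .c32 _ => 11 / 10
  | .c41 _ => 2 / 10
  | .c51 _ => 2 / 100
  | .m01 i => if i = 0 then 9 / 100 else 18 / 100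
  | .m02 _ => 271 / 100
  | .m31 _ => 9 / 100 | .m32 _ => 9 / 100 | .m33 _ => 9 / 100 | .m34 _ => 9 / 100
  | .m41 _ => 2 / 100
  | _ => 0

/-- Priorities. -/
def prio : Cls m → ℕ
  | .c11 _ => 2 | .c12 _ => 1 | .c13 _ => 3 | .c14 _ => 4
  | .c21 _ => 1 | .c22 _ => 2 | .c23 _ => 3
  | .c31 _ => 2 | .c32 _ => 1 | .c33 _ => 3
  | .c41 _ => 1 | .c42 _ => 2
  | .c51 _ => 1
  | .m01 i => if i = 0 then 1 else 2
  | .m02 _ => 1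
  | .m03 _ => 3
  | .m31 _ => 1 | .m32 _ => 1 | .m33 _ => 1 | .m34 _ => 1 | .m35 _ => 2
  | .m41 _ => 1 | .m42 _ => 2 | .m43 _ => 3

/-- Buffer capacities: zero or infinite. -/
def cap : Cls m → ℕ∞
  | .c13 _ => 0 | .c14 _ => 0 | .c23 _ => 0 | .c33 _ => 0 | .c42 _ => 0
  | .m35 _ => 0 | .m42 _ => 0 | .m43 _ => 0
  | _ => ⊤

/-- Routing. -/
def nextCls : Cls m → Option (Cls m)
  | .c11 i => some (.c21 i)
  | .c13 i => some (.c31 i)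
  | .c14 i => some (.c31 i)
  | .c22 i => some (.c12 i)
  | .c23 i => some (.c31 i)
  | .c33 i => some (.m01 i)
  | .c42 i => some (.c11 i)
  | .c51 i => some (.c11 i)
  | .m02 k => some (.m03 k)
  | .m03 k => some (.m31 k)
  | .m31 k => some (.m32 k)
  | .m32 k => some (.m33 k)
  | .m33 k => some (.m34 k)
  | .m35 j => some (.m41 j)
  | .m42 j => some (.m02 j)
  | .m43 j =>
      if M.β j = ![-1, 0] then some (.c41 0)
      else if M.β j = ![1, 0] then some (.c51 0)
      else if M.β j = ![0, -1] then some (.c41 1)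
      else if M.β j = ![0, 1] then some (.c51 1)
      else none
  | _ => none

/-- External arrivals, as pairs (interarrival time, initial delay). -/
def extArr : Cls m → Option (ℚ × ℚ)
  | .c22 _ => some (1, 0)
  | .c42 _ => some (1, 2 / 100)
  | .c13 _ => some (3, 16 / 10)
  | .c23 _ => some (3, 21 / 10)
  | .c14 _ => some (3, 26 / 10)
  | .c32 _ => some (3, 15 / 10)
  | .c33 _ => some (3, 27 / 10)
  | .m35 _ => some (3, -(1 / 100))
  | .m42 _ => some (3, 0)
  | .m43 _ => some (3, 0)
  | _ => none

/-- The queueing network constructed from the SCM. -/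
def network : QNetwork (Srv m) (Cls m) where
  server := M.srv
  service := srvTime
  priority := prio
  capacity := cap
  next := M.nextCls
  arrival := extArr

/-- The initial state: at time `0`, the server `S02` starts to work on a job of the class `m02 s₀`
of the initial state `s₀` of the SCM; there are no other jobs. -/
def initialState (s₀ : Fin m) : QState (Srv m) (Cls m) where
  waiting := fun _ => 0
  serving := Function.update (fun _ => none) .S02 (some (.m02 s₀, (srvTime (.m02 s₀) : ℝ)))

/-- The classes of the main network. -/
def IsMain : Cls m → Prop
  | .m01 _ | .m02 _ | .m03 _ | .m31 _ | .m32 _ | .m33 _ | .m34 _ | .m35 _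
  | .m41 _ | .m42 _ | .m43 _ => True
  | _ => False

/-- The classes of the `i`-th subnetwork outside its Rybko–Stolyar classes. -/
def IsNonRS (i : Fin 2) : Cls m → Prop
  | .c13 j | .c14 j | .c23 j | .c31 j | .c32 j | .c33 j | .c41 j | .c42 j | .c51 j => j = i
  | _ => False

/-- At time `t - 1` the server `S02` started to work on a job of class `m02 k`, and this is the only
job in the main network at time `t`. (A job which is in service at time `u`, with its whole service
time remaining, is one whose service started at time `u`.) -/
def MainAt (X : ℝ → QState (Srv m) (Cls m)) (t : ℝ) (k : Fin m) : Prop :=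
  (X (t - 1)).serving .S02 = some (.m02 k, (srvTime (.m02 k) : ℝ)) ∧
    ∀ c, IsMain c → M.network.queue (X t) c = if c = .m02 k then 1 else 0

open Classical in
/-- The status of the main network: the number (from `1` to `m`) of the state, or `-1`. -/
def statusMN (X : ℝ → QState (Srv m) (Cls m)) (t : ℝ) : ℤ :=
  if h : ∃ k, M.MainAt X t k then (h.choose.val : ℤ) + 1 else -1

/-- The combined workload of the first two servers of the `i`-th subnetwork: each job in `c22`
(`c11`) still requires a service of length `1 / 2` in `c12` (`c21`). -/
def rsWorkload (i : Fin 2) (x : QState (Srv m) (Cls m)) : ℝ :=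
  M.network.workload x (.c12 i) + M.network.workload x (.c21 i)
    + 1 / 2 * M.network.queue x (.c22 i) + 1 / 2 * M.network.queue x (.c11 i)

open Classical in
/-- The status of the `i`-th subnetwork: twice the workload immediately before time `t`, or `-1`. -/
def statusSN (i : Fin 2) (X : ℝ → QState (Srv m) (Cls m)) (t : ℝ) : ℝ :=
  if M.network.queue (X t) (.c12 i) * M.network.queue (X t) (.c21 i) = 0 ∧
      ∀ c, IsNonRS i c → M.network.queue (X t) c = 0
  then 2 * Function.leftLim (fun s => M.rsWorkload i (X s)) t
  else -1

end SCM

end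

/-!
All service times, and all times of external arrivals, are multiples of `1 / 100`. Hence an evolution
is determined by its states at the times `hund n = n / 100`: between two such times only the
remaining service times change (`QNetwork.IsEvolution.lattice_step`), and conversely each sequence of
states which settles at all these times interpolates to an evolution
(`QNetwork.exists_isEvolution_of_seq`). At one instant only finitely many events can happen, because
a potential decreases (`QNetwork.Event.potential_lt`); so an evolution exists. Simultaneous events
are carried out in arbitrary order, and every statement about a state at a lattice time is therefore
proved as an invariant of single events, where an event is taken together with the passage of the
jobs with zero service time which it sets in motion (`QNetwork.invariant_of_flush`). The states
without passing jobs are encoded by natural numbers (`NetState`, `SCM.conc`).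

The simulation of one step of the machine takes three units of time, which form a cycle: with the
time `τ` in hundredths, the cycle extends from `τ = 100` to `τ = 400`. It begins with the
configuration `(k, z)`, and the next state is `j`.

* In a subnetwork the Rybko–Stolyar servers never work at the same time. During each unit of time
  two jobs arrive (`c22` and `c42`), and one of the two servers works all the time, for half a unit
  per job. So the workload immediately before the beginning of each unit is the same, and it encodes
  the counter (`RSCore.count`, `SCM.CycleInv.rsWorkload_eq`).
* The jobs which arrive to `c13`, `c23`, `c14` at the times `160`, `210`, `260` test whether the
  first, the second, the first server is idle. If the counter is zero, the servers take turns every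
  half unit and all three jobs enter `c31`. If it is positive, some server works longer than that,
  and at most two jobs enter (`RSCore.after14`). The third server, which is kept busy by the `c32`
  job until `260`, needs `4` for each of them; at time `270` it is therefore idle iff the counter is
  positive, and exactly then a signal passes from `c33` to `S01` (`SubInv.third_at_signal`).
* The signals occupy `S01` until `270 + 9 * s 0 + 18 * s 1`, where `s i` is `1` if the counter `i`
  is positive and `0` otherwise. The job in `m02 k` leaves `S02` at time `271`, has to wait for
  `S01`, and then walks through `m31 k`, …, `m34 k`, which take `9` each. At time `299` it is found
  in the class which belongs to the pattern of positive counters, hence at the server `S3 j`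
  (`MainInv.walk_at`). The jobs which arrive to the classes `m35` at this time make all servers
  `S4 l` busy until `301` except `S4 j`, so at time `300` only the jobs in `m42 j` and `m43 j` get
  through.
* The first of these starts the service of `m02 j` and so establishes the new state. The second
  changes a counter: it starts a `c41` service, because of which the `c42` job arriving at time `302`
  is dropped, or a `c51` service, at the end of which an additional job joins `c11`
  (`SubInv.arrive42`, `SubInv.finish5`).

`SCM.CycleInv` collects these facts for an arbitrary moment of the cycle; it is preserved by
arrivals, service completions and the passage of time, and at the end of a cycle it holds again for
the next configuration (`SCM.CycleInv.restart`). Induction over the cycles gives `SCM.represents`.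
-/

open scoped Topology

noncomputable section

/-! ### Networks whose event times lie on a lattice -/

/-- The time `n / 100`: every service time and every arrival time of the network is of this form. -/
def hund (n : ℕ) : ℝ := (n : ℝ) / 100

theorem hund_zero : hund 0 = 0 := by simp [hund]

theorem hund_eq_zero {n : ℕ} : hund n = 0 ↔ n = 0 := by simp [hund]

theorem hund_succ (n : ℕ) : hund (n + 1) = hund n + 1 / 100 := by
  simp only [hund]; push_cast; ring

theorem hund_succ_sub (n : ℕ) : hund (n + 1) - 1 / 100 = hund n := by
  rw [hund_succ]; ring

theorem hund_nonneg (n : ℕ) : 0 ≤ hund n := by unfold hund; positivity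

theorem hund_lt {a b : ℕ} : hund a < hund b ↔ a < b := by
  unfold hund
  rw [div_lt_div_iff_of_pos_right (by norm_num)]
  exact_mod_cast Iff.rfl

namespace QState

variable {S C : Type*}

theorem flow_flow (d e : ℝ) (x : QState S C) : (x.flow d).flow e = x.flow (d + e) := by
  ext1
  · rfl
  · funext s
    simp only [flow]
    cases x.serving s <;> simp [sub_sub]

theorem flow_zero (x : QState S C) : x.flow 0 = x := by
  ext1
  · rfl
  · funext s
    simp only [flow]
    cases x.serving s <;> simp

end QState

namespace QNetwork

variable {S C : Type*} [DecidableEq S] [DecidableEq C] (N : QNetwork S C)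

/-- All service times and all positive arrival times are multiples of `1 / 100`. -/
structure OnLattice : Prop where
  service : ∀ c, ∃ k, (N.service c : ℝ) = hund k
  arrival : ∀ u c, 0 < u → c ∈ N.arrivals u → ∃ n, u = hund n

/-- Every job in service has a positive service time and a remaining service time which is a
positive multiple of `1 / 100`. This is how a state looks after all the events of a lattice time. -/
def Regular (x : QState S C) : Prop :=
  ∀ s c r, x.serving s = some (c, r) → N.service c ≠ 0 ∧ ∃ k, r = hund (k + 1)

/-- Every remaining service time is a multiple of `1 / 100`, and a job with zero service time has
no remaining service time. Unlike `Regular`, this also holds amid the events of a lattice time. -/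
def Tidy (x : QState S C) : Prop :=
  ∀ s c r, x.serving s = some (c, r) → (∃ k, r = hund k) ∧ (N.service c = 0 → r = 0)

variable {N}

section Closure

variable {Q : Option (C × ℝ) → Prop}

theorem startJob_all (hs : ∀ c, Q (some (c, (N.service c : ℝ)))) (c : C) {x : QState S C}
    (hx : ∀ s, Q (x.serving s)) (s : S) : Q ((N.startJob c x).serving s) := by
  simp only [startJob, Function.update_apply]
  split_ifs
  · exact hs c
  · exact hx s

theorem join_all (hs : ∀ c, Q (some (c, (N.service c : ℝ)))) (c : C) {x : QState S C}
    (hx : ∀ s, Q (x.serving s)) (s : S) : Q ((N.join c x).serving s) := by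
  unfold join
  split_ifs
  · exact startJob_all hs c hx s
  · exact hx s
  · exact hx s

theorem route_all (hs : ∀ c, Q (some (c, (N.service c : ℝ)))) (c : C) {x : QState S C}
    (hx : ∀ s, Q (x.serving s)) (s : S) : Q ((N.route c x).serving s) := by
  unfold route
  split
  · exact hx s
  · exact join_all hs _ hx s

theorem free_all (h0 : Q none) (s' : S) {x : QState S C}
    (hx : ∀ s, Q (x.serving s)) (s : S) : Q ((free s' x).serving s) := by
  simp only [free, Function.update_apply]
  split_ifs
  · exact h0
  · exact hx s

theorem Select.all (hs : ∀ c, Q (some (c, (N.service c : ℝ)))) {s' : S} {x y : QState S C}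
    (h : N.Select s' x y) (hx : ∀ s, Q (x.serving s)) (s : S) : Q (y.serving s) := by
  cases h with
  | busy h => exact hx s
  | idle h hw => exact hx s
  | start h c hc hw hp => exact startJob_all hs c (by exact hx) s

/-- A property of what a single server does which holds for idle servers and for services that have
just begun is preserved by all events. -/
theorem Event.all (h0 : Q none) (hs : ∀ c, Q (some (c, (N.service c : ℝ))))
    {p q : QState S C × Set C} (h : N.Event p q) (hx : ∀ s, Q (p.1.serving s)) (s : S) :
    Q (q.1.serving s) := by
  cases h with
  | finish x y P s' c hs' hu hy => exact hy.all hs (route_all hs c (free_all h0 s' hx)) s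
  | arrive x P c hc hu => exact join_all hs c hx s

end Closure

theorem Event.tidy (hN : N.OnLattice) {p q : QState S C × Set C} (h : N.Event p q)
    (hp : N.Tidy p.1) : N.Tidy q.1 := by
  have := h.all (Q := fun o => ∀ c r, o = some (c, r) →
    (∃ k, r = hund k) ∧ (N.service c = 0 → r = 0)) (by simp) (by
      intro c c' r hcr
      simp only [Option.some.injEq, Prod.mk.injEq] at hcr
      obtain ⟨rfl, rfl⟩ := hcr
      exact ⟨hN.service c, by intro h; simp [h]⟩) (fun s c r => hp s c r)
  exact fun s c r => this s c r

theorem tidy_of_reflTransGen (hN : N.OnLattice) {p q : QState S C × Set C}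
    (h : Relation.ReflTransGen N.Event p q) (hp : N.Tidy p.1) : N.Tidy q.1 := by
  induction h with
  | refl => exact hp
  | tail _ h ih => exact h.tidy hN ih

theorem Tidy.regular {x : QState S C} (hx : N.Tidy x) (h : ∀ s c, x.serving s ≠ some (c, 0)) :
    N.Regular x := by
  intro s c r hr
  obtain ⟨⟨k, hk⟩, h0⟩ := hx s c r hr
  have hr0 : r ≠ 0 := by
    rintro rfl
    exact h s c hr
  refine ⟨fun hc => hr0 (h0 hc), ?_⟩
  cases k with
  | zero => exact absurd (hk.trans hund_zero) hr0
  | succ k => exact ⟨k, hk⟩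

theorem Regular.tidy_flow {x : QState S C} (hx : N.Regular x) : N.Tidy (x.flow (1 / 100)) := by
  intro s c r hr
  simp only [QState.flow, Option.map_eq_some_iff, Prod.mk.injEq] at hr
  obtain ⟨⟨c', r'⟩, h1, h2, h3⟩ := hr
  simp only at h2 h3
  subst h2
  obtain ⟨h4, k, h5⟩ := hx s c' r' h1
  refine ⟨⟨k, ?_⟩, fun h => absurd h h4⟩
  rw [← h3, h5, hund_succ_sub]

theorem Settles.regular (hN : N.OnLattice) {u : ℝ} {x y : QState S C} (h : N.Settles u x y)
    (hx : N.Tidy x) : N.Regular y :=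
  (tidy_of_reflTransGen hN h.1 hx).regular h.2

/-- Between two consecutive lattice times no service is due. -/
theorem Regular.flow_ne_zero {x : QState S C} (hx : N.Regular x) {d : ℝ} (hd : d < 1 / 100)
    (s : S) (c : C) : (x.flow d).serving s ≠ some (c, 0) := by
  intro h
  simp only [QState.flow, Option.map_eq_some_iff, Prod.mk.injEq] at h
  obtain ⟨⟨c', r'⟩, h1, h2, h3⟩ := h
  obtain ⟨_, k, h5⟩ := hx s c' r' h1
  simp only at h3
  rw [h5, hund_succ] at h3
  have := hund_nonneg k
  linarith

theorem arrivals_eq_empty (hN : N.OnLattice) {u : ℝ} {n : ℕ} (h1 : hund n < u)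
    (h2 : u < hund (n + 1)) : N.arrivals u = ∅ := by
  ext c
  simp only [Set.mem_empty_iff_false, iff_false]
  intro hc
  obtain ⟨k, rfl⟩ := hN.arrival u c ((hund_nonneg n).trans_lt h1) hc
  rw [hund_lt] at h1 h2
  omega

/-- Without pending arrivals and due services nothing can happen. -/
theorem Settles.eq_of_quiet {u : ℝ} {x y : QState S C} (h : N.Settles u x y)
    (ha : N.arrivals u = ∅) (hx : ∀ s c, x.serving s ≠ some (c, 0)) : y = x := by
  have h1 := h.1
  rw [ha] at h1
  rcases Relation.ReflTransGen.cases_head h1 with h2 | ⟨q, h2, _⟩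
  · exact (Prod.mk.inj h2).1.symm
  · cases h2 with
    | finish _ _ _ s c hs => exact absurd hs (hx s c)
    | arrive _ _ c hc => exact absurd hc (by simp)

/-- Until the next lattice time, only the remaining service times change; the events of the next
lattice time then act on the state which results. -/
theorem IsEvolution.lattice_step (hN : N.OnLattice) {x₀ : QState S C} {X : ℝ → QState S C}
    (hX : N.IsEvolution x₀ X) (n : ℕ) (hn : N.Regular (X (hund n))) :
    (∀ r ∈ Set.Ico (hund n) (hund (n + 1)), X r = (X (hund n)).flow (r - hund n)) ∧
      N.Settles (hund (n + 1)) ((X (hund n)).flow (1 / 100)) (X (hund (n + 1))) := by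
  set a := hund n with ha
  set b := hund (n + 1) with hb
  have hab : b = a + 1 / 100 := hund_succ n
  have ha0 : 0 ≤ a := hund_nonneg n
  -- the left condition at a time `v`, restated with the state at time `a`
  have key : ∀ v, a < v → (∀ r ∈ Set.Ico a v, X r = (X a).flow (r - a)) →
      N.Settles v ((X a).flow (v - a)) (X v) := by
    intro v hav hf
    obtain ⟨s, hs0, hsv, hs, hset⟩ := hX.left v (ha0.trans_lt hav)
    have h1 : X (max s a) = (X s).flow (max s a - s) :=
      hs _ ⟨le_max_left _ _, max_lt hsv hav⟩
    have h2 : X (max s a) = (X a).flow (max s a - a) :=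
      hf _ ⟨le_max_right _ _, max_lt hsv hav⟩
    have h3 : (X s).flow (v - s) = (X a).flow (v - a) := by
      have e1 : (X s).flow (v - s) = (X (max s a)).flow (v - max s a) := by
        rw [h1, QState.flow_flow]; congr 1; ring
      have e2 : (X a).flow (v - a) = (X (max s a)).flow (v - max s a) := by
        rw [h2, QState.flow_flow]; congr 1; ring
      rw [e1, e2]
    rwa [h3] at hset
  -- The supremum `w` of the times up to which `X` flows from `X a` is `b`: if `w < b`, nothing happens
  -- at time `w`, and the right condition at `w` extends the flow beyond `w`.
  let T : Set ℝ := {v | a ≤ v ∧ v ≤ b ∧ ∀ r ∈ Set.Ico a v, X r = (X a).flow (r - a)}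
  have haT : a ∈ T := ⟨le_rfl, by linarith, by simp⟩
  have hbdd : BddAbove T := ⟨b, fun v hv => hv.2.1⟩
  set w := sSup T with hw
  have haw : a ≤ w := le_csSup hbdd haT
  have hwb : w ≤ b := csSup_le ⟨a, haT⟩ (fun v hv => hv.2.1)
  have hwf : ∀ r ∈ Set.Ico a w, X r = (X a).flow (r - a) := by
    intro r hr
    obtain ⟨v, hv, hrv⟩ := exists_lt_of_lt_csSup ⟨a, haT⟩ hr.2
    exact hv.2.2 r ⟨hr.1, hrv⟩
  have hwb' : w = b := by
    by_contra hne
    have hlt : w < b := lt_of_le_of_ne hwb hne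
    have hXw : X w = (X a).flow (w - a) := by
      rcases haw.eq_or_lt with h | h
      · rw [← h, sub_self, QState.flow_zero]
      · exact (key w h hwf).eq_of_quiet (arrivals_eq_empty hN h hlt)
          (hn.flow_ne_zero (by linarith))
    obtain ⟨v, hwv, hv⟩ := hX.right w (ha0.trans haw)
    have hmem : min v b ∈ T := by
      refine ⟨haw.trans (le_min hwv.le hlt.le), min_le_right _ _, fun r hr => ?_⟩
      rcases lt_or_ge r w with h | h
      · exact hwf r ⟨hr.1, h⟩
      · rw [hv r ⟨h, hr.2.trans_le (min_le_left _ _)⟩, hXw, QState.flow_flow]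
        congr 1; ring
    have := le_csSup hbdd hmem
    have h2 : w < min v b := lt_min hwv hlt
    linarith
  rw [hwb'] at hwf
  refine ⟨hwf, ?_⟩
  have := key b (by linarith) hwf
  rwa [show b - a = 1 / 100 by linarith] at this

/-- A sequence of states which settles at every lattice time interpolates to an evolution. -/
theorem exists_isEvolution_of_seq (hN : N.OnLattice) (x : ℕ → QState S C)
    (h0 : ∀ n, N.Regular (x n))
    (h : ∀ n, N.Settles (hund (n + 1)) ((x n).flow (1 / 100)) (x (n + 1))) :
    ∃ X, N.IsEvolution (x 0) X := by
  let fl : ℝ → ℕ := fun u => ⌊100 * u⌋₊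
  let X : ℝ → QState S C := fun u => (x (fl u)).flow (u - hund (fl u))
  have hfl : ∀ (n : ℕ) (u : ℝ), hund n ≤ u → u < hund (n + 1) → fl u = n := by
    intro n u h1 h2
    have := hund_nonneg n
    rw [Nat.floor_eq_iff (by linarith)]
    simp only [hund] at h1 h2
    push_cast at h2
    constructor <;> linarith
  have hle : ∀ u, 0 ≤ u → hund (fl u) ≤ u := by
    intro u hu
    have := Nat.floor_le (show 0 ≤ 100 * u by linarith)
    simp only [hund, fl]; linarith
  have hlt : ∀ u, u < hund (fl u + 1) := by
    intro u
    have := Nat.lt_floor_add_one (100 * u)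
    simp only [hund, fl]; push_cast; linarith
  have hXn : ∀ n, X (hund n) = x n := by
    intro n
    have : fl (hund n) = n := hfl n _ le_rfl (hund_lt.2 (Nat.lt_succ_self n))
    simp only [X, this, sub_self, QState.flow_zero]
  have hXf : ∀ (n : ℕ) (s r : ℝ), hund n ≤ s → s ≤ r → r < hund (n + 1) →
      X r = (X s).flow (r - s) := by
    intro n s r h1 h2 h3
    simp only [X, hfl n s h1 (h2.trans_lt h3), hfl n r (h1.trans h2) h3, QState.flow_flow]
    congr 1; ring
  refine ⟨X, ⟨by rw [← hund_zero, hXn], ?_, ?_⟩⟩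
  · intro s hs
    exact ⟨hund (fl s + 1), hlt s, fun r hr => hXf (fl s) s r (hle s hs) hr.1 hr.2⟩
  · intro u hu
    rcases (hle u hu.le).eq_or_lt with h1 | h1
    · -- `u` is a lattice time
      obtain ⟨n, hn⟩ : ∃ n, fl u = n + 1 := by
        refine Nat.exists_eq_succ_of_ne_zero fun h2 => ?_
        rw [h2, hund_zero] at h1
        linarith
      rw [hn] at h1
      refine ⟨hund n, hund_nonneg n, h1 ▸ hund_lt.2 (Nat.lt_succ_self n), ?_, ?_⟩
      · intro r hr
        exact hXf n _ r le_rfl hr.1 (h1 ▸ hr.2)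
      · rw [← h1, hXn, hXn, hund_succ, add_sub_cancel_left, ← hund_succ]
        exact h n
    · refine ⟨hund (fl u), hund_nonneg _, h1, ?_, ?_⟩
      · intro r hr
        exact hXf (fl u) _ r le_rfl hr.1 (hr.2.trans (hlt u))
      · have h2 : X u = (X (hund (fl u))).flow (u - hund (fl u)) :=
          hXf (fl u) _ u le_rfl h1.le (hlt u)
        rw [← h2]
        refine ⟨?_, ?_⟩
        · rw [arrivals_eq_empty hN h1 (hlt u)]
        · have := hlt u
          rw [hund_succ] at this
          exact (h0 _).flow_ne_zero (by linarith)

end QNetwork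

namespace QNetwork

variable {S C : Type*} [DecidableEq S] [DecidableEq C] {N : QNetwork S C}

/-! ### Existence of evolutions -/

theorem exists_select (N : QNetwork S C) (s : S) (x : QState S C) : ∃ y, N.Select s x y := by
  by_cases h : x.serving s = none
  · by_cases hw : ∀ c, N.server c = s → x.waiting c = 0
    · exact ⟨x, .idle h hw⟩
    · push Not at hw
      obtain ⟨c, ⟨hc, hw⟩, hmin⟩ := (measure N.priority).wf.has_min
        {c | N.server c = s ∧ x.waiting c ≠ 0} hw
      exact ⟨_, .start h c hc (Nat.pos_of_ne_zero hw) fun c' h1 h2 =>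
        not_lt.1 (hmin c' ⟨h1, h2.ne'⟩)⟩
  · exact ⟨x, .busy h⟩

/-- A bound for the number of services with zero service time which a job entering a class
triggers: along a route, it decreases at every class with zero service time. -/
structure IsRank (N : QNetwork S C) (rank : C → ℕ) (K : ℕ) : Prop where
  lt : ∀ c, rank c < K
  eq_zero : ∀ c, N.service c ≠ 0 → rank c = 0
  pos : ∀ c, N.service c = 0 → 0 < rank c
  next_lt : ∀ c d, N.service c = 0 → N.next c = some d → rank d < rank c

open Classical in
/-- The contribution of the job in service at a server to the potential. -/
def servingRank (N : QNetwork S C) (rank : C → ℕ) (K : ℕ) : Option (C × ℝ) → ℕ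
  | none => 0
  | some (c, r) => if N.service c = 0 then rank c else if r = 0 then K else 0

/-- The potential of a state: it bounds the number of events which can still happen without any
external arrival before time goes on. -/
def potential [Fintype S] [Fintype C] (N : QNetwork S C) (rank : C → ℕ) (K : ℕ)
    (x : QState S C) : ℕ :=
  ∑ c, x.waiting c * rank c + ∑ s, servingRank N rank K (x.serving s)

theorem sum_add_eq_of_eq_off {ι : Type*} [Fintype ι] [DecidableEq ι] {f g : ι → ℕ} (i : ι)
    (h : ∀ j, j ≠ i → f j = g j) : ∑ j, f j + g i = ∑ j, g j + f i := by
  rw [← Finset.add_sum_erase _ f (Finset.mem_univ i), ← Finset.add_sum_erase _ g (Finset.mem_univ i),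
    Finset.sum_congr rfl fun j hj => h j (Finset.ne_of_mem_erase hj)]
  ring

section Potential

variable [Fintype S] [Fintype C] {rank : C → ℕ} {K : ℕ}

theorem servingRank_start (hr : IsRank N rank K) (c : C) :
    servingRank N rank K (some (c, (N.service c : ℝ))) = rank c := by
  by_cases h : N.service c = 0
  · simp [servingRank, h]
  · simp [servingRank, h, hr.eq_zero c h]

theorem potential_startJob (hr : IsRank N rank K) {c : C} {x : QState S C}
    (h : x.serving (N.server c) = none) :
    potential N rank K (N.startJob c x) = potential N rank K x + rank c := by
  have := sum_add_eq_of_eq_off (f := fun s => servingRank N rank K ((N.startJob c x).serving s))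
    (g := fun s => servingRank N rank K (x.serving s)) (N.server c)
    (fun s hs => by simp [startJob, hs])
  simp only [startJob, Function.update_self, servingRank_start hr, h] at this
  simp only [potential, startJob]
  simp only [servingRank] at this ⊢
  omega

theorem potential_waiting (c : C) (x : QState S C) (n : ℕ) :
    potential N rank K { x with waiting := Function.update x.waiting c n } + x.waiting c * rank c =
      potential N rank K x + n * rank c := by
  have := sum_add_eq_of_eq_off (f := fun d => Function.update x.waiting c n d * rank d)
    (g := fun d => x.waiting d * rank d) c (fun s hs => by simp [hs])
  simp only [Function.update_self] at this
  simp only [potential]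
  omega

theorem potential_join (hr : IsRank N rank K) (c : C) (x : QState S C) :
    potential N rank K (N.join c x) ≤ potential N rank K x + rank c := by
  unfold join
  split_ifs with h1 h2
  · exact (potential_startJob hr h1.1).le
  · have := potential_waiting (N := N) (rank := rank) (K := K) c x (x.waiting c + 1)
    rw [add_mul, one_mul] at this
    omega
  · omega

theorem potential_free {s : S} {x : QState S C} :
    potential N rank K (free s x) + servingRank N rank K (x.serving s) =
      potential N rank K x := by
  have := sum_add_eq_of_eq_off (f := fun t => servingRank N rank K ((free s x).serving t))
    (g := fun t => servingRank N rank K (x.serving t)) s (fun t ht => by simp [free, ht])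
  have h0 : servingRank N rank K ((free s x).serving s) = 0 := by simp [free, servingRank]
  rw [h0] at this
  have hw : (free s x).waiting = x.waiting := rfl
  simp only [potential, hw]
  omega

theorem Select.potential_eq (hr : IsRank N rank K) {s : S} {x y : QState S C}
    (h : N.Select s x y) : potential N rank K y = potential N rank K x := by
  cases h with
  | busy h => rfl
  | idle h hw => rfl
  | start h c hc hw hp =>
    rw [potential_startJob hr (by subst hc; exact h)]
    have := potential_waiting (N := N) (rank := rank) (K := K) c x (x.waiting c - 1)
    obtain ⟨n, hn⟩ : ∃ n, x.waiting c = n + 1 := ⟨x.waiting c - 1, by omega⟩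
    simp only [hn, Nat.add_sub_cancel, add_mul, one_mul] at this ⊢
    omega

open Classical in
/-- The number of events which can still happen at the current instant is bounded. -/
theorem Event.potential_lt (hr : IsRank N rank K) {p q : QState S C × Set C}
    (h : N.Event p q) :
    potential N rank K q.1 + ∑ c, (if c ∈ q.2 then K else 0) <
      potential N rank K p.1 + ∑ c, (if c ∈ p.2 then K else 0) := by
  cases h with
  | finish x y P s c hs hu hy =>
    simp only [add_lt_add_iff_right]
    have h1 := potential_free (N := N) (rank := rank) (K := K) (s := s) (x := x)
    rw [hy.potential_eq hr]
    have h2 : potential N rank K (N.route c (free s x)) + 1 ≤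
        potential N rank K (free s x) + servingRank N rank K (x.serving s) := by
      rw [hs]
      unfold route
      have hK := hr.lt c
      have hp := hr.pos c
      split
      · simp only [servingRank]
        split_ifs with h0 h0
        · have := hp h0; omega
        · omega
      · rename_i d hd
        have h3 := potential_join hr d (free s x)
        have h4 := hr.lt d
        have h5 := hr.next_lt c d
        simp only [servingRank]
        split_ifs with h0 h0
        · have := h5 h0 hd; omega
        · omega
    omega
  | arrive x P c hc hu =>
    have h1 := potential_join hr c x
    have h2 := hr.lt c
    have h3 := sum_add_eq_of_eq_off (f := fun d => if d ∈ P \ {c} then K else 0)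
      (g := fun d => if d ∈ P then K else 0) c (fun d hd => by simp [hd])
    simp only [hc, Set.mem_sdiff, Set.mem_singleton_iff, not_true_eq_false, and_false, if_true,
      if_false] at h3
    simp only [Set.mem_sdiff, Set.mem_singleton_iff]
    omega

/-- The events of an instant can be carried out: passing jobs are served first, then the services
which are due are completed, then arrivals are admitted. The potential makes this terminate. -/
theorem exists_settles (hN : N.OnLattice) (hr : IsRank N rank K) (u : ℝ) (x : QState S C)
    (hx : N.Tidy x) : ∃ y, N.Settles u x y := by
  classical
  suffices H : ∀ (n : ℕ) (p : QState S C × Set C), N.Tidy p.1 →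
      potential N rank K p.1 + ∑ c, (if c ∈ p.2 then K else 0) = n →
      ∃ y, Relation.ReflTransGen N.Event p (y, ∅) ∧ ∀ s c, y.serving s ≠ some (c, 0) from
    H _ (x, N.arrivals u) hx rfl
  intro n
  induction n using Nat.strong_induction_on with
  | _ n ih =>
    rintro ⟨x, P⟩ hx hn
    have step : ∀ q, N.Event (x, P) q →
        ∃ y, Relation.ReflTransGen N.Event (x, P) (y, ∅) ∧ ∀ s c, y.serving s ≠ some (c, 0) := by
      intro q hq
      obtain ⟨y, h1, h2⟩ := ih _ (hn ▸ hq.potential_lt hr) q (hq.tidy hN hx) rfl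
      exact ⟨y, h1.head hq, h2⟩
    by_cases hp : N.Passing x
    · obtain ⟨s, c, r, h1, h2⟩ := hp
      obtain rfl := (hx s c r h1).2 h2
      obtain ⟨y, hy⟩ := exists_select N s (N.route c (free s x))
      exact step _ (.finish x y P s c h1 (.inl h2) hy)
    · by_cases hd : ∃ s c, x.serving s = some (c, 0)
      · obtain ⟨s, c, h1⟩ := hd
        obtain ⟨y, hy⟩ := exists_select N s (N.route c (free s x))
        exact step _ (.finish x y P s c h1 (.inr hp) hy)
      · push Not at hd
        by_cases hP : P = ∅
        · exact ⟨x, hP ▸ .refl, hd⟩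
        · obtain ⟨c, hc⟩ := Set.nonempty_iff_ne_empty.2 hP
          exact step _ (.arrive x P c hc hp)

/-- A network on the lattice whose routes do not contain a cycle of classes with zero service time
has an evolution. -/
theorem exists_isEvolution (hN : N.OnLattice) (hr : IsRank N rank K) {x₀ : QState S C}
    (hx₀ : N.Regular x₀) : ∃ X, N.IsEvolution x₀ X := by
  choose! f hf using fun u x => exists_settles hN hr u x
  let x : ℕ → QState S C := fun n =>
    Nat.rec x₀ (fun n y => f (hund (n + 1)) (y.flow (1 / 100))) n
  have hreg : ∀ n, N.Regular (x n) := by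
    intro n
    induction n with
    | zero => exact hx₀
    | succ n ih => exact (hf _ _ ih.tidy_flow).regular hN ih.tidy_flow
  exact exists_isEvolution_of_seq hN x hreg fun n => hf _ _ (hreg n).tidy_flow

end Potential

/-! ### Letting the jobs with zero service time pass -/

/-- The completion of a service of zero length. -/
def ZeroFinish (N : QNetwork S C) (x y : QState S C) : Prop :=
  ∃ s c, x.serving s = some (c, 0) ∧ N.service c = 0 ∧ N.Select s (N.route c (free s x)) y

/-- `z` results from `x` by letting all jobs with zero service time which are in service pass,
including those whose service begins meanwhile. -/
def Flush (N : QNetwork S C) (x z : QState S C) : Prop :=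
  Relation.ReflTransGen N.ZeroFinish x z ∧ ¬ N.Passing z

theorem Flush.eq {x z : QState S C} (h : N.Flush x z) (hx : ¬ N.Passing x) : z = x := by
  rcases Relation.ReflTransGen.cases_head h.1 with h2 | ⟨q, ⟨s, c, h1, h2, _⟩, _⟩
  · exact h2.symm
  · exact absurd ⟨s, c, 0, h1, h2⟩ hx

theorem free_startJob {c : C} {x : QState S C} (h : x.serving (N.server c) = none) :
    free (N.server c) (N.startJob c x) = x := by
  ext1
  · rfl
  · funext s
    by_cases hs : s = N.server c
    · subst hs; simp [free, h]
    · simp [free, startJob, hs]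

/-- If no other job is passing, a job with zero service time which begins service is routed on,
and its server selects the next job. -/
theorem Flush.startJob {c : C} {x z : QState S C} (h : N.Flush (N.startJob c x) z)
    (hx : ¬ N.Passing x) (hs : x.serving (N.server c) = none) (hc : N.service c = 0) :
    ∃ y, N.Select (N.server c) (N.route c x) y ∧ N.Flush y z := by
  rcases Relation.ReflTransGen.cases_head h.1 with h2 | ⟨q, ⟨s, d, h1, h2, h3⟩, h4⟩
  · exact absurd (h2 ▸ ⟨N.server c, c, 0, by simp [QNetwork.startJob, hc], hc⟩) h.2
  · by_cases hsc : s = N.server c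
    · subst hsc
      simp only [QNetwork.startJob, Function.update_self, Option.some.injEq, Prod.mk.injEq] at h1
      obtain ⟨rfl, _⟩ := h1
      rw [free_startJob hs] at h3
      exact ⟨q, h3, h4, h.2⟩
    · simp only [QNetwork.startJob, Function.update_of_ne hsc] at h1
      exact absurd ⟨s, d, 0, h1, h2⟩ hx

/-- To show that a property holds whenever no job is passing, it suffices to follow each event
together with the passing jobs which it sets in motion. -/
theorem invariant_of_flush {I : QState S C → Set C → Prop}
    (hI : ∀ x P, I x P → ¬ N.Passing x)
    (hf : ∀ x P s c y z, I x P → x.serving s = some (c, 0) →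
      N.Select s (N.route c (free s x)) y → N.Flush y z → I z P)
    (ha : ∀ x P c z, I x P → c ∈ P → N.Flush (N.join c x) z → I z (P \ {c}))
    {x y : QState S C} {P Q : Set C} (h : Relation.ReflTransGen N.Event (x, P) (y, Q))
    (hx : I x P) (hy : ∀ s c, N.service c = 0 → ∀ r, y.serving s ≠ some (c, r)) : I y Q := by
  suffices H : ∀ q, Relation.ReflTransGen N.Event (x, P) q → ∀ z, N.Flush q.1 z → I z q.2 from
    H _ h y ⟨.refl, fun ⟨s, c, r, h1, h2⟩ => hy s c h2 r h1⟩
  intro q hq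
  induction hq with
  | refl =>
    intro z hz
    rw [hz.eq (hI _ _ hx)]
    exact hx
  | @tail p q _ hpq ih =>
    intro z hz
    by_cases hp : N.Passing p.1
    · cases hpq with
      | finish x y P s c hs hu hy =>
        have hc : N.service c = 0 := hu.resolve_right (by simpa using hp)
        exact ih z ⟨hz.1.head ⟨s, c, hs, hc, hy⟩, hz.2⟩
      | arrive x P c hc hu => exact absurd hp hu
    · have hIp := ih p.1 ⟨.refl, hp⟩
      cases hpq with
      | finish x y P s c hs hu hy => exact hf _ _ s c y z hIp hs hy hz
      | arrive x P c hc hu => exact ha _ _ c z hIp hc hz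

end QNetwork

/-! ### States of the simulating network in natural numbers -/

/-- The state of a subnetwork `SN_i`, with remaining service times in hundredths. -/
structure SubState where
  /-- remaining service time of the `c12` job in service at the first server -/
  o1 : Option ℕ
  /-- remaining service time of the `c21` job in service at the second server -/
  o2 : Option ℕ
  /-- jobs waiting in the classes `c11`, `c12`, `c21`, `c22` -/
  w11 : ℕ
  w12 : ℕ
  w21 : ℕ
  w22 : ℕ
  /-- the job in service at the third server: `(true, r)` in class `c32`, `(false, r)` in `c31` -/
  o3 : Option (Bool × ℕ)
  /-- jobs waiting in the class `c31` -/
  w31 : ℕ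
  /-- remaining service time of the `c41` job in service at the fourth server -/
  o4 : Option ℕ
  /-- remaining service time of the `c51` job in service at the fifth server -/
  o5 : Option ℕ

/-- A state of the network in which no job is passing, with remaining service times in hundredths.
Only the states which the network can reach are encoded; in particular at most one job is in the
classes `m31`, `m32`, `m33`, `m34`, and at most one job waits in the classes `m03`. -/
structure NetState (m : ℕ) where
  /-- the subnetworks -/
  sub : Fin 2 → SubState
  /-- the job in service at `S01`: `(i, r)` in class `m01 i` -/
  o01 : Option (Fin 2 × ℕ)
  /-- jobs waiting in `m01 i` -/
  w01 : Fin 2 → ℕ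
  /-- the class `m03 k` in which a job waits, if any -/
  w03 : Option (Fin m)
  /-- the job in service at `S02`: `(k, r)` in class `m02 k` -/
  o02 : Option (Fin m × ℕ)
  /-- the job in the classes `m31`, …, `m34`: `(p, k, r)` in the class `probe p k` -/
  walk : Option (Fin 4 × Fin m × ℕ)
  /-- remaining service time of the `m41 j` job in service at `S4 j` -/
  o4 : Fin m → Option ℕ

namespace NetState

/-- Replace the state of the `i`-th subnetwork. -/
def setSub {m : ℕ} (a : NetState m) (i : Fin 2) (s : SubState) : NetState m :=
  { a with sub := Function.update a.sub i s }

end NetState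

namespace SCM

variable {m : ℕ} (M : SCM m)

/-- The classes `m31 k`, `m32 k`, `m33 k`, `m34 k`, which a job visits in this order. -/
def probe (p : Fin 4) (k : Fin m) : Cls m :=
  match p with
  | 0 => .m31 k
  | 1 => .m32 k
  | 2 => .m33 k
  | 3 => .m34 k

/-- The counter pattern to which the class `probe p k` belongs. -/
def bits (p : Fin 4) : Fin 2 → Bool :=
  match p with
  | 0 => ![true, true]
  | 1 => ![false, true]
  | 2 => ![true, false]
  | 3 => ![false, false]

/-- The job in service at the server `sub i l`, if `s` encodes the state of the subnetwork. -/
def subServing (i : Fin 2) (s : SubState) (l : Fin 5) : Option (Cls m × ℝ) :=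
  match l with
  | 0 => s.o1.map fun r => (.c12 i, hund r)
  | 1 => s.o2.map fun r => (.c21 i, hund r)
  | 2 => s.o3.map fun p => (if p.1 then .c32 i else .c31 i, hund p.2)
  | 3 => s.o4.map fun r => (.c41 i, hund r)
  | 4 => s.o5.map fun r => (.c51 i, hund r)

/-- The state of the network which is encoded by `a`. -/
def conc (a : NetState m) : QState (Srv m) (Cls m) where
  waiting
    | .c11 i => (a.sub i).w11
    | .c12 i => (a.sub i).w12
    | .c21 i => (a.sub i).w21
    | .c22 i => (a.sub i).w22
    | .c31 i => (a.sub i).w31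
    | .m01 i => a.w01 i
    | .m03 k => if a.w03 = some k then 1 else 0
    | _ => 0
  serving
    | .sub i l => subServing i (a.sub i) l
    | .S01 => a.o01.map fun p => (.m01 p.1, hund p.2)
    | .S02 => a.o02.map fun p => (.m02 p.1, hund p.2)
    | .S3 j => a.walk.bind fun p =>
        if M.α p.2.1 (bits p.1) = j then some (probe p.1 p.2.1, hund p.2.2) else none
    | .S4 j => (a.o4 j).map fun r => (.m41 j, hund r)

theorem waiting_setSub (a : NetState m) (i : Fin 2) (s : SubState) (c : Cls m) :
    (M.conc (a.setSub i s)).waiting c = match c with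
      | .c11 j => if j = i then s.w11 else (a.sub j).w11
      | .c12 j => if j = i then s.w12 else (a.sub j).w12
      | .c21 j => if j = i then s.w21 else (a.sub j).w21
      | .c22 j => if j = i then s.w22 else (a.sub j).w22
      | .c31 j => if j = i then s.w31 else (a.sub j).w31
      | c => (M.conc a).waiting c := by
  cases c <;> first
    | rfl
    | (simp only [conc, NetState.setSub, Function.update_apply]; split_ifs <;> rfl)

theorem serving_setSub (a : NetState m) (i : Fin 2) (s : SubState) (v : Srv m) :
    (M.conc (a.setSub i s)).serving v = match v with
      | .sub j l => if j = i then subServing i s l else subServing j (a.sub j) l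
      | v => (M.conc a).serving v := by
  rcases v with ⟨j, l⟩ | _ | _ | _ | _
  · by_cases h : j = i
    · subst h
      simp [conc, NetState.setSub]
    · simp [conc, NetState.setSub, h]
  all_goals rfl

theorem conc_w11 (a : NetState m) (i : Fin 2) (n : ℕ) :
    ⟨Function.update (M.conc a).waiting (.c11 i) n, (M.conc a).serving⟩ =
      M.conc (a.setSub i { a.sub i with w11 := n }) := by
  ext1
  · funext c
    rw [waiting_setSub]
    cases c <;> simp [Function.update_apply, conc] <;> (try intro h) <;>
      simp_all
  · funext v
    rw [serving_setSub]
    rcases v with ⟨j, l⟩ | _ | _ | _ | _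
    · fin_cases l <;> simp [conc, subServing] <;> intro h <;> simp_all
    all_goals rfl

theorem conc_w12 (a : NetState m) (i : Fin 2) (n : ℕ) :
    ⟨Function.update (M.conc a).waiting (.c12 i) n, (M.conc a).serving⟩ =
      M.conc (a.setSub i { a.sub i with w12 := n }) := by
  ext1
  · funext c
    rw [waiting_setSub]
    cases c <;> simp [Function.update_apply, conc] <;> (try intro h) <;>
      simp_all
  · funext v
    rw [serving_setSub]
    rcases v with ⟨j, l⟩ | _ | _ | _ | _
    · fin_cases l <;> simp [conc, subServing] <;> intro h <;> simp_all
    all_goals rfl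

theorem conc_w21 (a : NetState m) (i : Fin 2) (n : ℕ) :
    ⟨Function.update (M.conc a).waiting (.c21 i) n, (M.conc a).serving⟩ =
      M.conc (a.setSub i { a.sub i with w21 := n }) := by
  ext1
  · funext c
    rw [waiting_setSub]
    cases c <;> simp [Function.update_apply, conc] <;> (try intro h) <;>
      simp_all
  · funext v
    rw [serving_setSub]
    rcases v with ⟨j, l⟩ | _ | _ | _ | _
    · fin_cases l <;> simp [conc, subServing] <;> intro h <;> simp_all
    all_goals rfl

theorem conc_w22 (a : NetState m) (i : Fin 2) (n : ℕ) :
    ⟨Function.update (M.conc a).waiting (.c22 i) n, (M.conc a).serving⟩ =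
      M.conc (a.setSub i { a.sub i with w22 := n }) := by
  ext1
  · funext c
    rw [waiting_setSub]
    cases c <;> simp [Function.update_apply, conc] <;> (try intro h) <;>
      simp_all
  · funext v
    rw [serving_setSub]
    rcases v with ⟨j, l⟩ | _ | _ | _ | _
    · fin_cases l <;> simp [conc, subServing] <;> intro h <;> simp_all
    all_goals rfl

theorem conc_w31 (a : NetState m) (i : Fin 2) (n : ℕ) :
    ⟨Function.update (M.conc a).waiting (.c31 i) n, (M.conc a).serving⟩ =
      M.conc (a.setSub i { a.sub i with w31 := n }) := by
  ext1
  · funext c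
    rw [waiting_setSub]
    cases c <;> simp [Function.update_apply, conc] <;> (try intro h) <;>
      simp_all
  · funext v
    rw [serving_setSub]
    rcases v with ⟨j, l⟩ | _ | _ | _ | _
    · fin_cases l <;> simp [conc, subServing] <;> intro h <;> simp_all
    all_goals rfl

theorem conc_o1 (a : NetState m) (i : Fin 2) (n : Option ℕ) :
    ⟨(M.conc a).waiting, Function.update (M.conc a).serving (.sub i 0)
        (n.map fun r => (.c12 i, hund r))⟩ =
      M.conc (a.setSub i { a.sub i with o1 := n }) := by
  ext1
  · funext c
    rw [waiting_setSub]
    cases c <;> simp [conc] <;> intro h <;> simp_all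
  · funext v
    rw [serving_setSub]
    rcases v with ⟨j, l⟩ | _ | _ | _ | _
    · fin_cases l <;> simp [conc, subServing, Function.update_apply] <;> (try intro h) <;>
        simp_all
    all_goals simp

theorem conc_o2 (a : NetState m) (i : Fin 2) (n : Option ℕ) :
    ⟨(M.conc a).waiting, Function.update (M.conc a).serving (.sub i 1)
        (n.map fun r => (.c21 i, hund r))⟩ =
      M.conc (a.setSub i { a.sub i with o2 := n }) := by
  ext1
  · funext c
    rw [waiting_setSub]
    cases c <;> simp [conc] <;> intro h <;> simp_all
  · funext v
    rw [serving_setSub]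
    rcases v with ⟨j, l⟩ | _ | _ | _ | _
    · fin_cases l <;> simp [conc, subServing, Function.update_apply] <;> (try intro h) <;>
        simp_all
    all_goals simp

theorem conc_o3 (a : NetState m) (i : Fin 2) (n : Option (Bool × ℕ)) :
    ⟨(M.conc a).waiting, Function.update (M.conc a).serving (.sub i 2)
        (n.map fun p => (if p.1 then .c32 i else .c31 i, hund p.2))⟩ =
      M.conc (a.setSub i { a.sub i with o3 := n }) := by
  ext1
  · funext c
    rw [waiting_setSub]
    cases c <;> simp [conc] <;> intro h <;> simp_all
  · funext v
    rw [serving_setSub]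
    rcases v with ⟨j, l⟩ | _ | _ | _ | _
    · fin_cases l <;> simp [conc, subServing, Function.update_apply] <;> (try intro h) <;>
        simp_all
    all_goals simp

theorem conc_o4 (a : NetState m) (i : Fin 2) (n : Option ℕ) :
    ⟨(M.conc a).waiting, Function.update (M.conc a).serving (.sub i 3)
        (n.map fun r => (.c41 i, hund r))⟩ =
      M.conc (a.setSub i { a.sub i with o4 := n }) := by
  ext1
  · funext c
    rw [waiting_setSub]
    cases c <;> simp [conc] <;> intro h <;> simp_all
  · funext v
    rw [serving_setSub]
    rcases v with ⟨j, l⟩ | _ | _ | _ | _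
    · fin_cases l <;> simp [conc, subServing, Function.update_apply] <;> (try intro h) <;>
        simp_all
    all_goals simp

theorem conc_o5 (a : NetState m) (i : Fin 2) (n : Option ℕ) :
    ⟨(M.conc a).waiting, Function.update (M.conc a).serving (.sub i 4)
        (n.map fun r => (.c51 i, hund r))⟩ =
      M.conc (a.setSub i { a.sub i with o5 := n }) := by
  ext1
  · funext c
    rw [waiting_setSub]
    cases c <;> simp [conc] <;> intro h <;> simp_all
  · funext v
    rw [serving_setSub]
    rcases v with ⟨j, l⟩ | _ | _ | _ | _
    · fin_cases l <;> simp [conc, subServing, Function.update_apply] <;> (try intro h) <;>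
        simp_all
    all_goals simp

theorem conc_w01 (a : NetState m) (i : Fin 2) (n : ℕ) :
    ⟨Function.update (M.conc a).waiting (.m01 i) n, (M.conc a).serving⟩ =
      M.conc { a with w01 := Function.update a.w01 i n } := by
  ext1
  · funext c
    cases c <;> simp [Function.update_apply, conc]
  · rfl

theorem conc_w03_some (a : NetState m) (k : Fin m) (h : a.w03 = none) :
    ⟨Function.update (M.conc a).waiting (.m03 k) 1, (M.conc a).serving⟩ =
      M.conc { a with w03 := some k } := by
  ext1
  · funext c
    cases c <;> simp [Function.update_apply, conc, h, eq_comm (a := k)]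
  · rfl

theorem conc_w03_none (a : NetState m) (k : Fin m) (h : a.w03 = some k) :
    ⟨Function.update (M.conc a).waiting (.m03 k) 0, (M.conc a).serving⟩ =
      M.conc { a with w03 := none } := by
  ext1
  · funext c
    cases c <;> simp [Function.update_apply, conc, h, eq_comm (a := k)]
  · rfl

theorem conc_o01 (a : NetState m) (n : Option (Fin 2 × ℕ)) :
    ⟨(M.conc a).waiting, Function.update (M.conc a).serving .S01
      (n.map fun p => (.m01 p.1, hund p.2))⟩ = M.conc { a with o01 := n } := by
  ext1
  · rfl
  · funext v
    rcases v with ⟨j, l⟩ | _ | _ | _ | _ <;> simp [conc]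

theorem conc_o02 (a : NetState m) (n : Option (Fin m × ℕ)) :
    ⟨(M.conc a).waiting, Function.update (M.conc a).serving .S02
      (n.map fun p => (.m02 p.1, hund p.2))⟩ = M.conc { a with o02 := n } := by
  ext1
  · rfl
  · funext v
    rcases v with ⟨j, l⟩ | _ | _ | _ | _ <;> simp [conc]

theorem conc_o4j (a : NetState m) (j : Fin m) (n : Option ℕ) :
    ⟨(M.conc a).waiting, Function.update (M.conc a).serving (.S4 j)
      (n.map fun r => (.m41 j, hund r))⟩ =
      M.conc { a with o4 := Function.update a.o4 j n } := by
  ext1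
  · rfl
  · funext v
    rcases v with ⟨j, l⟩ | _ | _ | _ | _ <;> simp [conc, Function.update_apply]
    split_ifs with h <;> simp_all

theorem conc_walk_some (a : NetState m) (p : Fin 4) (k : Fin m) (r : ℕ) (h : a.walk = none) :
    ⟨(M.conc a).waiting, Function.update (M.conc a).serving (.S3 (M.α k (bits p)))
      (some (probe p k, hund r))⟩ = M.conc { a with walk := some (p, k, r) } := by
  ext1
  · rfl
  · funext v
    rcases v with ⟨j, l⟩ | _ | _ | _ | _ <;> simp [conc, Function.update_apply, h]
    split_ifs with h <;> simp_all

theorem conc_walk_none (a : NetState m) (p : Fin 4) (k : Fin m) (r : ℕ)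
    (h : a.walk = some (p, k, r)) :
    ⟨(M.conc a).waiting, Function.update (M.conc a).serving (.S3 (M.α k (bits p))) none⟩ =
      M.conc { a with walk := none } := by
  ext1
  · rfl
  · funext v
    rcases v with ⟨j, l⟩ | _ | _ | _ | _ <;> simp [conc, Function.update_apply, h]
    intro h1 h2
    exact absurd h2.symm h1

/-! ### Properties of the simulating network -/

/-- The service times in hundredths. -/
def svcHund : Cls m → ℕ
  | .c12 _ => 50
  | .c21 _ => 50
  | .c31 _ => 4
  | .c32 _ => 110
  | .c41 _ => 20
  | .c51 _ => 2
  | .m01 i => if i = 0 then 9 else 18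
  | .m02 _ => 271
  | .m31 _ => 9 | .m32 _ => 9 | .m33 _ => 9 | .m34 _ => 9
  | .m41 _ => 2
  | _ => 0

theorem srvTime_eq (c : Cls m) : ((srvTime c : ℚ≥0) : ℝ) = hund (svcHund c) := by
  cases c
  case m01 i => fin_cases i <;> norm_num [srvTime, svcHund, hund]
  all_goals norm_num [srvTime, svcHund, hund]

instance : Finite (Srv m) := by
  apply Set.finite_univ_iff.1
  refine ((Set.finite_range fun p : Fin 2 × Fin 5 => Srv.sub p.1 p.2).union <|
    (Set.finite_singleton Srv.S01).union <| (Set.finite_singleton Srv.S02).union <|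
    (Set.finite_range Srv.S3).union (Set.finite_range Srv.S4)).subset fun s _ => ?_
  cases s <;> simp

instance : Finite (Cls m) := by
  apply Set.finite_univ_iff.1
  have hs : ∀ f : Fin 2 → Cls m, (Set.range f).Finite := fun f => Set.finite_range f
  have hm : ∀ f : Fin m → Cls m, (Set.range f).Finite := fun f => Set.finite_range f
  refine ((hs .c11).union <| (hs .c12).union <| (hs .c13).union <| (hs .c14).union <|
    (hs .c21).union <| (hs .c22).union <| (hs .c23).union <| (hs .c31).union <|
    (hs .c32).union <| (hs .c33).union <| (hs .c41).union <| (hs .c42).union <|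
    (hs .c51).union <| (hs .m01).union <| (hm .m02).union <| (hm .m03).union <|
    (hm .m31).union <| (hm .m32).union <| (hm .m33).union <| (hm .m34).union <|
    (hm .m35).union <| (hm .m41).union <| (hm .m42).union (hm .m43)).subset fun c _ => ?_
  cases c <;> simp

/-- The classes with zero service time which feed a class with zero service time have rank two. -/
def zeroRank : Cls m → ℕ
  | .c42 _ => 2
  | .c11 _ | .c13 _ | .c14 _ | .c22 _ | .c23 _ | .c33 _ => 1
  | .m03 _ | .m35 _ | .m42 _ | .m43 _ => 1
  | _ => 0

theorem isRank_zeroRank : QNetwork.IsRank M.network zeroRank 3 where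
  lt c := by cases c <;> simp [zeroRank]
  eq_zero c h := by cases c <;> simp_all [network, srvTime, zeroRank]
  pos c h := by
    cases c <;> simp_all [network, srvTime, zeroRank]
    split_ifs at h <;> simp_all
  next_lt c d h hd := by
    cases c <;> simp_all [network, srvTime, nextCls]
    all_goals try subst hd
    all_goals try simp [zeroRank]
    split_ifs at hd <;> simp_all <;> subst hd <;> simp

end SCM

/-! ### Arrivals and services in terms of the encoded states -/

namespace QNetwork

variable {S C : Type*} [DecidableEq S] [DecidableEq C] {N : QNetwork S C}

theorem join_eq_startJob {c : C} {x : QState S C} (h : N.CanBegin c x) :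
    N.join c x = N.startJob c x := if_pos h

theorem join_eq_wait {c : C} {x : QState S C} (h : ¬ N.CanBegin c x) (hc : N.capacity c = ⊤) :
    N.join c x = ⟨Function.update x.waiting c (x.waiting c + 1), x.serving⟩ := by
  unfold join
  rw [if_neg h, if_pos (by simp [hc])]

theorem join_eq_self {c : C} {x : QState S C} (h : ¬ N.CanBegin c x) (hc : N.capacity c = 0) :
    N.join c x = x := by
  unfold join
  rw [if_neg h, if_neg (by simp [hc])]

/-- A server without waiting jobs does not start a new service. -/
theorem Select.eq_of_empty {s : S} {x y : QState S C} (h : N.Select s x y)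
    (hs : ∀ c, N.server c = s → x.waiting c = 0) : y = x := by
  cases h with
  | busy => rfl
  | idle => rfl
  | start _ c hc hw => exact absurd (hs c hc) hw.ne'

/-- If a single nonempty queue of an idle server has the highest priority, the selection is
determined. -/
theorem Select.eq_start {s : S} {x y : QState S C} (h : N.Select s x y)
    (hs : x.serving s = none) (d : C) (hd : N.server d = s) (hw : 0 < x.waiting d)
    (hp : ∀ c, N.server c = s → 0 < x.waiting c → c ≠ d → N.priority d < N.priority c) :
    y = N.startJob d ⟨Function.update x.waiting d (x.waiting d - 1), x.serving⟩ := by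
  cases h with
  | busy h => exact absurd hs h
  | idle _ h => exact absurd (h d hd) hw.ne'
  | start _ c hc hwc hpc =>
    by_cases hcd : c = d
    · subst hcd; rfl
    · exact absurd (hpc d hd hw) (not_le.2 (hp c hc hwc hcd))

end QNetwork

namespace SCM

variable {m : ℕ} (M : SCM m)

theorem not_passing_conc (a : NetState m) : ¬ M.network.Passing (M.conc a) := by
  rintro ⟨v, c, r, h1, h2⟩
  have h3 : svcHund c = 0 := by
    rw [← hund_eq_zero, ← srvTime_eq]
    simpa [network] using h2
  have key : svcHund c ≠ 0 := by
    rcases v with ⟨i, l⟩ | _ | _ | j | j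
    · fin_cases l <;> simp [conc, subServing] at h1
      · obtain ⟨_, _, rfl, _⟩ := h1; simp [svcHund]
      · obtain ⟨_, _, rfl, _⟩ := h1; simp [svcHund]
      · rcases h1 with ⟨_, _, rfl, _⟩ | ⟨_, _, rfl, _⟩ <;> simp [svcHund]
      · obtain ⟨_, _, rfl, _⟩ := h1; simp [svcHund]
      · obtain ⟨_, _, rfl, _⟩ := h1; simp [svcHund]
    · simp [conc] at h1
      rcases h1 with ⟨_, _, rfl, _⟩ | ⟨_, _, rfl, _⟩ <;> simp [svcHund]
    · simp [conc] at h1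
      obtain ⟨x, y, _, rfl, _⟩ := h1
      simp [svcHund]
    · simp [conc, Option.bind_eq_some_iff] at h1
      obtain ⟨p, k, r, h1, h2, rfl, h3⟩ := h1
      fin_cases p <;> simp [svcHund, probe]
    · simp [conc] at h1
      obtain ⟨x, _, rfl, _⟩ := h1
      simp [svcHund]
  exact key h3

theorem startJob_c12 (a : NetState m) (i : Fin 2) : M.network.startJob (.c12 i) (M.conc a) =
    M.conc (a.setSub i { a.sub i with o1 := some 50 }) := by
  rw [← conc_o1]
  simp [QNetwork.startJob, network, srv, srvTime_eq, svcHund]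

theorem startJob_c21 (a : NetState m) (i : Fin 2) : M.network.startJob (.c21 i) (M.conc a) =
    M.conc (a.setSub i { a.sub i with o2 := some 50 }) := by
  rw [← conc_o2]
  simp [QNetwork.startJob, network, srv, srvTime_eq, svcHund]

theorem startJob_c31 (a : NetState m) (i : Fin 2) : M.network.startJob (.c31 i) (M.conc a) =
    M.conc (a.setSub i { a.sub i with o3 := some (false, 4) }) := by
  rw [← conc_o3]
  simp [QNetwork.startJob, network, srv, srvTime_eq, svcHund]

theorem startJob_c32 (a : NetState m) (i : Fin 2) : M.network.startJob (.c32 i) (M.conc a) =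
    M.conc (a.setSub i { a.sub i with o3 := some (true, 110) }) := by
  rw [← conc_o3]
  simp [QNetwork.startJob, network, srv, srvTime_eq, svcHund]

theorem startJob_c41 (a : NetState m) (i : Fin 2) : M.network.startJob (.c41 i) (M.conc a) =
    M.conc (a.setSub i { a.sub i with o4 := some 20 }) := by
  rw [← conc_o4]
  simp [QNetwork.startJob, network, srv, srvTime_eq, svcHund]

theorem startJob_c51 (a : NetState m) (i : Fin 2) : M.network.startJob (.c51 i) (M.conc a) =
    M.conc (a.setSub i { a.sub i with o5 := some 2 }) := by
  rw [← conc_o5]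
  simp [QNetwork.startJob, network, srv, srvTime_eq, svcHund]

theorem startJob_m01 (a : NetState m) (i : Fin 2) : M.network.startJob (.m01 i) (M.conc a) =
    M.conc { a with o01 := some (i, if i = 0 then 9 else 18) } := by
  refine Eq.trans ?_ (M.conc_o01 a (some (i, if i = 0 then 9 else 18)))
  simp [QNetwork.startJob, network, srv, srvTime_eq, svcHund]

theorem startJob_m02 (a : NetState m) (k : Fin m) : M.network.startJob (.m02 k) (M.conc a) =
    M.conc { a with o02 := some (k, 271) } := by
  refine Eq.trans ?_ (M.conc_o02 a (some (k, 271)))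
  simp [QNetwork.startJob, network, srv, srvTime_eq, svcHund]

theorem startJob_m41 (a : NetState m) (j : Fin m) : M.network.startJob (.m41 j) (M.conc a) =
    M.conc { a with o4 := Function.update a.o4 j (some 2) } := by
  rw [← conc_o4j]
  simp [QNetwork.startJob, network, srv, srvTime_eq, svcHund]

theorem startJob_probe (a : NetState m) (p : Fin 4) (k : Fin m) (h : a.walk = none) :
    M.network.startJob (probe p k) (M.conc a) = M.conc { a with walk := some (p, k, 9) } := by
  rw [← conc_walk_some _ _ _ _ _ h]
  fin_cases p <;> simp [QNetwork.startJob, network, srv, srvTime_eq, svcHund, probe, bits]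

theorem canBegin_c12 (a : NetState m) (i : Fin 2) : M.network.CanBegin (.c12 i) (M.conc a) ↔
    (a.sub i).o1 = none ∧ (a.sub i).w12 = 0 := by
  constructor
  · rintro ⟨h1, h2⟩
    have := h2 (.c12 i)
    simp_all [network, srv, conc, subServing, prio, Nat.pos_iff_ne_zero]
  · rintro ⟨h1, h2⟩
    refine ⟨by simp [network, srv, conc, subServing, h1], fun c hc hw => ?_⟩
    cases c <;> simp_all [network, srv, conc, prio]

theorem canBegin_c21 (a : NetState m) (i : Fin 2) : M.network.CanBegin (.c21 i) (M.conc a) ↔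
    (a.sub i).o2 = none ∧ (a.sub i).w21 = 0 := by
  constructor
  · rintro ⟨h1, h2⟩
    have := h2 (.c21 i)
    simp_all [network, srv, conc, subServing, prio, Nat.pos_iff_ne_zero]
  · rintro ⟨h1, h2⟩
    refine ⟨by simp [network, srv, conc, subServing, h1], fun c hc hw => ?_⟩
    cases c <;> simp_all [network, srv, conc, prio]

theorem canBegin_c11 (a : NetState m) (i : Fin 2) : M.network.CanBegin (.c11 i) (M.conc a) ↔
    (a.sub i).o1 = none ∧ (a.sub i).w12 = 0 ∧ (a.sub i).w11 = 0 := by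
  constructor
  · rintro ⟨h1, h2⟩
    have := h2 (.c12 i)
    have := h2 (.c11 i)
    simp_all [network, srv, conc, subServing, prio, Nat.pos_iff_ne_zero]
  · rintro ⟨h1, h2⟩
    refine ⟨by simp [network, srv, conc, subServing, h1], fun c hc hw => ?_⟩
    cases c <;> simp_all [network, srv, conc]

theorem canBegin_c22 (a : NetState m) (i : Fin 2) : M.network.CanBegin (.c22 i) (M.conc a) ↔
    (a.sub i).o2 = none ∧ (a.sub i).w21 = 0 ∧ (a.sub i).w22 = 0 := by
  constructor
  · rintro ⟨h1, h2⟩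
    have := h2 (.c21 i)
    have := h2 (.c22 i)
    simp_all [network, srv, conc, subServing, prio, Nat.pos_iff_ne_zero]
  · rintro ⟨h1, h2⟩
    refine ⟨by simp [network, srv, conc, subServing, h1], fun c hc hw => ?_⟩
    cases c <;> simp_all [network, srv, conc]

theorem canBegin_c13 (a : NetState m) (i : Fin 2) : M.network.CanBegin (.c13 i) (M.conc a) ↔
    (a.sub i).o1 = none ∧ (a.sub i).w12 = 0 ∧ (a.sub i).w11 = 0 := by
  constructor
  · rintro ⟨h1, h2⟩
    have := h2 (.c12 i)
    have := h2 (.c11 i)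
    simp_all [network, srv, conc, subServing, prio, Nat.pos_iff_ne_zero]
  · rintro ⟨h1, h2⟩
    refine ⟨by simp [network, srv, conc, subServing, h1], fun c hc hw => ?_⟩
    cases c <;> simp_all [network, srv, conc]

theorem canBegin_c14 (a : NetState m) (i : Fin 2) : M.network.CanBegin (.c14 i) (M.conc a) ↔
    (a.sub i).o1 = none ∧ (a.sub i).w12 = 0 ∧ (a.sub i).w11 = 0 := by
  constructor
  · rintro ⟨h1, h2⟩
    have := h2 (.c12 i)
    have := h2 (.c11 i)
    simp_all [network, srv, conc, subServing, prio, Nat.pos_iff_ne_zero]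
  · rintro ⟨h1, h2⟩
    refine ⟨by simp [network, srv, conc, subServing, h1], fun c hc hw => ?_⟩
    cases c <;> simp_all [network, srv, conc]

theorem canBegin_c23 (a : NetState m) (i : Fin 2) : M.network.CanBegin (.c23 i) (M.conc a) ↔
    (a.sub i).o2 = none ∧ (a.sub i).w21 = 0 ∧ (a.sub i).w22 = 0 := by
  constructor
  · rintro ⟨h1, h2⟩
    have := h2 (.c21 i)
    have := h2 (.c22 i)
    simp_all [network, srv, conc, subServing, prio, Nat.pos_iff_ne_zero]
  · rintro ⟨h1, h2⟩
    refine ⟨by simp [network, srv, conc, subServing, h1], fun c hc hw => ?_⟩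
    cases c <;> simp_all [network, srv, conc]

theorem canBegin_c31 (a : NetState m) (i : Fin 2) : M.network.CanBegin (.c31 i) (M.conc a) ↔
    (a.sub i).o3 = none ∧ (a.sub i).w31 = 0 := by
  constructor
  · rintro ⟨h1, h2⟩
    have := h2 (.c31 i)
    simp_all [network, srv, conc, subServing, prio, Nat.pos_iff_ne_zero]
  · rintro ⟨h1, h2⟩
    refine ⟨by simp [network, srv, conc, subServing, h1], fun c hc hw => ?_⟩
    cases c <;> simp_all [network, srv, conc]

theorem canBegin_c32 (a : NetState m) (i : Fin 2) : M.network.CanBegin (.c32 i) (M.conc a) ↔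
    (a.sub i).o3 = none := by
  constructor
  · rintro ⟨h1, h2⟩
    simp_all [network, srv, conc, subServing]
  · intro h1
    refine ⟨by simp [network, srv, conc, subServing, h1], fun c hc hw => ?_⟩
    cases c <;> simp_all [network, srv, conc, prio]

theorem canBegin_c33 (a : NetState m) (i : Fin 2) : M.network.CanBegin (.c33 i) (M.conc a) ↔
    (a.sub i).o3 = none ∧ (a.sub i).w31 = 0 := by
  constructor
  · rintro ⟨h1, h2⟩
    have := h2 (.c31 i)
    simp_all [network, srv, conc, subServing, prio, Nat.pos_iff_ne_zero]
  · rintro ⟨h1, h2⟩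
    refine ⟨by simp [network, srv, conc, subServing, h1], fun c hc hw => ?_⟩
    cases c <;> simp_all [network, srv, conc]

theorem canBegin_c41 (a : NetState m) (i : Fin 2) : M.network.CanBegin (.c41 i) (M.conc a) ↔
    (a.sub i).o4 = none := by
  constructor
  · rintro ⟨h1, h2⟩
    simp_all [network, srv, conc, subServing]
  · intro h1
    refine ⟨by simp [network, srv, conc, subServing, h1], fun c hc hw => ?_⟩
    cases c <;> simp_all [network, srv, conc]

theorem canBegin_c42 (a : NetState m) (i : Fin 2) : M.network.CanBegin (.c42 i) (M.conc a) ↔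
    (a.sub i).o4 = none := by
  constructor
  · rintro ⟨h1, h2⟩
    simp_all [network, srv, conc, subServing]
  · intro h1
    refine ⟨by simp [network, srv, conc, subServing, h1], fun c hc hw => ?_⟩
    cases c <;> simp_all [network, srv, conc]

theorem canBegin_c51 (a : NetState m) (i : Fin 2) : M.network.CanBegin (.c51 i) (M.conc a) ↔
    (a.sub i).o5 = none := by
  constructor
  · rintro ⟨h1, h2⟩
    simp_all [network, srv, conc, subServing]
  · intro h1
    refine ⟨by simp [network, srv, conc, subServing, h1], fun c hc hw => ?_⟩
    cases c <;> simp_all [network, srv, conc]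

theorem canBegin_m01 (a : NetState m) (i : Fin 2) (h : ∀ i, a.w01 i = 0) :
    M.network.CanBegin (.m01 i) (M.conc a) ↔ a.o01 = none := by
  constructor
  · rintro ⟨h1, h2⟩
    simpa [network, srv, conc] using h1
  · intro h1
    refine ⟨by simp [network, srv, conc, h1], fun c hc hw => ?_⟩
    cases c
    case m01 i' => exact absurd (h i') hw.ne'
    all_goals simp_all [network, srv, conc, prio]
    split_ifs <;> simp

theorem canBegin_m02 (a : NetState m) (k : Fin m) : M.network.CanBegin (.m02 k) (M.conc a) ↔
    a.o02 = none := by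
  constructor
  · rintro ⟨h1, h2⟩
    simpa [network, srv, conc] using h1
  · intro h1
    refine ⟨by simp [network, srv, conc, h1], fun c hc hw => ?_⟩
    cases c <;> simp_all [network, srv, conc]

theorem canBegin_m03 (a : NetState m) (k : Fin m) (h : ∀ i, a.w01 i = 0) (h' : a.w03 = none) :
    M.network.CanBegin (.m03 k) (M.conc a) ↔ a.o01 = none := by
  constructor
  · rintro ⟨h1, h2⟩
    simpa [network, srv, conc] using h1
  · intro h1
    refine ⟨by simp [network, srv, conc, h1], fun c hc hw => ?_⟩
    cases c
    case m01 i' => exact absurd (h i') hw.ne'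
    all_goals simp_all [network, srv, conc]

theorem canBegin_probe (a : NetState m) (p : Fin 4) (k : Fin m) (h : a.walk = none) :
    M.network.CanBegin (probe p k) (M.conc a) := by
  refine ⟨?_, fun c hc hw => ?_⟩
  · fin_cases p <;> simp [network, srv, conc, h, probe]
  · fin_cases p <;> cases c <;> simp_all [network, srv, conc, probe]

theorem canBegin_m35 (a : NetState m) (j : Fin m) : M.network.CanBegin (.m35 j) (M.conc a) ↔
    ∀ p k r, a.walk = some (p, k, r) → M.α k (bits p) ≠ j := by
  constructor
  · rintro ⟨h1, h2⟩ p k r h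
    simpa [network, srv, conc, h] using h1
  · intro h1
    refine ⟨?_, fun c hc hw => ?_⟩
    · rcases hw : a.walk with _ | ⟨p, k, r⟩
      · simp [network, srv, conc, hw]
      · simpa [network, srv, conc, hw] using h1 p k r hw
    · cases c <;> simp_all [network, srv, conc]

theorem canBegin_m41 (a : NetState m) (j : Fin m) : M.network.CanBegin (.m41 j) (M.conc a) ↔
    a.o4 j = none := by
  constructor
  · rintro ⟨h1, h2⟩
    simpa [network, srv, conc] using h1
  · intro h1
    refine ⟨by simp [network, srv, conc, h1], fun c hc hw => ?_⟩
    cases c <;> simp_all [network, srv, conc]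

theorem canBegin_m42 (a : NetState m) (j : Fin m) : M.network.CanBegin (.m42 j) (M.conc a) ↔
    a.o4 j = none := by
  constructor
  · rintro ⟨h1, h2⟩
    simpa [network, srv, conc] using h1
  · intro h1
    refine ⟨by simp [network, srv, conc, h1], fun c hc hw => ?_⟩
    cases c <;> simp_all [network, srv, conc]

theorem canBegin_m43 (a : NetState m) (j : Fin m) : M.network.CanBegin (.m43 j) (M.conc a) ↔
    a.o4 j = none := by
  constructor
  · rintro ⟨h1, h2⟩
    simpa [network, srv, conc] using h1
  · intro h1
    refine ⟨by simp [network, srv, conc, h1], fun c hc hw => ?_⟩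
    cases c <;> simp_all [network, srv, conc]

end SCM

/-! ### The effect of the events of a subnetwork -/

namespace NetState

variable {m : ℕ}

theorem setSub_sub_self (a : NetState m) (i : Fin 2) (s : SubState) :
    (a.setSub i s).sub i = s := by simp [setSub]

theorem setSub_setSub (a : NetState m) (i : Fin 2) (s t : SubState) :
    (a.setSub i s).setSub i t = a.setSub i t := by simp [setSub]

theorem setSub_eq_self (a : NetState m) (i : Fin 2) : a.setSub i (a.sub i) = a := by
  simp [setSub]

end NetState

namespace SubState

/-- A job joins class `c12`. -/
def join12 (s : SubState) : SubState :=
  if s.o1 = none ∧ s.w12 = 0 then { s with o1 := some 50 } else { s with w12 := s.w12 + 1 }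

/-- A job joins class `c21`. -/
def join21 (s : SubState) : SubState :=
  if s.o2 = none ∧ s.w21 = 0 then { s with o2 := some 50 } else { s with w21 := s.w21 + 1 }

/-- A job joins class `c31`. -/
def join31 (s : SubState) : SubState :=
  if s.o3 = none ∧ s.w31 = 0 then { s with o3 := some (false, 4) } else { s with w31 := s.w31 + 1 }

/-- A job joins class `c11`, and passes on to `c21` if it can. -/
def pass11 (s : SubState) : SubState :=
  if s.o1 = none ∧ s.w12 = 0 ∧ s.w11 = 0 then s.join21 else { s with w11 := s.w11 + 1 }

/-- A job joins class `c22`, and passes on to `c12` if it can. -/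
def pass22 (s : SubState) : SubState :=
  if s.o2 = none ∧ s.w21 = 0 ∧ s.w22 = 0 then s.join12 else { s with w22 := s.w22 + 1 }

/-- The idle first server selects its next job; unless a `c12` job is waiting, all waiting `c11`
jobs pass on to `c21`. -/
def select1 (s : SubState) : SubState :=
  if 0 < s.w12 then { s with o1 := some 50, w12 := s.w12 - 1 }
  else join21^[s.w11] { s with w11 := 0 }

/-- The idle second server selects its next job; unless a `c21` job is waiting, all waiting `c22`
jobs pass on to `c12`. -/
def select2 (s : SubState) : SubState :=
  if 0 < s.w21 then { s with o2 := some 50, w21 := s.w21 - 1 }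
  else join12^[s.w22] { s with w22 := 0 }

/-- The idle third server selects its next job. -/
def select3 (s : SubState) : SubState :=
  if 0 < s.w31 then { s with o3 := some (false, 4), w31 := s.w31 - 1 } else s

theorem join21_o1 (s : SubState) : s.join21.o1 = s.o1 := by
  unfold join21; split_ifs <;> rfl

theorem join21_w12 (s : SubState) : s.join21.w12 = s.w12 := by
  unfold join21; split_ifs <;> rfl

theorem join21_w11 (s : SubState) : s.join21.w11 = s.w11 := by
  unfold join21; split_ifs <;> rfl

theorem join21_comm (s : SubState) (n : ℕ) :
    { s.join21 with w11 := n } = { s with w11 := n }.join21 := by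
  unfold join21; split_ifs <;> rfl

theorem join12_o2 (s : SubState) : s.join12.o2 = s.o2 := by
  unfold join12; split_ifs <;> rfl

theorem join12_w21 (s : SubState) : s.join12.w21 = s.w21 := by
  unfold join12; split_ifs <;> rfl

theorem join12_w22 (s : SubState) : s.join12.w22 = s.w22 := by
  unfold join12; split_ifs <;> rfl

theorem join12_comm (s : SubState) (n : ℕ) :
    { s.join12 with w22 := n } = { s with w22 := n }.join12 := by
  unfold join12; split_ifs <;> rfl

theorem join31_w11 (s : SubState) : s.join31.w11 = s.w11 := by
  unfold join31; split_ifs <;> rfl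

theorem join31_w12 (s : SubState) : s.join31.w12 = s.w12 := by
  unfold join31; split_ifs <;> rfl

theorem join31_w21 (s : SubState) : s.join31.w21 = s.w21 := by
  unfold join31; split_ifs <;> rfl

theorem join31_w22 (s : SubState) : s.join31.w22 = s.w22 := by
  unfold join31; split_ifs <;> rfl

end SubState

namespace QNetwork

theorem join_waiting_of_ne {S C : Type*} [DecidableEq S] [DecidableEq C] {N : QNetwork S C}
    {c d : C} {x : QState S C} (h : c ≠ d) : (N.join d x).waiting c = x.waiting c := by
  unfold join
  split_ifs
  · rfl
  · exact Function.update_of_ne h _ _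
  · rfl

end QNetwork

open QNetwork

namespace SCM

variable {m : ℕ} (M : SCM m)

theorem server_sub0 {c : Cls m} {i : Fin 2} (h : M.network.server c = .sub i 0) :
    c = .c11 i ∨ c = .c12 i ∨ c = .c13 i ∨ c = .c14 i := by
  cases c <;> simp_all [network, srv]

theorem server_sub1 {c : Cls m} {i : Fin 2} (h : M.network.server c = .sub i 1) :
    c = .c21 i ∨ c = .c22 i ∨ c = .c23 i := by
  cases c <;> simp_all [network, srv]

theorem server_sub2 {c : Cls m} {i : Fin 2} (h : M.network.server c = .sub i 2) :
    c = .c31 i ∨ c = .c32 i ∨ c = .c33 i := by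
  cases c <;> simp_all [network, srv]

theorem server_sub3 {c : Cls m} {i : Fin 2} (h : M.network.server c = .sub i 3) :
    c = .c41 i ∨ c = .c42 i := by
  cases c <;> simp_all [network, srv]

theorem server_sub4 {c : Cls m} {i : Fin 2} (h : M.network.server c = .sub i 4) :
    c = .c51 i := by
  cases c <;> simp_all [network, srv]

theorem empty_sub0 {a : NetState m} {i : Fin 2} (h1 : (a.sub i).w11 = 0)
    (h2 : (a.sub i).w12 = 0) (c : Cls m) (hc : M.network.server c = .sub i 0) :
    (M.conc a).waiting c = 0 := by
  rcases M.server_sub0 hc with rfl | rfl | rfl | rfl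
  exacts [h1, h2, rfl, rfl]

theorem empty_sub1 {a : NetState m} {i : Fin 2} (h1 : (a.sub i).w21 = 0)
    (h2 : (a.sub i).w22 = 0) (c : Cls m) (hc : M.network.server c = .sub i 1) :
    (M.conc a).waiting c = 0 := by
  rcases M.server_sub1 hc with rfl | rfl | rfl
  exacts [h1, h2, rfl]

theorem empty_sub2 {a : NetState m} {i : Fin 2} (h1 : (a.sub i).w31 = 0) (c : Cls m)
    (hc : M.network.server c = .sub i 2) : (M.conc a).waiting c = 0 := by
  rcases M.server_sub2 hc with rfl | rfl | rfl
  exacts [h1, rfl, rfl]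

theorem empty_sub3 {a : NetState m} {i : Fin 2} (c : Cls m)
    (hc : M.network.server c = .sub i 3) : (M.conc a).waiting c = 0 := by
  rcases M.server_sub3 hc with rfl | rfl <;> rfl

theorem empty_sub4 {a : NetState m} {i : Fin 2} (c : Cls m)
    (hc : M.network.server c = .sub i 4) : (M.conc a).waiting c = 0 := by
  rw [M.server_sub4 hc]; rfl

theorem join_c12 (a : NetState m) (i : Fin 2) : M.network.join (.c12 i) (M.conc a) =
    M.conc (a.setSub i (a.sub i).join12) := by
  by_cases h : M.network.CanBegin (.c12 i) (M.conc a)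
  · rw [join_eq_startJob h, startJob_c12, SubState.join12, if_pos ((M.canBegin_c12 a i).1 h)]
  · rw [join_eq_wait h rfl, conc_w12, SubState.join12,
      if_neg fun h' => h ((M.canBegin_c12 a i).2 h')]
    rfl

theorem join_c21 (a : NetState m) (i : Fin 2) : M.network.join (.c21 i) (M.conc a) =
    M.conc (a.setSub i (a.sub i).join21) := by
  by_cases h : M.network.CanBegin (.c21 i) (M.conc a)
  · rw [join_eq_startJob h, startJob_c21, SubState.join21, if_pos ((M.canBegin_c21 a i).1 h)]
  · rw [join_eq_wait h rfl, conc_w21, SubState.join21,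
      if_neg fun h' => h ((M.canBegin_c21 a i).2 h')]
    rfl

theorem join_c31 (a : NetState m) (i : Fin 2) : M.network.join (.c31 i) (M.conc a) =
    M.conc (a.setSub i (a.sub i).join31) := by
  by_cases h : M.network.CanBegin (.c31 i) (M.conc a)
  · rw [join_eq_startJob h, startJob_c31, SubState.join31, if_pos ((M.canBegin_c31 a i).1 h)]
  · rw [join_eq_wait h rfl, conc_w31, SubState.join31,
      if_neg fun h' => h ((M.canBegin_c31 a i).2 h')]
    rfl

theorem join_c32 (a : NetState m) (i : Fin 2) (h : (a.sub i).o3 = none) :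
    M.network.join (.c32 i) (M.conc a) =
      M.conc (a.setSub i { a.sub i with o3 := some (true, 110) }) := by
  rw [join_eq_startJob ((M.canBegin_c32 a i).2 h), startJob_c32]

theorem join_c41 (a : NetState m) (i : Fin 2) (h : (a.sub i).o4 = none) :
    M.network.join (.c41 i) (M.conc a) =
      M.conc (a.setSub i { a.sub i with o4 := some 20 }) := by
  rw [join_eq_startJob ((M.canBegin_c41 a i).2 h), startJob_c41]

theorem join_c51 (a : NetState m) (i : Fin 2) (h : (a.sub i).o5 = none) :
    M.network.join (.c51 i) (M.conc a) =
      M.conc (a.setSub i { a.sub i with o5 := some 2 }) := by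
  rw [join_eq_startJob ((M.canBegin_c51 a i).2 h), startJob_c51]

/-- In an encoded state no job is passing. -/
theorem flush_conc {a : NetState m} {z : QState (Srv m) (Cls m)}
    (h : M.network.Flush (M.conc a) z) : z = M.conc a :=
  h.eq (M.not_passing_conc a)

/-- A job which joins `c11` passes on to `c21` iff the first server is idle and has no job waiting in
`c11` or `c12`. -/
theorem flush_join_c11 {a : NetState m} {i : Fin 2} {z : QState (Srv m) (Cls m)}
    (h : M.network.Flush (M.network.join (.c11 i) (M.conc a)) z) :
    z = M.conc (a.setSub i (a.sub i).pass11) := by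
  by_cases hb : M.network.CanBegin (.c11 i) (M.conc a)
  · have hb' := (M.canBegin_c11 a i).1 hb
    rw [join_eq_startJob hb] at h
    obtain ⟨y, hy, hz⟩ := h.startJob (M.not_passing_conc a) hb.1 rfl
    have hr : M.network.route (.c11 i) (M.conc a) = M.network.join (.c21 i) (M.conc a) := rfl
    rw [hr, join_c21] at hy
    have hy' := hy.eq_of_empty (M.empty_sub0 (by simp [NetState.setSub_sub_self, SubState.join21_w11, hb'])
      (by simp [NetState.setSub_sub_self, SubState.join21_w12, hb']))
    subst hy'
    rw [M.flush_conc hz, SubState.pass11, if_pos hb']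
  · rw [join_eq_wait hb rfl, conc_w11] at h
    rw [M.flush_conc h, SubState.pass11, if_neg fun h' => hb ((M.canBegin_c11 a i).2 h')]
    rfl

/-- A job which joins `c22` passes on to `c12` iff the second server is idle and has no job waiting
in `c21` or `c22`. -/
theorem flush_join_c22 {a : NetState m} {i : Fin 2} {z : QState (Srv m) (Cls m)}
    (h : M.network.Flush (M.network.join (.c22 i) (M.conc a)) z) :
    z = M.conc (a.setSub i (a.sub i).pass22) := by
  by_cases hb : M.network.CanBegin (.c22 i) (M.conc a)
  · have hb' := (M.canBegin_c22 a i).1 hb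
    rw [join_eq_startJob hb] at h
    obtain ⟨y, hy, hz⟩ := h.startJob (M.not_passing_conc a) hb.1 rfl
    have hr : M.network.route (.c22 i) (M.conc a) = M.network.join (.c12 i) (M.conc a) := rfl
    rw [hr, join_c12] at hy
    have hy' := hy.eq_of_empty (M.empty_sub1 (by simp [NetState.setSub_sub_self, SubState.join12_w21, hb'])
      (by simp [NetState.setSub_sub_self, SubState.join12_w22, hb']))
    subst hy'
    rw [M.flush_conc hz, SubState.pass22, if_pos hb']
  · rw [join_eq_wait hb rfl, conc_w22] at h
    rw [M.flush_conc h, SubState.pass22, if_neg fun h' => hb ((M.canBegin_c22 a i).2 h')]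
    rfl

/-- The classes `c13`, `c14`, `c23`: an arriving job passes on to `c31` iff its server is idle. -/
theorem flush_join_c13 {a : NetState m} {i : Fin 2} {z : QState (Srv m) (Cls m)}
    (h : M.network.Flush (M.network.join (.c13 i) (M.conc a)) z) :
    z = M.conc (if (a.sub i).o1 = none ∧ (a.sub i).w12 = 0 ∧ (a.sub i).w11 = 0 then
      a.setSub i (a.sub i).join31 else a) := by
  by_cases hb : M.network.CanBegin (.c13 i) (M.conc a)
  · have hb' := (M.canBegin_c13 a i).1 hb
    rw [join_eq_startJob hb] at h
    obtain ⟨y, hy, hz⟩ := h.startJob (M.not_passing_conc a) hb.1 rfl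
    have hr : M.network.route (.c13 i) (M.conc a) = M.network.join (.c31 i) (M.conc a) := rfl
    rw [hr, join_c31] at hy
    have hy' := hy.eq_of_empty (M.empty_sub0
      (by simp [NetState.setSub_sub_self, SubState.join31_w11, hb'])
      (by simp [NetState.setSub_sub_self, SubState.join31_w12, hb']))
    subst hy'
    rw [M.flush_conc hz, if_pos hb']
  · rw [join_eq_self hb rfl] at h
    rw [M.flush_conc h, if_neg fun h' => hb ((M.canBegin_c13 a i).2 h')]

theorem flush_join_c14 {a : NetState m} {i : Fin 2} {z : QState (Srv m) (Cls m)}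
    (h : M.network.Flush (M.network.join (.c14 i) (M.conc a)) z) :
    z = M.conc (if (a.sub i).o1 = none ∧ (a.sub i).w12 = 0 ∧ (a.sub i).w11 = 0 then
      a.setSub i (a.sub i).join31 else a) := by
  by_cases hb : M.network.CanBegin (.c14 i) (M.conc a)
  · have hb' := (M.canBegin_c14 a i).1 hb
    rw [join_eq_startJob hb] at h
    obtain ⟨y, hy, hz⟩ := h.startJob (M.not_passing_conc a) hb.1 rfl
    have hr : M.network.route (.c14 i) (M.conc a) = M.network.join (.c31 i) (M.conc a) := rfl
    rw [hr, join_c31] at hy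
    have hy' := hy.eq_of_empty (M.empty_sub0
      (by simp [NetState.setSub_sub_self, SubState.join31_w11, hb'])
      (by simp [NetState.setSub_sub_self, SubState.join31_w12, hb']))
    subst hy'
    rw [M.flush_conc hz, if_pos hb']
  · rw [join_eq_self hb rfl] at h
    rw [M.flush_conc h, if_neg fun h' => hb ((M.canBegin_c14 a i).2 h')]

theorem flush_join_c23 {a : NetState m} {i : Fin 2} {z : QState (Srv m) (Cls m)}
    (h : M.network.Flush (M.network.join (.c23 i) (M.conc a)) z) :
    z = M.conc (if (a.sub i).o2 = none ∧ (a.sub i).w21 = 0 ∧ (a.sub i).w22 = 0 then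
      a.setSub i (a.sub i).join31 else a) := by
  by_cases hb : M.network.CanBegin (.c23 i) (M.conc a)
  · have hb' := (M.canBegin_c23 a i).1 hb
    rw [join_eq_startJob hb] at h
    obtain ⟨y, hy, hz⟩ := h.startJob (M.not_passing_conc a) hb.1 rfl
    have hr : M.network.route (.c23 i) (M.conc a) = M.network.join (.c31 i) (M.conc a) := rfl
    rw [hr, join_c31] at hy
    have hy' := hy.eq_of_empty (M.empty_sub1
      (by simp [NetState.setSub_sub_self, SubState.join31_w21, hb'])
      (by simp [NetState.setSub_sub_self, SubState.join31_w22, hb']))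
    subst hy'
    rw [M.flush_conc hz, if_pos hb']
  · rw [join_eq_self hb rfl] at h
    rw [M.flush_conc h, if_neg fun h' => hb ((M.canBegin_c23 a i).2 h')]

/-- A job which arrives to `c42` is dropped if a `c41` job is in service, and otherwise becomes a
`c11` job. -/
theorem flush_join_c42 {a : NetState m} {i : Fin 2} {z : QState (Srv m) (Cls m)}
    (h : M.network.Flush (M.network.join (.c42 i) (M.conc a)) z) :
    z = M.conc (if (a.sub i).o4 = none then a.setSub i (a.sub i).pass11 else a) := by
  by_cases hb : M.network.CanBegin (.c42 i) (M.conc a)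
  · have hb' := (M.canBegin_c42 a i).1 hb
    rw [join_eq_startJob hb] at h
    obtain ⟨y, hy, hz⟩ := h.startJob (M.not_passing_conc a) hb.1 rfl
    have hr : M.network.route (.c42 i) (M.conc a) = M.network.join (.c11 i) (M.conc a) := rfl
    rw [hr] at hy
    have hy' := hy.eq_of_empty (fun c hc => by
      rw [join_waiting_of_ne (by rintro rfl; simp [network, srv] at hc)]
      exact M.empty_sub3 c hc)
    subst hy'
    rw [M.flush_join_c11 hz, if_pos hb']
  · rw [join_eq_self hb rfl] at h
    rw [M.flush_conc h, if_neg fun h' => hb ((M.canBegin_c42 a i).2 h')]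

/-- If no `c12` job is waiting, the idle first server lets all waiting `c11` jobs pass one by one. -/
theorem flush_select1 {a : NetState m} {i : Fin 2} {y z : QState (Srv m) (Cls m)}
    (ho : (a.sub i).o1 = none) (h : M.network.Select (.sub i 0) (M.conc a) y)
    (hz : M.network.Flush y z) : z = M.conc (a.setSub i (a.sub i).select1) := by
  by_cases hw : 0 < (a.sub i).w12
  · have hy := h.eq_start (by simp [conc, subServing, ho]) (.c12 i) rfl hw (by
      intro c hc _ hne
      rcases M.server_sub0 hc with rfl | rfl | rfl | rfl <;> simp_all [network, prio])
    rw [conc_w12, startJob_c12, NetState.setSub_setSub, NetState.setSub_sub_self] at hy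
    subst hy
    rw [M.flush_conc hz, SubState.select1, if_pos hw]
    rfl
  · have hw12 : (a.sub i).w12 = 0 := by omega
    rw [SubState.select1, if_neg hw]
    clear hw
    generalize hn : (a.sub i).w11 = n
    induction n generalizing a y with
    | zero =>
      have hy := h.eq_of_empty (M.empty_sub0 hn hw12)
      subst hy
      rw [M.flush_conc hz, Function.iterate_zero, id, ← hn, NetState.setSub_eq_self]
    | succ n ih =>
      have hy := h.eq_start (by simp [conc, subServing, ho]) (.c11 i) rfl
        (by simp [conc, hn]) (by
          intro c hc hcw hne
          rcases M.server_sub0 hc with rfl | rfl | rfl | rfl <;> simp_all [network, conc])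
      have hwn : (M.conc a).waiting (.c11 i) - 1 = n := by simp [conc, hn]
      rw [hwn, conc_w11] at hy
      subst hy
      obtain ⟨y', hy', hz'⟩ := hz.startJob (M.not_passing_conc _)
        (by simp [network, srv, conc, subServing, NetState.setSub, ho]) rfl
      have hr : ∀ x, M.network.route (.c11 i) x = M.network.join (.c21 i) x := fun _ => rfl
      rw [hr, join_c21, NetState.setSub_setSub, NetState.setSub_sub_self] at hy'
      have := ih (by rw [NetState.setSub_sub_self, SubState.join21_o1]; exact ho) hy' hz'
        (by rw [NetState.setSub_sub_self, SubState.join21_w12]; exact hw12)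
        (by rw [NetState.setSub_sub_self, SubState.join21_w11])
      rw [NetState.setSub_setSub, NetState.setSub_sub_self, SubState.join21_comm] at this
      rw [this, Function.iterate_succ_apply]

/-- If no `c21` job is waiting, the idle second server lets all waiting `c22` jobs pass one by
one. -/
theorem flush_select2 {a : NetState m} {i : Fin 2} {y z : QState (Srv m) (Cls m)}
    (ho : (a.sub i).o2 = none) (h : M.network.Select (.sub i 1) (M.conc a) y)
    (hz : M.network.Flush y z) : z = M.conc (a.setSub i (a.sub i).select2) := by
  by_cases hw : 0 < (a.sub i).w21
  · have hy := h.eq_start (by simp [conc, subServing, ho]) (.c21 i) rfl hw (by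
      intro c hc _ hne
      rcases M.server_sub1 hc with rfl | rfl | rfl <;> simp_all [network, prio])
    rw [conc_w21, startJob_c21, NetState.setSub_setSub, NetState.setSub_sub_self] at hy
    subst hy
    rw [M.flush_conc hz, SubState.select2, if_pos hw]
    rfl
  · have hw21 : (a.sub i).w21 = 0 := by omega
    rw [SubState.select2, if_neg hw]
    clear hw
    generalize hn : (a.sub i).w22 = n
    induction n generalizing a y with
    | zero =>
      have hy := h.eq_of_empty (M.empty_sub1 hw21 hn)
      subst hy
      rw [M.flush_conc hz, Function.iterate_zero, id, ← hn, NetState.setSub_eq_self]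
    | succ n ih =>
      have hy := h.eq_start (by simp [conc, subServing, ho]) (.c22 i) rfl
        (by simp [conc, hn]) (by
          intro c hc hcw hne
          rcases M.server_sub1 hc with rfl | rfl | rfl <;> simp_all [network, conc])
      have hwn : (M.conc a).waiting (.c22 i) - 1 = n := by simp [conc, hn]
      rw [hwn, conc_w22] at hy
      subst hy
      obtain ⟨y', hy', hz'⟩ := hz.startJob (M.not_passing_conc _)
        (by simp [network, srv, conc, subServing, NetState.setSub, ho]) rfl
      have hr : ∀ x, M.network.route (.c22 i) x = M.network.join (.c12 i) x := fun _ => rfl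
      rw [hr, join_c12, NetState.setSub_setSub, NetState.setSub_sub_self] at hy'
      have := ih (by rw [NetState.setSub_sub_self, SubState.join12_o2]; exact ho) hy' hz'
        (by rw [NetState.setSub_sub_self, SubState.join12_w21]; exact hw21)
        (by rw [NetState.setSub_sub_self, SubState.join12_w22])
      rw [NetState.setSub_setSub, NetState.setSub_sub_self, SubState.join12_comm] at this
      rw [this, Function.iterate_succ_apply]

theorem flush_select3 {a : NetState m} {i : Fin 2} {y z : QState (Srv m) (Cls m)}
    (ho : (a.sub i).o3 = none) (h : M.network.Select (.sub i 2) (M.conc a) y)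
    (hz : M.network.Flush y z) : z = M.conc (a.setSub i (a.sub i).select3) := by
  by_cases hw : 0 < (a.sub i).w31
  · have hy := h.eq_start (by simp [conc, subServing, ho]) (.c31 i) rfl hw (by
      intro c hc hcw hne
      rcases M.server_sub2 hc with rfl | rfl | rfl
      exacts [absurd rfl hne, absurd hcw (lt_irrefl 0), by simp [network, prio]])
    rw [conc_w31, startJob_c31, NetState.setSub_setSub, NetState.setSub_sub_self] at hy
    subst hy
    rw [M.flush_conc hz, SubState.select3, if_pos hw]
    rfl
  · have hy := h.eq_of_empty (M.empty_sub2 (by omega))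
    subst hy
    rw [M.flush_conc hz, SubState.select3, if_neg hw, NetState.setSub_eq_self]

theorem flush_finish_c12 {a : NetState m} {i : Fin 2} {y z : QState (Srv m) (Cls m)}
    (h : M.network.Select (.sub i 0) (M.network.route (.c12 i) (free (.sub i 0) (M.conc a))) y)
    (hz : M.network.Flush y z) :
    z = M.conc (a.setSub i { a.sub i with o1 := none }.select1) := by
  have h1 : M.network.route (.c12 i) (free (.sub i 0) (M.conc a)) =
    M.conc (a.setSub i { a.sub i with o1 := none }) := (M.conc_o1 a i none)
  rw [h1] at h
  have := M.flush_select1 (by rw [NetState.setSub_sub_self]) h hz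
  rwa [NetState.setSub_setSub, NetState.setSub_sub_self] at this

theorem flush_finish_c21 {a : NetState m} {i : Fin 2} {y z : QState (Srv m) (Cls m)}
    (h : M.network.Select (.sub i 1) (M.network.route (.c21 i) (free (.sub i 1) (M.conc a))) y)
    (hz : M.network.Flush y z) :
    z = M.conc (a.setSub i { a.sub i with o2 := none }.select2) := by
  have h1 : M.network.route (.c21 i) (free (.sub i 1) (M.conc a)) =
    M.conc (a.setSub i { a.sub i with o2 := none }) := (M.conc_o2 a i none)
  rw [h1] at h
  have := M.flush_select2 (by rw [NetState.setSub_sub_self]) h hz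
  rwa [NetState.setSub_setSub, NetState.setSub_sub_self] at this

theorem flush_finish_c31 {a : NetState m} {i : Fin 2} {y z : QState (Srv m) (Cls m)} {b : Bool}
    (h : M.network.Select (.sub i 2) (M.network.route (if b then .c32 i else .c31 i)
      (free (.sub i 2) (M.conc a))) y) (hz : M.network.Flush y z) :
    z = M.conc (a.setSub i { a.sub i with o3 := none }.select3) := by
  have h1 : M.network.route (if b then .c32 i else .c31 i) (free (.sub i 2) (M.conc a)) =
    M.conc (a.setSub i { a.sub i with o3 := none }) := by
      cases b <;> exact (M.conc_o3 a i none)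
  rw [h1] at h
  have := M.flush_select3 (by rw [NetState.setSub_sub_self]) h hz
  rwa [NetState.setSub_setSub, NetState.setSub_sub_self] at this

theorem flush_finish_c41 {a : NetState m} {i : Fin 2} {y z : QState (Srv m) (Cls m)}
    (h : M.network.Select (.sub i 3) (M.network.route (.c41 i) (free (.sub i 3) (M.conc a))) y)
    (hz : M.network.Flush y z) :
    z = M.conc (a.setSub i { a.sub i with o4 := none }) := by
  have h1 : M.network.route (.c41 i) (free (.sub i 3) (M.conc a)) =
    M.conc (a.setSub i { a.sub i with o4 := none }) := (M.conc_o4 a i none)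
  rw [h1] at h
  have hy := h.eq_of_empty M.empty_sub3
  subst hy
  exact M.flush_conc hz

theorem flush_finish_c51 {a : NetState m} {i : Fin 2} {y z : QState (Srv m) (Cls m)}
    (h : M.network.Select (.sub i 4) (M.network.route (.c51 i) (free (.sub i 4) (M.conc a))) y)
    (hz : M.network.Flush y z) :
    z = M.conc (a.setSub i { a.sub i with o5 := none }.pass11) := by
  have h1 : free (.sub i 4) (M.conc a) =
    M.conc (a.setSub i { a.sub i with o5 := none }) := (M.conc_o5 a i none)
  have hr : ∀ x, M.network.route (.c51 i) x = M.network.join (.c11 i) x := fun _ => rfl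
  rw [h1, hr] at h
  have hy := h.eq_of_empty (fun c hc => by
    rw [join_waiting_of_ne (by rintro rfl; simp [network, srv] at hc)]
    exact M.empty_sub4 c hc)
  subst hy
  have := M.flush_join_c11 hz
  rwa [NetState.setSub_setSub, NetState.setSub_sub_self] at this

end SCM

/-! ### The effect of the events of the main network -/

open QNetwork

namespace NetState

variable {m : ℕ}

/-- The idle server `S01` selects its next job; a waiting `m03 k` job passes on to `m31 k`. -/
def select01 (a : NetState m) : NetState m :=
  if 0 < a.w01 0 then { a with o01 := some (0, 9), w01 := Function.update a.w01 0 (a.w01 0 - 1) }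
  else if 0 < a.w01 1 then
    { a with o01 := some (1, 18), w01 := Function.update a.w01 1 (a.w01 1 - 1) }
  else match a.w03 with
    | none => a
    | some k => { a with w03 := none, walk := some (0, k, 9) }

end NetState

namespace SCM

variable {m : ℕ} (M : SCM m)

theorem server_S01 {c : Cls m} (h : M.network.server c = .S01) :
    (∃ i, c = .m01 i) ∨ ∃ k, c = .m03 k := by
  cases c <;> simp_all [network, srv]

theorem server_S02 {c : Cls m} (h : M.network.server c = .S02) : ∃ k, c = .m02 k := by
  cases c <;> simp_all [network, srv]

theorem server_S3 {c : Cls m} {j : Fin m} (h : M.network.server c = .S3 j) :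
    (∃ p k, c = probe p k) ∨ c = .m35 j := by
  cases c <;> simp_all [network, srv]
  case m31 k => exact ⟨0, k, rfl⟩
  case m32 k => exact ⟨1, k, rfl⟩
  case m33 k => exact ⟨2, k, rfl⟩
  case m34 k => exact ⟨3, k, rfl⟩

theorem server_S4 {c : Cls m} {j : Fin m} (h : M.network.server c = .S4 j) :
    c = .m41 j ∨ c = .m42 j ∨ c = .m43 j := by
  cases c <;> simp_all [network, srv]

theorem empty_S01 {a : NetState m} (h1 : ∀ i, a.w01 i = 0) (h2 : a.w03 = none) (c : Cls m)
    (hc : M.network.server c = .S01) : (M.conc a).waiting c = 0 := by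
  rcases M.server_S01 hc with ⟨i, rfl⟩ | ⟨k, rfl⟩
  · exact h1 i
  · simp [conc, h2]

theorem empty_S02 {a : NetState m} (c : Cls m)
    (hc : M.network.server c = .S02) : (M.conc a).waiting c = 0 := by
  obtain ⟨k, rfl⟩ := M.server_S02 hc
  rfl

theorem empty_S3 {a : NetState m} {j : Fin m} (c : Cls m)
    (hc : M.network.server c = .S3 j) : (M.conc a).waiting c = 0 := by
  rcases M.server_S3 hc with ⟨p, k, rfl⟩ | rfl
  · fin_cases p <;> rfl
  · rfl

theorem empty_S4 {a : NetState m} {j : Fin m} (c : Cls m)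
    (hc : M.network.server c = .S4 j) : (M.conc a).waiting c = 0 := by
  rcases M.server_S4 hc with rfl | rfl | rfl <;> rfl

theorem join_m01_idle (a : NetState m) (i : Fin 2) (h : ∀ i, a.w01 i = 0) (h' : a.o01 = none) :
    M.network.join (.m01 i) (M.conc a) =
      M.conc { a with o01 := some (i, if i = 0 then 9 else 18) } := by
  rw [join_eq_startJob ((M.canBegin_m01 a i h).2 h'), startJob_m01]

theorem join_m01_busy (a : NetState m) (i : Fin 2) (h' : a.o01 ≠ none) :
    M.network.join (.m01 i) (M.conc a) =
      M.conc { a with w01 := Function.update a.w01 i (a.w01 i + 1) } := by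
  have hb : ¬ M.network.CanBegin (.m01 i) (M.conc a) := by
    intro hb
    have := hb.1
    simp [network, srv, conc] at this
    exact h' this
  rw [join_eq_wait hb rfl]
  exact M.conc_w01 a i (a.w01 i + 1)

theorem join_probe (a : NetState m) (p : Fin 4) (k : Fin m) (h : a.walk = none) :
    M.network.join (probe p k) (M.conc a) = M.conc { a with walk := some (p, k, 9) } := by
  rw [join_eq_startJob (M.canBegin_probe a p k h), startJob_probe _ _ _ _ h]

theorem join_m02 (a : NetState m) (k : Fin m) (h : a.o02 = none) :
    M.network.join (.m02 k) (M.conc a) = M.conc { a with o02 := some (k, 271) } := by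
  rw [join_eq_startJob ((M.canBegin_m02 a k).2 h), startJob_m02]

theorem join_m41 (a : NetState m) (j : Fin m) (h : a.o4 j = none) :
    M.network.join (.m41 j) (M.conc a) =
      M.conc { a with o4 := Function.update a.o4 j (some 2) } := by
  rw [join_eq_startJob ((M.canBegin_m41 a j).2 h), startJob_m41]

/-- A job which arrives to a class of capacity zero and can begin service is routed on. -/
theorem flush_join_of_canBegin {a : NetState m} {c d : Cls m} {z : QState (Srv m) (Cls m)}
    (h : M.network.Flush (M.network.join c (M.conc a)) z) (hb : M.network.CanBegin c (M.conc a))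
    (hc : M.network.service c = 0) (hd : M.network.next c = some d) (hcd : srv M c ≠ srv M d)
    (he : ∀ c', M.network.server c' = M.network.server c → (M.conc a).waiting c' = 0) :
    M.network.Flush (M.network.join d (M.conc a)) z := by
  rw [join_eq_startJob hb] at h
  obtain ⟨y, hy, hz⟩ := h.startJob (M.not_passing_conc a) hb.1 hc
  have hr : M.network.route c (M.conc a) = M.network.join d (M.conc a) := by
    unfold QNetwork.route; rw [hd]
  rw [hr] at hy
  have hy' := hy.eq_of_empty (fun c' hc' => by
    rw [join_waiting_of_ne (by rintro rfl; exact hcd hc'.symm)]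
    exact he c' hc')
  rwa [← hy']

/-- If the third server is idle, the job which arrives to `c33` becomes a signal for `S01`. -/
theorem flush_join_c33_idle {a : NetState m} {i : Fin 2} {z : QState (Srv m) (Cls m)}
    (h : M.network.Flush (M.network.join (.c33 i) (M.conc a)) z)
    (h1 : (a.sub i).o3 = none) (h2 : (a.sub i).w31 = 0) :
    M.network.Flush (M.network.join (.m01 i) (M.conc a)) z :=
  M.flush_join_of_canBegin h ((M.canBegin_c33 a i).2 ⟨h1, h2⟩) rfl rfl (by simp [srv])
    (M.empty_sub2 h2)

/-- If the third server is busy, the job which arrives to `c33` is dropped. -/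
theorem flush_join_c33_busy {a : NetState m} {i : Fin 2} {z : QState (Srv m) (Cls m)}
    (h : M.network.Flush (M.network.join (.c33 i) (M.conc a)) z) (h1 : (a.sub i).o3 ≠ none) :
    z = M.conc a := by
  rw [join_eq_self (fun hb => h1 ((M.canBegin_c33 a i).1 hb).1) rfl] at h
  exact M.flush_conc h

/-- Unless the walking job is at `S3 j`, the job which arrives to `m35 j` makes `S4 j` busy. -/
theorem flush_join_m35_idle {a : NetState m} {j : Fin m} {z : QState (Srv m) (Cls m)}
    (h : M.network.Flush (M.network.join (.m35 j) (M.conc a)) z)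
    (h1 : ∀ p k r, a.walk = some (p, k, r) → M.α k (bits p) ≠ j) (h2 : a.o4 j = none) :
    z = M.conc { a with o4 := Function.update a.o4 j (some 2) } := by
  have := M.flush_join_of_canBegin h ((M.canBegin_m35 a j).2 h1) rfl rfl (by simp [srv])
    M.empty_S3
  rw [join_m41 _ _ _ h2] at this
  exact M.flush_conc this

/-- If the walking job is at `S3 j`, the job which arrives to `m35 j` is dropped. -/
theorem flush_join_m35_busy {a : NetState m} {j : Fin m} {z : QState (Srv m) (Cls m)}
    (h : M.network.Flush (M.network.join (.m35 j) (M.conc a)) z) {p : Fin 4} {k : Fin m} {r : ℕ}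
    (h1 : a.walk = some (p, k, r)) (h2 : M.α k (bits p) = j) : z = M.conc a := by
  rw [join_eq_self (fun hb => (M.canBegin_m35 a j).1 hb p k r h1 h2) rfl] at h
  exact M.flush_conc h

/-- If `S4 j` is idle, the job which arrives to `m42 j` starts the service of the state `j`. -/
theorem flush_join_m42_idle {a : NetState m} {j : Fin m} {z : QState (Srv m) (Cls m)}
    (h : M.network.Flush (M.network.join (.m42 j) (M.conc a)) z)
    (h1 : a.o4 j = none) (h2 : a.o02 = none) :
    z = M.conc { a with o02 := some (j, 271) } := by
  have := M.flush_join_of_canBegin h ((M.canBegin_m42 a j).2 h1) rfl rfl (by simp [srv])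
    M.empty_S4
  rw [join_m02 _ _ _ h2] at this
  exact M.flush_conc this

theorem flush_join_m42_busy {a : NetState m} {j : Fin m} {z : QState (Srv m) (Cls m)}
    (h : M.network.Flush (M.network.join (.m42 j) (M.conc a)) z) (h1 : a.o4 j ≠ none) :
    z = M.conc a := by
  rw [join_eq_self (fun hb => h1 ((M.canBegin_m42 a j).1 hb)) rfl] at h
  exact M.flush_conc h

theorem flush_join_m43_busy {a : NetState m} {j : Fin m} {z : QState (Srv m) (Cls m)}
    (h : M.network.Flush (M.network.join (.m43 j) (M.conc a)) z) (h1 : a.o4 j ≠ none) :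
    z = M.conc a := by
  rw [join_eq_self (fun hb => h1 ((M.canBegin_m43 a j).1 hb)) rfl] at h
  exact M.flush_conc h

/-- A job which passes through `m43 j` starts a service in the class `c41 i` or `c51 i`, according
to the counter which is decremented or incremented in the state `j`. -/
theorem flush_join_m43_idle {a : NetState m} {j : Fin m} {z : QState (Srv m) (Cls m)}
    (h : M.network.Flush (M.network.join (.m43 j) (M.conc a)) z)
    (h1 : a.o4 j = none) (h2 : ∀ i, (a.sub i).o4 = none) (h3 : ∀ i, (a.sub i).o5 = none) :
    z = M.conc { a with sub := fun i => { a.sub i with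
      o4 := if M.β j i = -1 then some 20 else none
      o5 := if M.β j i = 1 then some 2 else none } } := by
  have hb := (M.canBegin_m43 a j).2 h1
  have hsub : ∀ i l, srv M (.m43 j) ≠ .sub i l := by simp [srv]
  have key : ∀ d, M.network.next (.m43 j) = some d → srv M (.m43 j) ≠ srv M d →
      M.network.Flush (M.network.join d (M.conc a)) z := fun d hd hcd =>
    M.flush_join_of_canBegin h hb rfl hd hcd M.empty_S4
  have hself : ∀ i, { a.sub i with o4 := none, o5 := none } = a.sub i := by
    intro i
    have h2 := h2 i
    have h3 := h3 i
    revert h2 h3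
    cases a.sub i
    rintro h2 h3
    simp_all
  have hmem := M.β_mem j
  simp only [Set.mem_insert_iff, Set.mem_singleton_iff] at hmem
  rcases hmem with hβ | hβ | hβ | hβ | hβ
  · have := key (.c41 0) (by simp [network, nextCls, hβ]) (by simp [srv])
    rw [M.join_c41 a 0 (h2 0)] at this
    rw [M.flush_conc this]
    congr 1
    simp only [NetState.setSub, hβ]
    congr 1
    funext i
    fin_cases i
    · simp [h3]
    · simp [hself]
  · have := key (.c41 1) (by simp [network, nextCls, hβ]) (by simp [srv])
    rw [M.join_c41 a 1 (h2 1)] at this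
    rw [M.flush_conc this]
    congr 1
    simp only [NetState.setSub, hβ]
    congr 1
    funext i
    fin_cases i
    · simp [hself]
    · simp [h3]
  · rw [join_eq_startJob hb] at h
    obtain ⟨y, hy, hz⟩ := h.startJob (M.not_passing_conc a) hb.1 rfl
    have hr : M.network.route (.m43 j) (M.conc a) = M.conc a := by
      unfold QNetwork.route
      simp [network, nextCls, hβ]
    rw [hr] at hy
    have hy' := hy.eq_of_empty M.empty_S4
    subst hy'
    rw [M.flush_conc hz]
    have hall : ∀ f, f = a.sub → { a with sub := f } = a := by
      rintro _ rfl
      rfl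
    congr 1
    refine (hall _ (funext fun i => ?_)).symm
    fin_cases i <;> simp [hβ, hself]
  · have := key (.c51 0) (by simp [network, nextCls, hβ]) (by simp [srv])
    rw [M.join_c51 a 0 (h3 0)] at this
    rw [M.flush_conc this]
    congr 1
    simp only [NetState.setSub, hβ]
    congr 1
    funext i
    fin_cases i
    · simp [h2]
    · simp [hself]
  · have := key (.c51 1) (by simp [network, nextCls, hβ]) (by simp [srv])
    rw [M.join_c51 a 1 (h3 1)] at this
    rw [M.flush_conc this]
    congr 1
    simp only [NetState.setSub, hβ]
    congr 1
    funext i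
    fin_cases i
    · simp [hself]
    · simp [h2]

/-- Waiting signals have priority over the job in `m03`, which passes on only when there are none. -/
theorem flush_finish_m01 {a : NetState m} {i : Fin 2} {y z : QState (Srv m) (Cls m)}
    (h : M.network.Select .S01 (M.network.route (.m01 i) (free .S01 (M.conc a))) y)
    (hz : M.network.Flush y z) (hw : a.w03 = none ∨ a.walk = none) :
    z = M.conc { a with o01 := none }.select01 := by
  have h1 : M.network.route (.m01 i) (free .S01 (M.conc a)) =
    M.conc { a with o01 := none } := M.conc_o01 a none
  rw [h1] at h
  have ho : (M.conc { a with o01 := none }).serving .S01 = none := rfl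
  unfold NetState.select01
  by_cases h0 : 0 < a.w01 0
  · have hy := h.eq_start ho (.m01 0) rfl h0 (by
      intro c hc hcw hne
      rcases M.server_S01 hc with ⟨i, rfl⟩ | ⟨k, rfl⟩
      · fin_cases i
        · exact absurd rfl hne
        · simp [network, prio]
      · simp [network, prio])
    rw [conc_w01, startJob_m01] at hy
    subst hy
    rw [M.flush_conc hz, if_pos h0]
    rfl
  rw [if_neg h0]
  by_cases h1 : 0 < a.w01 1
  · have hy := h.eq_start ho (.m01 1) rfl h1 (by
      intro c hc hcw hne
      rcases M.server_S01 hc with ⟨i, rfl⟩ | ⟨k, rfl⟩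
      · fin_cases i
        · exact absurd hcw h0
        · exact absurd rfl hne
      · simp [network, prio])
    rw [conc_w01, startJob_m01] at hy
    subst hy
    rw [M.flush_conc hz, if_pos h1]
    rfl
  rw [if_neg h1]
  have hall : ∀ i, a.w01 i = 0 := by
    intro i; fin_cases i
    · exact Nat.eq_zero_of_not_pos h0
    · exact Nat.eq_zero_of_not_pos h1
  rcases hk : a.w03 with _ | k
  · have hy := h.eq_of_empty (M.empty_S01 hall hk)
    subst hy
    rw [M.flush_conc hz, hk]
  · have hwalk : a.walk = none := by simpa [hk] using hw
    have hy := h.eq_start ho (.m03 k) rfl (by simp [conc, hk]) (by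
      intro c hc hcw hne
      rcases M.server_S01 hc with ⟨i, rfl⟩ | ⟨k', rfl⟩
      · exact absurd (hall i) hcw.ne'
      · by_cases hkk : k = k'
        · exact absurd (hkk ▸ rfl) hne
        · simp [conc, hk, hkk] at hcw)
    have hw1 : (M.conc { a with o01 := none }).waiting (.m03 k) - 1 = 0 := by simp [conc, hk]
    rw [hw1, conc_w03_none _ _ _ (by exact hk)] at hy
    subst hy
    obtain ⟨y', hy', hz'⟩ := hz.startJob (M.not_passing_conc _) rfl rfl
    have hr : ∀ x, M.network.route (.m03 k) x = M.network.join (probe 0 k) x := fun _ => rfl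
    rw [hr, join_probe _ _ _ _ (by exact hwalk)] at hy'
    have hy'' := hy'.eq_of_empty (M.empty_S01 hall rfl)
    subst hy''
    rw [M.flush_conc hz', hk]

/-- The job of the old state begins its walk if `S01` is idle, and otherwise waits in `m03`. -/
theorem flush_finish_m02 {a : NetState m} {k : Fin m} {y z : QState (Srv m) (Cls m)}
    (h : M.network.Select .S02 (M.network.route (.m02 k) (free .S02 (M.conc a))) y)
    (hz : M.network.Flush y z) (hw : a.w03 = none) (hw' : a.walk = none)
    (h01 : a.o01 = none → ∀ i, a.w01 i = 0) :
    z = M.conc (if a.o01 = none then { a with o02 := none, walk := some (0, k, 9) }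
      else { a with o02 := none, w03 := some k }) := by
  have h1 : M.network.route (.m02 k) (free .S02 (M.conc a)) =
    M.network.join (.m03 k) (M.conc { a with o02 := none }) :=
      congrArg (M.network.join (.m03 k)) (M.conc_o02 a none)
  rw [h1] at h
  have hy := h.eq_of_empty (fun c hc => by
    rw [join_waiting_of_ne (by rintro rfl; simp [network, srv] at hc)]
    exact M.empty_S02 c hc)
  subst hy
  by_cases ho : a.o01 = none
  · rw [if_pos ho]
    have hb := (M.canBegin_m03 { a with o02 := none } k (h01 ho) hw).2 ho
    have := M.flush_join_of_canBegin hz hb rfl (d := probe 0 k) rfl (by simp [srv, probe])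
      (M.empty_S01 (h01 ho) hw)
    rw [join_probe _ _ _ _ (by exact hw')] at this
    exact M.flush_conc this
  · rw [if_neg ho]
    have hb : ¬ M.network.CanBegin (.m03 k) (M.conc { a with o02 := none }) := by
      intro hb
      have := hb.1
      simp [network, srv, conc] at this
      exact ho this
    rw [join_eq_wait hb rfl] at hz
    have hw1 : (M.conc { a with o02 := none }).waiting (.m03 k) + 1 = 1 := by simp [conc, hw]
    rw [hw1, conc_w03_some _ _ _ (by exact hw)] at hz
    exact M.flush_conc hz

theorem flush_finish_probe {a : NetState m} {p : Fin 4} {k : Fin m} {r : ℕ}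
    {y z : QState (Srv m) (Cls m)} (ha : a.walk = some (p, k, r))
    (h : M.network.Select (.S3 (M.α k (bits p)))
      (M.network.route (probe p k) (free (.S3 (M.α k (bits p))) (M.conc a))) y)
    (hz : M.network.Flush y z) :
    z = M.conc { a with walk := if p = 3 then none else some (p + 1, k, 9) } := by
  have h1 : free (.S3 (M.α k (bits p))) (M.conc a) = M.conc { a with walk := none } :=
    M.conc_walk_none a p k r ha
  rw [h1] at h
  have h2 : M.network.route (probe p k) (M.conc { a with walk := none }) =
      M.conc { a with walk := if p = 3 then none else some (p + 1, k, 9) } := by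
    by_cases hp : p = 3
    · subst hp; rfl
    · rw [if_neg hp]
      have hr : M.network.next (probe p k) = some (probe (p + 1) k) := by
        fin_cases p
        · rfl
        · rfl
        · rfl
        · exact absurd rfl hp
      unfold QNetwork.route
      rw [hr]
      exact M.join_probe _ _ _ rfl
  rw [h2] at h
  have hy := h.eq_of_empty M.empty_S3
  subst hy
  exact M.flush_conc hz

theorem flush_finish_m41 {a : NetState m} {j : Fin m} {y z : QState (Srv m) (Cls m)}
    (h : M.network.Select (.S4 j) (M.network.route (.m41 j) (free (.S4 j) (M.conc a))) y)
    (hz : M.network.Flush y z) :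
    z = M.conc { a with o4 := Function.update a.o4 j none } := by
  have h1 : M.network.route (.m41 j) (free (.S4 j) (M.conc a)) =
    M.conc { a with o4 := Function.update a.o4 j none } := M.conc_o4j a j none
  rw [h1] at h
  have hy := h.eq_of_empty M.empty_S4
  subst hy
  exact M.flush_conc hz

end SCM

/-! ### The invariant of a subnetwork -/

/-- For each of the external arrivals of a subnetwork, and for the arrival of the class `m43 j` by
which the counters are changed: `1` if it is still to be carried out at this instant, else `0`. -/
structure SubFlags where
  f22 : ℕ
  f42 : ℕ
  f13 : ℕ
  f23 : ℕ
  f14 : ℕ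
  f32 : ℕ
  f43 : ℕ

/-- The state of the Rybko–Stolyar servers: only the first server works, with its buffers
`c12`, `c11` containing `wa`, `wp` jobs (`md = 0`); or only the second server works, with its
buffers `c21`, `c22` containing `wa`, `wp` jobs (`md = 1`); or both are idle (`md = 2`). The
remaining service time is `r`, with the convention `r = 50` if both are idle. -/
def RSState (s : SubState) (md r wa wp : ℕ) : Prop :=
  (md = 0 ∧ s.o1 = some r ∧ s.o2 = none ∧ s.w12 = wa ∧ s.w11 = wp ∧ s.w21 = 0 ∧ s.w22 = 0) ∨
  (md = 1 ∧ s.o2 = some r ∧ s.o1 = none ∧ s.w21 = wa ∧ s.w22 = wp ∧ s.w12 = 0 ∧ s.w11 = 0) ∨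
  (md = 2 ∧ s.o1 = none ∧ s.o2 = none ∧ s.w12 = 0 ∧ s.w11 = 0 ∧ s.w21 = 0 ∧ s.w22 = 0 ∧
    wa = 0 ∧ wp = 0 ∧ r = 50)

/-- The invariant of the Rybko–Stolyar servers at time `τ` (in hundredths) of a cycle which extends
from `100` to `400`; `z` is the counter, `ap` and `am` tell whether an additional job has been
inserted, or a job left out, in this cycle, and `N` is the number of jobs which have entered `c31`. -/
structure RSCore (τ z ap am : ℕ) (f : SubFlags) (md r wa wp N : ℕ) : Prop where
  range : 100 ≤ τ ∧ τ < 400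
  flag22 : f.f22 = 0 ∨ f.f22 = 1 ∧ τ % 100 = 0
  flag42 : f.f42 = 0 ∨ f.f42 = 1 ∧ τ % 100 = 2
  flag13 : f.f13 = 0 ∨ f.f13 = 1 ∧ τ = 160
  flag23 : f.f23 = 0 ∨ f.f23 = 1 ∧ τ = 210
  flag14 : f.f14 = 0 ∨ f.f14 = 1 ∧ τ = 260
  adjust : ap ≤ 1 ∧ am ≤ 1 ∧ am ≤ z ∧ (τ < 302 → ap = 0 ∧ am = 0)
  /-- Services begin and end at multiples of half a unit of time. -/
  slot : r ≤ 50 ∧ (md < 2 → (r + τ) % 50 = 0) ∧ (md = 2 → r = 50 ∧ wa = 0 ∧ wp = 0) ∧ md ≤ 2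
  /-- The number of jobs: the counter and one more job for each arrival in the current unit of
  time, less one job which leaves at the middle of the unit; a job whose service is due is still
  counted. -/
  count : wa + wp + (3 - md) / 2 + (τ % 100 + 50) / 100 + am + f.f22 + f.f42 =
    z + (50 - r) / 50 + 1 + (τ % 100 + 98) / 100 + ap
  /-- If the counter is zero, the first server works in the first half of each unit of time, and
  the second server in the second half. -/
  zero : z = 0 → τ < 300 →
    (md = 0 → (τ % 100 = 0 → wp = 0) ∧ (0 < τ % 100 → wa = 0) ∧
      (50 ≤ τ % 100 → τ % 100 = 50 ∧ r = 0)) ∧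
    (md = 1 → (τ % 100 = 0 → wa = 0 ∧ r = 0) ∧ (0 < τ % 100 → 50 ≤ τ % 100 ∧ r ≠ 0))
  before13 : (τ < 160 ∨ f.f13 = 1) → N = 0
  /-- The job which tests the first server at time `160` gets through iff the second server works. No
  job is completed before time `200`, so the same server still works then. -/
  after13 : 160 ≤ τ → f.f13 = 0 → τ < 200 → N ≤ 1 ∧ (N = 1 ↔ md = 1)
  /-- If the first test succeeded and the first server works now, the servers changed places at time
  `200`, and only a `c42` job which arrived since then waits in `c11`. -/
  before23 : 200 ≤ τ → (τ < 210 ∨ f.f23 = 1) → N ≤ 1 ∧ (z = 0 → N = 1) ∧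
    (N = 1 → md = 0 → wp + f.f42 = (τ % 100 + 98) / 100)
  /-- If the first two tests succeeded, the servers changed places at time `200`. They change again at
  time `250` only if no `c12` job waits, that is, if the counter is zero. -/
  after23 : 210 ≤ τ → f.f23 = 0 → τ ≤ 250 → N ≤ 2 ∧ (z = 0 → N = 2) ∧
    (N = 2 → (md = 0 ∧ wp = 1) ∨ (z = 0 ∧ τ = 250 ∧ r ≠ 0))
  /-- If the first two tests succeeded and the counter is positive, the third test will fail. -/
  before14 : 250 < τ → (τ < 260 ∨ f.f14 = 1) → N ≤ 2 ∧ (z = 0 → N = 2) ∧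
    (N = 2 → 1 ≤ z → md = 0)
  after14 : 260 ≤ τ → f.f14 = 0 → N ≤ 3 ∧ (N = 3 ↔ z = 0)

namespace RSCore

variable {τ z ap am : ℕ} {f : SubFlags} {md r wa wp N : ℕ}

theorem arrive22_first (h : RSCore τ z ap am f 0 r wa wp N) (hf : f.f22 = 1) :
    RSCore τ z ap am { f with f22 := 0 } 0 r (wa + 1) wp N := by
  obtain ⟨h1, h2, h3, h4, h5, h6, h7, h8, h9, h10, h11, h12, h13, h14, h15, h16⟩ := h
  constructor <;> grind

theorem arrive22_second (h : RSCore τ z ap am f 1 r wa wp N) (hf : f.f22 = 1) :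
    RSCore τ z ap am { f with f22 := 0 } 1 r wa (wp + 1) N := by
  obtain ⟨h1, h2, h3, h4, h5, h6, h7, h8, h9, h10, h11, h12, h13, h14, h15, h16⟩ := h
  constructor <;> grind

theorem arrive22_idle (h : RSCore τ z ap am f 2 r wa wp N) (hf : f.f22 = 1) :
    RSCore τ z ap am { f with f22 := 0 } 0 50 0 0 N := by
  obtain ⟨h1, h2, h3, h4, h5, h6, h7, h8, h9, h10, h11, h12, h13, h14, h15, h16⟩ := h
  constructor <;> grind

theorem arrive42_first (h : RSCore τ z ap am f 0 r wa wp N) (hf : f.f42 = 1) :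
    RSCore τ z ap am { f with f42 := 0 } 0 r wa (wp + 1) N := by
  obtain ⟨h1, h2, h3, h4, h5, h6, h7, h8, h9, h10, h11, h12, h13, h14, h15, h16⟩ := h
  constructor <;> grind

theorem arrive42_second (h : RSCore τ z ap am f 1 r wa wp N) (hf : f.f42 = 1) :
    RSCore τ z ap am { f with f42 := 0 } 1 r (wa + 1) wp N := by
  obtain ⟨h1, h2, h3, h4, h5, h6, h7, h8, h9, h10, h11, h12, h13, h14, h15, h16⟩ := h
  constructor <;> grind

/-- Both servers can be idle only at the beginning of a unit of time. -/
theorem mode_lt (h : RSCore τ z ap am f md r wa wp N) (hτ : τ % 100 ≠ 0) : md < 2 := by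
  obtain ⟨h1, h2, h3, h4, h5, h6, h7, h8, h9, h10, h11, h12, h13, h14, h15, h16⟩ := h
  clear h10 h11 h12 h13 h14 h15 h16
  omega

/-- A job which is left out decrements the counter. -/
theorem drop42 (h : RSCore τ z ap am f md r wa wp N) (hf : f.f42 = 1) (hτ : τ = 302) (ham : am = 0)
    (hz : 1 ≤ z) :
    RSCore τ z ap 1 { f with f42 := 0 } md r wa wp N := by
  obtain ⟨h1, h2, h3, h4, h5, h6, h7, h8, h9, h10, h11, h12, h13, h14, h15, h16⟩ := h
  constructor <;> grind

/-- An additional `c11` job increments the counter; it waits if the first server works, and otherwise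
passes on to the second server. -/
theorem insert_first (h : RSCore τ z ap am f 0 r wa wp N) (hτ : τ = 302) (hap : ap = 0) :
    RSCore τ z 1 am f 0 r wa (wp + 1) N := by
  obtain ⟨h1, h2, h3, h4, h5, h6, h7, h8, h9, h10, h11, h12, h13, h14, h15, h16⟩ := h
  constructor <;> grind

theorem insert_second (h : RSCore τ z ap am f 1 r wa wp N) (hτ : τ = 302) (hap : ap = 0) :
    RSCore τ z 1 am f 1 r (wa + 1) wp N := by
  obtain ⟨h1, h2, h3, h4, h5, h6, h7, h8, h9, h10, h11, h12, h13, h14, h15, h16⟩ := h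
  constructor <;> grind

theorem arrive13_busy (h : RSCore τ z ap am f 0 r wa wp N) (hf : f.f13 = 1) :
    RSCore τ z ap am { f with f13 := 0 } 0 r wa wp N := by
  obtain ⟨h1, h2, h3, h4, h5, h6, h7, h8, h9, h10, h11, h12, h13, h14, h15, h16⟩ := h
  constructor <;> grind

theorem arrive13_idle (h : RSCore τ z ap am f 1 r wa wp N) (hf : f.f13 = 1) :
    RSCore τ z ap am { f with f13 := 0 } 1 r wa wp (N + 1) := by
  obtain ⟨h1, h2, h3, h4, h5, h6, h7, h8, h9, h10, h11, h12, h13, h14, h15, h16⟩ := h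
  constructor <;> grind

theorem arrive23_busy (h : RSCore τ z ap am f 1 r wa wp N) (hf : f.f23 = 1) :
    RSCore τ z ap am { f with f23 := 0 } 1 r wa wp N := by
  obtain ⟨h1, h2, h3, h4, h5, h6, h7, h8, h9, h10, h11, h12, h13, h14, h15, h16⟩ := h
  constructor <;> grind

theorem arrive23_idle (h : RSCore τ z ap am f 0 r wa wp N) (hf : f.f23 = 1) :
    RSCore τ z ap am { f with f23 := 0 } 0 r wa wp (N + 1) := by
  obtain ⟨h1, h2, h3, h4, h5, h6, h7, h8, h9, h10, h11, h12, h13, h14, h15, h16⟩ := h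
  constructor <;> grind

theorem arrive14_busy (h : RSCore τ z ap am f 0 r wa wp N) (hf : f.f14 = 1) :
    RSCore τ z ap am { f with f14 := 0 } 0 r wa wp N := by
  obtain ⟨h1, h2, h3, h4, h5, h6, h7, h8, h9, h10, h11, h12, h13, h14, h15, h16⟩ := h
  constructor <;> grind

theorem arrive14_idle (h : RSCore τ z ap am f 1 r wa wp N) (hf : f.f14 = 1) :
    RSCore τ z ap am { f with f14 := 0 } 1 r wa wp (N + 1) := by
  obtain ⟨h1, h2, h3, h4, h5, h6, h7, h8, h9, h10, h11, h12, h13, h14, h15, h16⟩ := h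
  constructor <;> grind

theorem finish_first (h : RSCore τ z ap am f 0 0 (wa + 1) wp N)  :
    RSCore τ z ap am f 0 50 wa wp N := by
  obtain ⟨h1, h2, h3, h4, h5, h6, h7, h8, h9, h10, h11, h12, h13, h14, h15, h16⟩ := h
  constructor <;> grind

theorem finish_second (h : RSCore τ z ap am f 1 0 (wa + 1) wp N)  :
    RSCore τ z ap am f 1 50 wa wp N := by
  obtain ⟨h1, h2, h3, h4, h5, h6, h7, h8, h9, h10, h11, h12, h13, h14, h15, h16⟩ := h
  constructor <;> grind

/-- When the first server runs out of `c12` jobs, all `c11` jobs move to the second server, which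
starts to work. -/
theorem switch_first (h : RSCore τ z ap am f 0 0 0 (wp + 1) N)  :
    RSCore τ z ap am f 1 50 wp 0 N := by
  obtain ⟨h1, h2, h3, h4, h5, h6, h7, h8, h9, h10, h11, h12, h13, h14, h15, h16⟩ := h
  constructor <;> grind

/-- When the second server runs out of `c21` jobs, all `c22` jobs move to the first server, which
starts to work. -/
theorem switch_second (h : RSCore τ z ap am f 1 0 0 (wp + 1) N)  :
    RSCore τ z ap am f 0 50 wp 0 N := by
  obtain ⟨h1, h2, h3, h4, h5, h6, h7, h8, h9, h10, h11, h12, h13, h14, h15, h16⟩ := h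
  constructor <;> grind

/-- Both servers become idle; this is possible only at the beginning of a unit of time. -/
theorem idle_first (h : RSCore τ z ap am f 0 0 0 0 N)  :
    RSCore τ z ap am f 2 50 0 0 N := by
  obtain ⟨h1, h2, h3, h4, h5, h6, h7, h8, h9, h10, h11, h12, h13, h14, h15, h16⟩ := h
  constructor <;> grind

theorem idle_second (h : RSCore τ z ap am f 1 0 0 0 N)  :
    RSCore τ z ap am f 2 50 0 0 N := by
  obtain ⟨h1, h2, h3, h4, h5, h6, h7, h8, h9, h10, h11, h12, h13, h14, h15, h16⟩ := h
  constructor <;> grind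

theorem congr (h : RSCore τ z ap am f md r wa wp N) {g : SubFlags} (h22 : g.f22 = f.f22)
    (h42 : g.f42 = f.f42) (h13 : g.f13 = f.f13) (h23 : g.f23 = f.f23) (h14 : g.f14 = f.f14) :
    RSCore τ z ap am g md r wa wp N := by
  obtain ⟨h1, h2, h3, h4, h5, h6, h7, h8, h9, h10, h11, h12, h13, h14, h15, h16⟩ := h
  constructor <;> grind

end RSCore

/-- The flags of a subnetwork at the beginning of the instant `τ`. -/
structure SubFlags.Fresh (f : SubFlags) (τ : ℕ) : Prop where
  f22 : f.f22 = 1 ∧ τ % 100 = 0 ∨ f.f22 = 0 ∧ τ % 100 ≠ 0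
  f42 : f.f42 = 1 ∧ τ % 100 = 2 ∨ f.f42 = 0 ∧ τ % 100 ≠ 2
  f13 : f.f13 = 1 ∧ τ = 160 ∨ f.f13 = 0 ∧ τ ≠ 160
  f23 : f.f23 = 1 ∧ τ = 210 ∨ f.f23 = 0 ∧ τ ≠ 210
  f14 : f.f14 = 1 ∧ τ = 260 ∨ f.f14 = 0 ∧ τ ≠ 260
  f32 : f.f32 = 1 ∧ τ = 150 ∨ f.f32 = 0 ∧ τ ≠ 150
  f43 : f.f43 = 1 ∧ τ = 300 ∨ f.f43 = 0 ∧ τ ≠ 300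

/-- Nothing is pending in a subnetwork. -/
structure SubFlags.Done (f : SubFlags) : Prop where
  f22 : f.f22 = 0
  f42 : f.f42 = 0
  f13 : f.f13 = 0
  f23 : f.f23 = 0
  f14 : f.f14 = 0
  f32 : f.f32 = 0
  f43 : f.f43 = 0

namespace RSCore

variable {τ z ap am : ℕ} {f g : SubFlags} {md r wa wp N : ℕ}

/-- After the arrivals of an instant one of the two servers works. -/
theorem tick_mode (h : RSCore τ z ap am f md r wa wp N) (hf : f.Done) : md < 2 := by
  obtain ⟨h1, h2, h3, h4, h5, h6, h7, h8, h9, h10, h11, h12, h13, h14, h15, h16⟩ := h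
  obtain ⟨f1, f2, f3, f4, f5, f6, f7⟩ := hf
  clear h10 h11 h12 h13 h14 h15 h16
  omega

set_option maxHeartbeats 1000000 in
theorem tick (h : RSCore τ z ap am f md (r + 1) wa wp N) (hf : f.Done) (hg : g.Fresh (τ + 1))
    (hτ : τ + 1 < 400) : RSCore (τ + 1) z ap am g md r wa wp N := by
  have hmd : md = 0 ∨ md = 1 := by have := h.tick_mode hf; omega
  have hmod : τ % 100 = 99 ∧ (τ + 1) % 100 = 0 ∨ τ % 100 < 99 ∧ (τ + 1) % 100 = τ % 100 + 1 := by
    omega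
  obtain ⟨h1, h2, h3, h4, h5, h6, h7, h8, h9, h10, h11, h12, h13, h14, h15, h16⟩ := h
  obtain ⟨f1, f2, f3, f4, f5, f6, f7⟩ := hf
  obtain ⟨g1, g2, g3, g4, g5, g6, g7⟩ := hg
  constructor
  case count =>
    clear h10 h11 h12 h13 h14 h15 h16 h4 h5 h6 h7 g3 g4 g5 g6 g7 h2 h3
    rcases hmd with rfl | rfl <;> rcases hmod with ⟨_, hm⟩ | ⟨_, hm⟩ <;> rw [hm] at g1 g2 ⊢ <;>
      omega
  case before23 =>
    intro hτ1 hτ2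
    clear h11 h14 h15 h16 h4 h5 h6 h7 g3 g5 g6 g7 h2 h3
    rcases (by omega : τ = 199 ∨ 200 ≤ τ) with rfl | h200
    · clear h13
      rcases hmd with rfl | rfl <;> omega
    · clear h12
      rcases hmd with rfl | rfl <;> omega
  all_goals rcases hmd with rfl | rfl <;> grind

/-- At the end of a cycle the counter has its new value. -/
theorem restart (h : RSCore τ z ap am f md (r + 1) wa wp N) (hf : f.Done) (hτ : τ = 399)
    (hg : g.Fresh 100) {z' : ℕ} (hz : z' + am = z + ap) :
    RSCore 100 z' 0 0 g md r wa wp 0 := by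
  have hmd : md = 0 ∨ md = 1 := by have := h.tick_mode hf; omega
  obtain ⟨h1, h2, h3, h4, h5, h6, h7, h8, h9, h10, h11, h12, h13, h14, h15, h16⟩ := h
  obtain ⟨f1, f2, f3, f4, f5, f6, f7⟩ := hf
  obtain ⟨g1, g2, g3, g4, g5, g6, g7⟩ := hg
  rcases hmd with rfl | rfl <;> constructor <;> grind

end RSCore

/-- The third server, where `N` jobs have entered `c31` in this cycle: a `c32` job is served until
time `260`, and thereafter the `c31` jobs one after the other until time `260 + 4 * N`. -/
def ThirdInv (τ f32 N : ℕ) (o3 : Option (Bool × ℕ)) (w31 : ℕ) : Prop :=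
  (o3 = none ∧ w31 = 0 ∧ ((τ < 150 ∨ τ = 150 ∧ f32 = 1) ∧ N = 0 ∨ 260 + 4 * N ≤ τ)) ∨
  (∃ r, o3 = some (true, r) ∧ w31 = N ∧ r + τ = 260 ∧ 150 ≤ τ ∧ f32 = 0) ∨
  (∃ r, o3 = some (false, r) ∧ r + 4 * w31 + τ = 260 + 4 * N ∧ 260 ≤ τ ∧ r ≤ 4)

/-- A server which begins a service at time `300` of a cycle in which `e = 1`, as soon as its job
arrives (`f = 0`), and which completes it at the time `u`. -/
def TimerInv (u τ e f : ℕ) (o : Option ℕ) : Prop :=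
  (∃ r, o = some r ∧ e = 1 ∧ r + τ = u ∧ 300 ≤ τ ∧ f = 0) ∨
  (o = none ∧ (e = 0 ∨ τ < 300 ∨ f = 1 ∨ u ≤ τ))

/-- The invariant of a subnetwork at time `τ` of a cycle which begins with the counter `z`;
`inc` and `dec` tell whether the counter is incremented or decremented in this cycle. -/
def SubInv (τ z inc dec : ℕ) (f : SubFlags) (s : SubState) : Prop :=
  ∃ md r wa wp N ap am, RSState s md r wa wp ∧ RSCore τ z ap am f md r wa wp N ∧
    ThirdInv τ f.f32 N s.o3 s.w31 ∧ TimerInv 320 τ dec f.f43 s.o4 ∧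
    TimerInv 302 τ inc f.f43 s.o5 ∧ (inc ≤ 1 ∧ dec ≤ 1 ∧ dec ≤ z) ∧
    (f.f32 = 0 ∨ f.f32 = 1 ∧ τ = 150) ∧ (f.f43 = 0 ∨ f.f43 = 1 ∧ τ = 300) ∧
    (ap = 1 ↔ inc = 1 ∧ 302 ≤ τ ∧ s.o5 = none) ∧ (am = 1 ↔ dec = 1 ∧ 302 ≤ τ ∧ f.f42 = 0)

namespace RSState

variable {s : SubState} {md r wa wp : ℕ}

theorem pass22_first (h : RSState s 0 r wa wp) : RSState s.pass22 0 r (wa + 1) wp := by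
  obtain ⟨_, h1, h2, h3, h4, h5, h6⟩ | ⟨h, _⟩ | ⟨h, _⟩ := h
  · simp [RSState, SubState.pass22, SubState.join12, h1, h2, h3, h4, h5, h6]
  all_goals omega

theorem pass22_second (h : RSState s 1 r wa wp) : RSState s.pass22 1 r wa (wp + 1) := by
  obtain ⟨h, _⟩ | ⟨_, h1, h2, h3, h4, h5, h6⟩ | ⟨h, _⟩ := h
  · omega
  · simp [RSState, SubState.pass22, h1, h2, h3, h4, h5, h6]
  · omega

theorem pass22_idle (h : RSState s 2 r wa wp) : RSState s.pass22 0 50 0 0 := by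
  obtain ⟨h, _⟩ | ⟨h, _⟩ | ⟨_, h1, h2, h3, h4, h5, h6, _⟩ := h
  · omega
  · omega
  · simp [RSState, SubState.pass22, SubState.join12, h1, h2, h3, h4, h5, h6]

theorem pass11_first (h : RSState s 0 r wa wp) : RSState s.pass11 0 r wa (wp + 1) := by
  obtain ⟨_, h1, h2, h3, h4, h5, h6⟩ | ⟨h, _⟩ | ⟨h, _⟩ := h
  · simp [RSState, SubState.pass11, h1, h2, h3, h4, h5, h6]
  all_goals omega

theorem pass11_second (h : RSState s 1 r wa wp) : RSState s.pass11 1 r (wa + 1) wp := by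
  obtain ⟨h, _⟩ | ⟨_, h1, h2, h3, h4, h5, h6⟩ | ⟨h, _⟩ := h
  · omega
  · simp [RSState, SubState.pass11, SubState.join21, h1, h2, h3, h4, h5, h6]
  · omega

theorem o1_ne_none (h : RSState s 0 r wa wp) : s.o1 ≠ none := by
  obtain ⟨_, h1, _⟩ | ⟨h, _⟩ | ⟨h, _⟩ := h
  · simp [h1]
  all_goals omega

theorem o2_ne_none (h : RSState s 1 r wa wp) : s.o2 ≠ none := by
  obtain ⟨h, _⟩ | ⟨_, h1, _⟩ | ⟨h, _⟩ := h
  · omega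
  · simp [h1]
  · omega

theorem first_idle (h : RSState s 1 r wa wp) : s.o1 = none ∧ s.w12 = 0 ∧ s.w11 = 0 := by
  obtain ⟨h, _⟩ | ⟨_, h1, h2, h3, h4, h5, h6⟩ | ⟨h, _⟩ := h
  · omega
  · exact ⟨h2, h5, h6⟩
  · omega

theorem second_idle (h : RSState s 0 r wa wp) : s.o2 = none ∧ s.w21 = 0 ∧ s.w22 = 0 := by
  obtain ⟨_, h1, h2, h3, h4, h5, h6⟩ | ⟨h, _⟩ | ⟨h, _⟩ := h
  · exact ⟨h2, h5, h6⟩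
  all_goals omega

theorem of_o1 (h : RSState s md r wa wp) {k : ℕ} (ho : s.o1 = some k) : md = 0 ∧ r = k := by
  obtain ⟨h, h1, _⟩ | ⟨_, _, h1, _⟩ | ⟨_, h1, _⟩ := h
  · simp_all
  all_goals simp_all

theorem of_o2 (h : RSState s md r wa wp) {k : ℕ} (ho : s.o2 = some k) : md = 1 ∧ r = k := by
  obtain ⟨_, _, h1, _⟩ | ⟨h, h1, _⟩ | ⟨_, _, h1, _⟩ := h
  all_goals simp_all

theorem iterate_join21 (s : SubState) (n : ℕ) (ho : s.o2 ≠ none) :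
    SubState.join21^[n] s = { s with w21 := s.w21 + n } := by
  induction n generalizing s with
  | zero => rfl
  | succ n ih =>
    have : s.join21 = { s with w21 := s.w21 + 1 } := by simp [SubState.join21, ho]
    rw [Function.iterate_succ_apply, this, ih _ (by exact ho)]
    simp only [Nat.add_assoc, Nat.add_comm 1 n]

theorem iterate_join12 (s : SubState) (n : ℕ) (ho : s.o1 ≠ none) :
    SubState.join12^[n] s = { s with w12 := s.w12 + n } := by
  induction n generalizing s with
  | zero => rfl
  | succ n ih =>
    have : s.join12 = { s with w12 := s.w12 + 1 } := by simp [SubState.join12, ho]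
    rw [Function.iterate_succ_apply, this, ih _ (by exact ho)]
    simp only [Nat.add_assoc, Nat.add_comm 1 n]

theorem select1_next (h : RSState s 0 r (wa + 1) wp) :
    RSState { s with o1 := none }.select1 0 50 wa wp := by
  obtain ⟨_, h1, h2, h3, h4, h5, h6⟩ | ⟨h, _⟩ | ⟨h, _⟩ := h
  · simp [RSState, SubState.select1, h2, h3, h4, h5, h6]
  all_goals omega

theorem select1_switch (h : RSState s 0 r 0 (wp + 1)) :
    RSState { s with o1 := none }.select1 1 50 wp 0 := by
  obtain ⟨_, h1, h2, h3, h4, h5, h6⟩ | ⟨h, _⟩ | ⟨h, _⟩ := h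
  · unfold SubState.select1
    rw [if_neg (by simp [h3])]
    dsimp only
    rw [h4, Function.iterate_succ_apply, iterate_join21 _ _ (by simp [SubState.join21, h2, h5])]
    simp [RSState, SubState.join21, h2, h3, h5, h6]
  all_goals omega

theorem select1_idle (h : RSState s 0 r 0 0) :
    RSState { s with o1 := none }.select1 2 50 0 0 := by
  obtain ⟨_, h1, h2, h3, h4, h5, h6⟩ | ⟨h, _⟩ | ⟨h, _⟩ := h
  · simp [RSState, SubState.select1, h2, h3, h4, h5, h6]
  all_goals omega

theorem select2_next (h : RSState s 1 r (wa + 1) wp) :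
    RSState { s with o2 := none }.select2 1 50 wa wp := by
  obtain ⟨h, _⟩ | ⟨_, h1, h2, h3, h4, h5, h6⟩ | ⟨h, _⟩ := h
  · omega
  · simp [RSState, SubState.select2, h2, h3, h4, h5, h6]
  · omega

theorem select2_switch (h : RSState s 1 r 0 (wp + 1)) :
    RSState { s with o2 := none }.select2 0 50 wp 0 := by
  obtain ⟨h, _⟩ | ⟨_, h1, h2, h3, h4, h5, h6⟩ | ⟨h, _⟩ := h
  · omega
  · unfold SubState.select2
    rw [if_neg (by simp [h3])]
    dsimp only
    rw [h4, Function.iterate_succ_apply, iterate_join12 _ _ (by simp [SubState.join12, h2, h5])]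
    simp [RSState, SubState.join12, h2, h3, h5, h6]
  · omega

theorem select2_idle (h : RSState s 1 r 0 0) :
    RSState { s with o2 := none }.select2 2 50 0 0 := by
  obtain ⟨h, _⟩ | ⟨_, h1, h2, h3, h4, h5, h6⟩ | ⟨h, _⟩ := h
  · omega
  · simp [RSState, SubState.select2, h2, h3, h4, h5, h6]
  · omega

theorem join31 (h : RSState s md r wa wp) : RSState s.join31 md r wa wp := by
  unfold SubState.join31; split_ifs <;> exact h

end RSState

namespace SubState

variable (s : SubState)

/-- The part of the state of a subnetwork which belongs to the servers with the numbers 3, 4, 5. -/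
def rest : Option (Bool × ℕ) × ℕ × Option ℕ × Option ℕ := (s.o3, s.w31, s.o4, s.o5)

theorem rest_join12 : s.join12.rest = s.rest := by unfold join12; split_ifs <;> rfl

theorem rest_join21 : s.join21.rest = s.rest := by unfold join21; split_ifs <;> rfl

theorem rest_pass11 : s.pass11.rest = s.rest := by
  unfold pass11; split_ifs
  · exact s.rest_join21
  · rfl

theorem rest_pass22 : s.pass22.rest = s.rest := by
  unfold pass22; split_ifs
  · exact s.rest_join12
  · rfl

theorem rest_iterate {g : SubState → SubState} (hg : ∀ s, (g s).rest = s.rest) (n : ℕ) :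
    (g^[n] s).rest = s.rest := by
  induction n generalizing s with
  | zero => rfl
  | succ n ih => rw [Function.iterate_succ_apply, ih, hg]

theorem rest_select1 : s.select1.rest = s.rest := by
  unfold select1; split_ifs
  · rfl
  · rw [rest_iterate _ rest_join21]; rfl

theorem rest_select2 : s.select2.rest = s.rest := by
  unfold select2; split_ifs
  · rfl
  · rw [rest_iterate _ rest_join12]; rfl

theorem o4_join31 : s.join31.o4 = s.o4 := by unfold join31; split_ifs <;> rfl

theorem o5_join31 : s.join31.o5 = s.o5 := by unfold join31; split_ifs <;> rfl

end SubState

namespace SubInv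

variable {τ z inc dec : ℕ} {f : SubFlags} {s : SubState}

theorem arrive22 (h : SubInv τ z inc dec f s) (hf : f.f22 = 1) :
    SubInv τ z inc dec { f with f22 := 0 } s.pass22 := by
  obtain ⟨md, r, wa, wp, N, ap, am, hs, hc, h3, h4, h5, hz, h32, h43, hap, ham⟩ := h
  have hr := s.rest_pass22
  simp only [SubState.rest, Prod.mk.injEq] at hr
  obtain ⟨r1, r2, r3, r4⟩ := hr
  rw [← r1, ← r2] at h3
  rw [← r3] at h4
  rw [← r4] at h5 hap
  have hmd := hc.slot.2.2.2
  interval_cases md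
  · exact ⟨_, _, _, _, N, ap, am, hs.pass22_first, hc.arrive22_first hf, h3, h4, h5, hz, h32, h43,
      hap, ham⟩
  · exact ⟨_, _, _, _, N, ap, am, hs.pass22_second, hc.arrive22_second hf, h3, h4, h5, hz, h32,
      h43, hap, ham⟩
  · exact ⟨_, _, _, _, N, ap, am, hs.pass22_idle, hc.arrive22_idle hf, h3, h4, h5, hz, h32, h43,
      hap, ham⟩

/-- The `c42` job which arrives at time `302` is dropped iff a `c41` job is in service, which is how
the counter is decremented. -/
theorem arrive42 (h : SubInv τ z inc dec f s) (hf : f.f42 = 1) :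
    SubInv τ z inc dec { f with f42 := 0 } (if s.o4 = none then s.pass11 else s) := by
  obtain ⟨md, r, wa, wp, N, ap, am, hs, hc, h3, h4, h5, hz, h32, h43, hap, ham⟩ := h
  have hτ := hc.flag42
  have hadj := hc.adjust
  have hrange := hc.range
  split_ifs with ho
  · have hr := s.rest_pass11
    simp only [SubState.rest, Prod.mk.injEq] at hr
    obtain ⟨r1, r2, r3, r4⟩ := hr
    have ham' : am = 1 ↔ dec = 1 ∧ 302 ≤ τ ∧ 0 = 0 := by
      obtain ⟨r, h, _⟩ | ⟨_, h⟩ := h4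
      · simp [ho] at h
      · omega
    rw [← r1, ← r2] at h3
    rw [← r3] at h4
    rw [← r4] at h5 hap
    have hmd := hc.mode_lt (by omega)
    interval_cases md
    · exact ⟨_, _, _, _, N, ap, am, hs.pass11_first, hc.arrive42_first hf, h3, h4, h5, hz, h32,
        h43, hap, ham'⟩
    · exact ⟨_, _, _, _, N, ap, am, hs.pass11_second, hc.arrive42_second hf, h3, h4, h5, hz, h32,
        h43, hap, ham'⟩
  · obtain ⟨r', h, h6, h7, h8, h9⟩ | ⟨h, _⟩ := h4
    · have hτ' : τ = 302 := by omega
      refine ⟨_, _, _, _, N, ap, 1, hs, hc.drop42 hf hτ' (by omega) (by omega), h3,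
        .inl ⟨r', h, h6, h7, h8, h9⟩, h5, hz, h32, h43, hap, ?_⟩
      dsimp only
      omega
    · exact absurd h ho

/-- The third server when a job enters `c31`. -/
theorem third_join31 {N : ℕ} (h3 : ThirdInv τ f.f32 N s.o3 s.w31) (h1 : 160 ≤ τ)
    (h2 : τ ≤ 260) : ThirdInv τ f.f32 (N + 1) s.join31.o3 s.join31.w31 := by
  obtain ⟨h4, h5, h6⟩ | ⟨r, h4, h5, h6, h7, h8⟩ | ⟨r, h4, h5, h6, h7⟩ := h3
  · right; right
    refine ⟨4, ?_⟩
    simp [SubState.join31, h4, h5]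
    omega
  · right; left
    refine ⟨r, ?_⟩
    simp [SubState.join31, h4]
    omega
  · right; right
    refine ⟨r, ?_⟩
    simp [SubState.join31, h4]
    omega

theorem arrive13 (h : SubInv τ z inc dec f s) (hf : f.f13 = 1) :
    SubInv τ z inc dec { f with f13 := 0 }
      (if s.o1 = none ∧ s.w12 = 0 ∧ s.w11 = 0 then s.join31 else s) := by
  obtain ⟨md, r, wa, wp, N, ap, am, hs, hc, h3, h4, h5, hz, h32, h43, hap, ham⟩ := h
  have hτ := hc.flag13
  have hmd := hc.mode_lt (by omega)
  interval_cases md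
  · rw [if_neg fun h => hs.o1_ne_none h.1]
    exact ⟨_, _, _, _, N, ap, am, hs, hc.arrive13_busy hf, h3, h4, h5, hz, h32, h43, hap, ham⟩
  · rw [if_pos hs.first_idle]
    refine ⟨_, _, _, _, N + 1, ap, am, hs.join31, hc.arrive13_idle hf,
      third_join31 h3 (by omega) (by omega), ?_, ?_, hz, h32, h43, ?_, ham⟩
    · rw [s.o4_join31]; exact h4
    · rw [s.o5_join31]; exact h5
    · rw [s.o5_join31]; exact hap

theorem arrive14 (h : SubInv τ z inc dec f s) (hf : f.f14 = 1) :
    SubInv τ z inc dec { f with f14 := 0 }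
      (if s.o1 = none ∧ s.w12 = 0 ∧ s.w11 = 0 then s.join31 else s) := by
  obtain ⟨md, r, wa, wp, N, ap, am, hs, hc, h3, h4, h5, hz, h32, h43, hap, ham⟩ := h
  have hτ := hc.flag14
  have hmd := hc.mode_lt (by omega)
  interval_cases md
  · rw [if_neg fun h => hs.o1_ne_none h.1]
    exact ⟨_, _, _, _, N, ap, am, hs, hc.arrive14_busy hf, h3, h4, h5, hz, h32, h43, hap, ham⟩
  · rw [if_pos hs.first_idle]
    refine ⟨_, _, _, _, N + 1, ap, am, hs.join31, hc.arrive14_idle hf,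
      third_join31 h3 (by omega) (by omega), ?_, ?_, hz, h32, h43, ?_, ham⟩
    · rw [s.o4_join31]; exact h4
    · rw [s.o5_join31]; exact h5
    · rw [s.o5_join31]; exact hap

theorem arrive23 (h : SubInv τ z inc dec f s) (hf : f.f23 = 1) :
    SubInv τ z inc dec { f with f23 := 0 }
      (if s.o2 = none ∧ s.w21 = 0 ∧ s.w22 = 0 then s.join31 else s) := by
  obtain ⟨md, r, wa, wp, N, ap, am, hs, hc, h3, h4, h5, hz, h32, h43, hap, ham⟩ := h
  have hτ := hc.flag23
  have hmd := hc.mode_lt (by omega)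
  interval_cases md
  · rw [if_pos hs.second_idle]
    refine ⟨_, _, _, _, N + 1, ap, am, hs.join31, hc.arrive23_idle hf,
      third_join31 h3 (by omega) (by omega), ?_, ?_, hz, h32, h43, ?_, ham⟩
    · rw [s.o4_join31]; exact h4
    · rw [s.o5_join31]; exact h5
    · rw [s.o5_join31]; exact hap
  · rw [if_neg fun h => hs.o2_ne_none h.1]
    exact ⟨_, _, _, _, N, ap, am, hs, hc.arrive23_busy hf, h3, h4, h5, hz, h32, h43, hap, ham⟩

theorem o3_eq_none (h : SubInv τ z inc dec f s) (hf : f.f32 = 1) : s.o3 = none := by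
  obtain ⟨md, r, wa, wp, N, ap, am, hs, hc, h3, h4, h5, hz, h32, h43, hap, ham⟩ := h
  obtain ⟨h3, _⟩ | ⟨r, _, _, _, _, _⟩ | ⟨r, _, _, _, _⟩ := h3
  · exact h3
  · omega
  · omega

theorem arrive32 (h : SubInv τ z inc dec f s) (hf : f.f32 = 1) :
    SubInv τ z inc dec { f with f32 := 0 } { s with o3 := some (true, 110) } := by
  obtain ⟨md, r, wa, wp, N, ap, am, hs, hc, h3, h4, h5, hz, h32, h43, hap, ham⟩ := h
  have hN := hc.before13
  refine ⟨md, r, wa, wp, N, ap, am, hs, hc.congr rfl rfl rfl rfl rfl, .inr (.inl ?_), h4, h5, hz,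
    .inl rfl, h43, hap, ham⟩
  refine ⟨110, rfl, ?_⟩
  obtain ⟨_, h6, _⟩ | ⟨r, _, _, _, _, _⟩ | ⟨r, _, _, _, _⟩ := h3
  · dsimp only
    omega
  · omega
  · omega

theorem o4_eq_none (h : SubInv τ z inc dec f s) (hf : f.f43 = 1) : s.o4 = none := by
  obtain ⟨md, r, wa, wp, N, ap, am, hs, hc, h3, h4, h5, hz, h32, h43, hap, ham⟩ := h
  obtain ⟨r, _, _, _, _, _⟩ | ⟨h4, _⟩ := h4
  · omega
  · exact h4

theorem o5_eq_none (h : SubInv τ z inc dec f s) (hf : f.f43 = 1) : s.o5 = none := by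
  obtain ⟨md, r, wa, wp, N, ap, am, hs, hc, h3, h4, h5, hz, h32, h43, hap, ham⟩ := h
  obtain ⟨r, _, _, _, _, _⟩ | ⟨h5, _⟩ := h5
  · omega
  · exact h5

/-- The job which passes through `m43 j` starts the service which changes the counter. -/
theorem arrive43 (h : SubInv τ z inc dec f s) (hf : f.f43 = 1) :
    SubInv τ z inc dec { f with f43 := 0 } { s with
      o4 := if dec = 1 then some 20 else none
      o5 := if inc = 1 then some 2 else none } := by
  obtain ⟨md, r, wa, wp, N, ap, am, hs, hc, h3, h4, h5, hz, h32, h43, hap, ham⟩ := h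
  refine ⟨md, r, wa, wp, N, ap, am, hs, hc.congr rfl rfl rfl rfl rfl, h3, ?_, ?_, hz,
    h32, .inl rfl, ?_, ham⟩
  · by_cases hd : dec = 1
    · refine .inl ⟨20, by simp [hd], hd, ?_⟩
      dsimp only
      omega
    · refine .inr ⟨by simp [hd], ?_⟩
      omega
  · by_cases hi : inc = 1
    · refine .inl ⟨2, by simp [hi], hi, ?_⟩
      dsimp only
      omega
    · refine .inr ⟨by simp [hi], ?_⟩
      omega
  · dsimp only
    omega

theorem finish1 (h : SubInv τ z inc dec f s) (ho : s.o1 = some 0) :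
    SubInv τ z inc dec f { s with o1 := none }.select1 := by
  obtain ⟨md, r, wa, wp, N, ap, am, hs, hc, h3, h4, h5, hz, h32, h43, hap, ham⟩ := h
  have hr := { s with o1 := none }.rest_select1
  simp only [SubState.rest, Prod.mk.injEq] at hr
  obtain ⟨r1, r2, r3, r4⟩ := hr
  replace h3 : ThirdInv τ f.f32 N { s with o1 := none }.select1.o3
      { s with o1 := none }.select1.w31 := by
    rw [r1, r2]; exact h3
  rw [← r3] at h4
  rw [← r4] at h5 hap
  obtain ⟨rfl, rfl⟩ := hs.of_o1 ho
  rcases wa with _ | wa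
  · rcases wp with _ | wp
    · exact ⟨_, _, _, _, N, ap, am, hs.select1_idle, hc.idle_first, h3, h4, h5, hz, h32, h43,
        hap, ham⟩
    · exact ⟨_, _, _, _, N, ap, am, hs.select1_switch, hc.switch_first, h3, h4, h5, hz, h32, h43,
        hap, ham⟩
  · exact ⟨_, _, _, _, N, ap, am, hs.select1_next, hc.finish_first, h3, h4, h5, hz, h32, h43,
      hap, ham⟩

theorem finish2 (h : SubInv τ z inc dec f s) (ho : s.o2 = some 0) :
    SubInv τ z inc dec f { s with o2 := none }.select2 := by
  obtain ⟨md, r, wa, wp, N, ap, am, hs, hc, h3, h4, h5, hz, h32, h43, hap, ham⟩ := h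
  have hr := { s with o2 := none }.rest_select2
  simp only [SubState.rest, Prod.mk.injEq] at hr
  obtain ⟨r1, r2, r3, r4⟩ := hr
  replace h3 : ThirdInv τ f.f32 N { s with o2 := none }.select2.o3
      { s with o2 := none }.select2.w31 := by
    rw [r1, r2]; exact h3
  rw [← r3] at h4
  rw [← r4] at h5 hap
  obtain ⟨rfl, rfl⟩ := hs.of_o2 ho
  rcases wa with _ | wa
  · rcases wp with _ | wp
    · exact ⟨_, _, _, _, N, ap, am, hs.select2_idle, hc.idle_second, h3, h4, h5, hz, h32, h43,
        hap, ham⟩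
    · exact ⟨_, _, _, _, N, ap, am, hs.select2_switch, hc.switch_second, h3, h4, h5, hz, h32, h43,
        hap, ham⟩
  · exact ⟨_, _, _, _, N, ap, am, hs.select2_next, hc.finish_second, h3, h4, h5, hz, h32, h43,
      hap, ham⟩

theorem finish3 (h : SubInv τ z inc dec f s) {b : Bool} (ho : s.o3 = some (b, 0)) :
    SubInv τ z inc dec f { s with o3 := none }.select3 := by
  obtain ⟨md, r, wa, wp, N, ap, am, hs, hc, h3, h4, h5, hz, h32, h43, hap, ham⟩ := h
  have hw : (s.w31 = 0 ∧ 260 + 4 * N ≤ τ) ∨ 0 < s.w31 ∧ 4 * s.w31 + τ = 260 + 4 * N ∧ 260 ≤ τ := by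
    obtain ⟨h6, _⟩ | ⟨r, h6, _, _, _, _⟩ | ⟨r, h6, _, _, _⟩ := h3
    · simp [h6] at ho
    · simp only [ho, Option.some.injEq, Prod.mk.injEq] at h6
      omega
    · simp only [ho, Option.some.injEq, Prod.mk.injEq] at h6
      omega
  rcases hw with ⟨hw, hN⟩ | ⟨hw, hN⟩
  · have : { s with o3 := none }.select3 = { s with o3 := none } := by
      simp [SubState.select3, hw]
    rw [this]
    exact ⟨md, r, wa, wp, N, ap, am, hs, hc, .inl ⟨rfl, hw, .inr hN⟩, h4, h5, hz, h32, h43,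
      hap, ham⟩
  · have : { s with o3 := none }.select3 = { s with o3 := some (false, 4), w31 := s.w31 - 1 } := by
      simp [SubState.select3, hw]
    rw [this]
    refine ⟨md, r, wa, wp, N, ap, am, hs, hc, .inr (.inr ⟨4, rfl, ?_⟩), h4, h5, hz, h32, h43,
      hap, ham⟩
    dsimp only
    omega

theorem finish4 (h : SubInv τ z inc dec f s) (ho : s.o4 = some 0) :
    SubInv τ z inc dec f { s with o4 := none } := by
  obtain ⟨md, r, wa, wp, N, ap, am, hs, hc, h3, h4, h5, hz, h32, h43, hap, ham⟩ := h
  refine ⟨md, r, wa, wp, N, ap, am, hs, hc, h3, .inr ⟨rfl, ?_⟩, h5, hz, h32, h43, hap, ham⟩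
  obtain ⟨r, h6, _, _, _, _⟩ | ⟨h6, _⟩ := h4
  · simp only [ho, Option.some.injEq] at h6
    omega
  · simp [ho] at h6

/-- The `c51` job whose service ends at time `302` joins `c11`, which is how the counter is
incremented. -/
theorem finish5 (h : SubInv τ z inc dec f s) (ho : s.o5 = some 0) :
    SubInv τ z inc dec f { s with o5 := none }.pass11 := by
  obtain ⟨md, r, wa, wp, N, ap, am, hs, hc, h3, h4, h5, hz, h32, h43, hap, ham⟩ := h
  have hr := { s with o5 := none }.rest_pass11
  simp only [SubState.rest, Prod.mk.injEq] at hr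
  obtain ⟨r1, r2, r3, r4⟩ := hr
  replace h3 : ThirdInv τ f.f32 N { s with o5 := none }.pass11.o3
      { s with o5 := none }.pass11.w31 := by
    rw [r1, r2]; exact h3
  rw [← r3] at h4
  have hap0 : ap = 0 := by
    have := hc.adjust
    have : ¬ ap = 1 := by rw [hap, ho]; simp
    omega
  obtain ⟨r', h6, h7, h8, _, _⟩ | ⟨h6, _⟩ := h5
  swap
  · simp [ho] at h6
  simp only [ho, Option.some.injEq] at h6
  have hτ : τ = 302 := by omega
  have h5' : TimerInv 302 τ inc f.f43 { s with o5 := none }.pass11.o5 := by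
    rw [r4]
    exact .inr ⟨rfl, by omega⟩
  have hap' : 1 = 1 ↔ inc = 1 ∧ 302 ≤ τ ∧ { s with o5 := none }.pass11.o5 = none := by
    rw [r4]
    simp [h7, hτ]
  have hs' : RSState { s with o5 := none } md r wa wp := hs
  have hmd := hc.mode_lt (by omega)
  interval_cases md
  · exact ⟨_, _, _, _, N, 1, am, hs'.pass11_first, hc.insert_first hτ hap0, h3, h4, h5', hz, h32,
      h43, hap', ham⟩
  · exact ⟨_, _, _, _, N, 1, am, hs'.pass11_second, hc.insert_second hτ hap0, h3, h4, h5', hz, h32,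
      h43, hap', ham⟩

/-- At time `270` of the cycle, the third server is idle iff the counter is positive. -/
theorem third_at_signal (h : SubInv τ z inc dec f s) (hf : f.Done ∨ f.f14 = 0) (hτ : τ = 270) :
    (z = 0 → s.o3 ≠ none) ∧ (0 < z → s.o3 = none ∧ s.w31 = 0) := by
  obtain ⟨md, r, wa, wp, N, ap, am, hs, hc, h3, h4, h5, hz, h32, h43, hap, ham⟩ := h
  have hN := hc.after14 (by omega) (by rcases hf with hf | hf; exacts [hf.f14, hf])
  obtain ⟨h6, h7, _⟩ | ⟨r, h6, _, _, _, _⟩ | ⟨r, h6, _, _, _⟩ := h3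
  · exact ⟨fun _ => by omega, fun _ => ⟨h6, h7⟩⟩
  · omega
  · refine ⟨fun _ => by simp [h6], fun _ => by omega⟩

/-- The state of a subnetwork after one hundredth of a unit of time. -/
def _root_.SubState.tick (s : SubState) : SubState :=
  { s with
    o1 := s.o1.map (· - 1)
    o2 := s.o2.map (· - 1)
    o3 := s.o3.map fun p => (p.1, p.2 - 1)
    o4 := s.o4.map (· - 1)
    o5 := s.o5.map (· - 1) }

/-- No service is due in a subnetwork. -/
structure _root_.SubState.Settled (s : SubState) : Prop where
  o1 : s.o1 ≠ some 0
  o2 : s.o2 ≠ some 0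
  o3 : ∀ b, s.o3 ≠ some (b, 0)
  o4 : s.o4 ≠ some 0
  o5 : s.o5 ≠ some 0

theorem _root_.RSState.tick {md r wa wp : ℕ} (h : RSState s md r wa wp) (hmd : md < 2)
    (hs : s.Settled) : ∃ r', r = r' + 1 ∧ RSState s.tick md r' wa wp := by
  obtain ⟨h, h1, h2, h3, h4, h5, h6⟩ | ⟨h, h1, h2, h3, h4, h5, h6⟩ | ⟨h, _⟩ := h
  · rcases r with _ | r
    · exact absurd h1 hs.o1
    · exact ⟨r, rfl, by simp [RSState, SubState.tick, *]⟩
  · rcases r with _ | r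
    · exact absurd h1 hs.o2
    · exact ⟨r, rfl, by simp [RSState, SubState.tick, *]⟩
  · omega

theorem _root_.TimerInv.tick {u τ e f g : ℕ} {o : Option ℕ} (h : TimerInv u τ e f o)
    (hf : f = 0) (hg : g = 1 ∧ τ + 1 = 300 ∨ g = 0 ∧ τ + 1 ≠ 300) (ho : o ≠ some 0) :
    TimerInv u (τ + 1) e g (o.map (· - 1)) := by
  obtain ⟨r, rfl, _, _, _, _⟩ | ⟨rfl, _⟩ := h
  · have : r ≠ 0 := by rintro rfl; exact ho rfl
    exact .inl ⟨r - 1, rfl, by omega⟩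
  · exact .inr ⟨rfl, by omega⟩

theorem tick (h : SubInv τ z inc dec f s) (hf : f.Done) (hs' : s.Settled) {g : SubFlags}
    (hg : g.Fresh (τ + 1)) (hτ : τ + 1 < 400) : SubInv (τ + 1) z inc dec g s.tick := by
  obtain ⟨md, r, wa, wp, N, ap, am, hs, hc, h3, h4, h5, hz, h32, h43, hap, ham⟩ := h
  obtain ⟨r, rfl, hst⟩ := hs.tick (hc.tick_mode hf) hs'
  refine ⟨md, r, wa, wp, N, ap, am, hst, hc.tick hf hg hτ, ?_, h4.tick hf.f43 hg.f43 hs'.o4,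
    h5.tick hf.f43 hg.f43 hs'.o5, hz, ?_, ?_, ?_, ?_⟩
  · have hf' := hf.f32
    have hg' := hg.f32
    obtain ⟨h6, h7, h8⟩ | ⟨r', h6, h7, h8, h9, _⟩ | ⟨r', h6, h7, _, _⟩ := h3
    · refine .inl ⟨by simp [SubState.tick, h6], h7, ?_⟩
      omega
    · have : r' ≠ 0 := by rintro rfl; exact hs'.o3 _ h6
      refine .inr (.inl ⟨r' - 1, by simp [SubState.tick, h6], h7, ?_⟩)
      omega
    · have : r' ≠ 0 := by rintro rfl; exact hs'.o3 _ h6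
      refine .inr (.inr ⟨r' - 1, by simp [SubState.tick, h6], ?_⟩)
      dsimp only [SubState.tick]
      omega
  · have := hg.f32
    omega
  · have := hg.f43
    omega
  · have ho : s.tick.o5 = none ↔ s.o5 = none := by simp [SubState.tick]
    rw [ho, hap]
    obtain ⟨r, h6, _, _, _, _⟩ | ⟨h6, _⟩ := h5
    · simp [h6]
    · have := hf.f43
      constructor
      · rintro ⟨h7, h8, h9⟩; exact ⟨h7, by omega, h9⟩
      · rintro ⟨h7, h8, h9⟩; exact ⟨h7, by omega, h9⟩
  · have := hg.f42
    have := hf.f42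
    omega

/-- At the end of a cycle the subnetwork is ready for the next cycle, with the new counter. -/
theorem restart (h : SubInv τ z inc dec f s) (hf : f.Done) (hs' : s.Settled) {g : SubFlags}
    (hg : g.Fresh 100) (hτ : τ = 399) {z' inc' dec' : ℕ} (hz' : z' + dec = z + inc)
    (hid : inc' ≤ 1 ∧ dec' ≤ 1 ∧ dec' ≤ z') : SubInv 100 z' inc' dec' g s.tick := by
  obtain ⟨md, r, wa, wp, N, ap, am, hs, hc, h3, h4, h5, hz, h32, h43, hap, ham⟩ := h
  obtain ⟨r, rfl, hst⟩ := hs.tick (hc.tick_mode hf) hs'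
  have hf42 := hf.f42
  have hg32 := hg.f32
  have hg43 := hg.f43
  have hg42 := hg.f42
  have hadj := hc.adjust
  have ho4 : s.o4 = none := by
    obtain ⟨r, _, _, _, _, _⟩ | ⟨h4, _⟩ := h4
    · omega
    · exact h4
  have ho5 : s.o5 = none := by
    obtain ⟨r, _, _, _, _, _⟩ | ⟨h5, _⟩ := h5
    · omega
    · exact h5
  have ho3 : s.o3 = none ∧ s.w31 = 0 := by
    have hN := hc.after14 (by omega) hf.f14
    obtain ⟨h6, h7, h8⟩ | ⟨r', h6, h7, h8, h9, _⟩ | ⟨r', h6, h7, _, _⟩ := h3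
    · exact ⟨h6, h7⟩
    · omega
    · omega
  simp only [ho5, and_true] at hap
  refine ⟨md, r, wa, wp, 0, 0, 0, hst, hc.restart hf hτ hg (by omega), ?_, ?_, ?_, hid, ?_, ?_, ?_,
    ?_⟩
  · exact .inl ⟨by simp [SubState.tick, ho3], ho3.2, .inl ⟨by omega, rfl⟩⟩
  · exact .inr ⟨by simp [SubState.tick, ho4], by omega⟩
  · exact .inr ⟨by simp [SubState.tick, ho5], by omega⟩
  · omega
  · omega
  · simp
  · simp

end SubInv

/-! ### The invariant of the main network -/

/-- The number of jobs which the `i`-th subnetwork has sent to `S01` by the instant `τ` of a cycle,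
where `f = 1` iff the arrival of class `c33 i` is still to be carried out, and `s` is `1` or `0`
according to whether the counter is positive. -/
def signals (τ f s : ℕ) : ℕ := if τ < 270 ∨ τ = 270 ∧ f = 1 then 0 else s

/-- The server `S01`: it works from time `270` until it has served the signals. -/
def SignalInv (τ g₀ g₁ : ℕ) (o : Option (Fin 2 × ℕ)) (w : Fin 2 → ℕ) : Prop :=
  (∃ i r, o = some (i, r) ∧ r + 9 * w 0 + 18 * w 1 + τ = 270 + 9 * g₀ + 18 * g₁ ∧ 270 ≤ τ) ∨
  (o = none ∧ w 0 = 0 ∧ w 1 = 0 ∧ (g₀ = 0 ∧ g₁ = 0 ∨ 270 + 9 * g₀ + 18 * g₁ ≤ τ))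

/-- The time at which the job which represents the old state of the machine begins its walk through
the classes `m31`, …, `m34`: both this job and `S01` must be ready. -/
def walkTime (s : Fin 2 → ℕ) : ℕ := max 271 (270 + 9 * s 0 + 18 * s 1)

/-- The invariant of the main network at the instant `τ` of a cycle in which the state of the
machine changes from `k` to `j`; `s i` is `1` or `0` according to whether the counter `i` is
positive. The numbers `f33 i`, `f35 l`, `f42` are `1` if the arrival of the class `c33 i`, `m35 l`,
`m42 j` is still to be carried out at this instant. -/
structure MainInv {m : ℕ} (τ : ℕ) (k j : Fin m) (s f33 : Fin 2 → ℕ) (f35 : Fin m → ℕ) (f42 : ℕ)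
    (a : NetState m) : Prop where
  range : 100 ≤ τ ∧ τ < 400
  s_le : s 0 ≤ 1 ∧ s 1 ≤ 1
  f33_eq : ∀ i, f33 i = 0 ∨ f33 i = 1 ∧ τ = 270
  f35_eq : ∀ l, f35 l = 0 ∨ f35 l = 1 ∧ τ = 299
  f42_eq : f42 = 0 ∨ f42 = 1 ∧ τ = 300
  s01 : SignalInv τ (signals τ (f33 0) (s 0)) (signals τ (f33 1) (s 1)) a.o01 a.w01
  /-- The job which represents the old state is served at `S02`, then waits for `S01`, then walks
  through the classes `m31`, …, `m34`, and leaves. The next state enters `S02` at time `300`. -/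
  token :
    (∃ r, a.o02 = some (k, r) ∧ r + τ = 271 ∧ a.w03 = none ∧ a.walk = none) ∨
    (271 ≤ τ ∧
      (a.o02 = none ∧ (τ < 300 ∨ τ = 300 ∧ f42 = 1) ∨
        (∃ r, a.o02 = some (j, r) ∧ r + τ = 571 ∧ 300 ≤ τ ∧ f42 = 0)) ∧
      (a.w03 = some k ∧ a.walk = none ∧ a.o01 ≠ none ∨
        a.w03 = none ∧ (∃ p r, a.walk = some (p, k, r) ∧ r ≤ 9 ∧
          r + τ = walkTime s + 9 * (p.val + 1)) ∨
        a.w03 = none ∧ a.walk = none ∧ walkTime s + 36 ≤ τ))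
  s4 : ∀ l, (∃ r, a.o4 l = some r ∧ l ≠ j ∧ r + τ = 301 ∧ 299 ≤ τ ∧ f35 l = 0) ∨
    (a.o4 l = none ∧ (l = j ∨ τ < 299 ∨ τ = 299 ∧ f35 l = 1 ∨ 301 ≤ τ))

namespace MainInv

variable {m τ : ℕ} {k j : Fin m} {s f33 : Fin 2 → ℕ} {f35 : Fin m → ℕ} {f42 : ℕ} {a : NetState m}

/-- If the counter is zero, the arrival of the class `c33 i` has no effect on the main network. -/
theorem arrive33_reject (h : MainInv τ k j s f33 f35 f42 a) {i : Fin 2} (hf : f33 i = 1)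
    (hs : s i = 0) : MainInv τ k j s (Function.update f33 i 0) f35 f42 a := by
  obtain ⟨h1, h2, h3, h4, h5, h6, h7, h8⟩ := h
  refine ⟨h1, h2, ?_, h4, h5, ?_, h7, h8⟩
  · intro l
    rw [Function.update_apply]
    split_ifs
    · exact .inl rfl
    · exact h3 l
  · have : ∀ l, signals τ (Function.update f33 i 0 l) (s l) = signals τ (f33 l) (s l) := by
      intro l
      by_cases hl : l = i
      · subst hl
        simp [signals, hs]
      · rw [Function.update_of_ne hl]
    rw [this, this]
    exact h6

/-- The server `S01` after the arrival of a signal. -/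
def _root_.NetState.signal (a : NetState m) (i : Fin 2) : NetState m :=
  if a.o01 = none then { a with o01 := some (i, if i = 0 then 9 else 18) }
  else { a with w01 := Function.update a.w01 i (a.w01 i + 1) }

theorem arrive33 (h : MainInv τ k j s f33 f35 f42 a) {i : Fin 2} (hf : f33 i = 1)
    (hs : s i = 1) : MainInv τ k j s (Function.update f33 i 0) f35 f42 (a.signal i) := by
  obtain ⟨h1, h2, h3, h4, h5, h6, h7, h8⟩ := h
  have hτ : τ = 270 := by have := h3 i; omega
  have h7' : ∃ r, a.o02 = some (k, r) ∧ r + τ = 271 ∧ a.w03 = none ∧ a.walk = none :=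
    h7.resolve_right (by omega)
  have h3' : ∀ l, Function.update f33 i 0 l = 0 ∨ Function.update f33 i 0 l = 1 ∧ τ = 270 := by
    intro l
    rw [Function.update_apply]
    split_ifs
    · exact .inl rfl
    · exact h3 l
  have h30 := h3 0
  have h31 := h3 1
  clear h7 h3
  by_cases ho : a.o01 = none
  · rw [NetState.signal, if_pos ho]
    refine ⟨h1, h2, h3', h4, h5, .inl ⟨_, _, rfl, ?_⟩, .inl h7', h8⟩
    obtain ⟨i', r, h9, _⟩ | ⟨_, hw0, hw1, h9⟩ := h6
    · simp [ho] at h9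
    · subst hτ
      obtain rfl | rfl : i = 0 ∨ i = 1 := by omega
      all_goals
        simp [signals, hf, hs, hw0, hw1] at h9 ⊢
        exact h9
  · rw [NetState.signal, if_neg ho]
    refine ⟨h1, h2, h3', h4, h5, .inl ?_, .inl h7', h8⟩
    obtain ⟨i', r, h9, h10, h11⟩ | ⟨h9, _⟩ := h6
    · subst hτ
      refine ⟨i', r, h9, ?_, h11⟩
      obtain rfl | rfl : i = 0 ∨ i = 1 := by omega
      all_goals
        simp [signals, hf, hs] at h10 ⊢
        split_ifs at h10 ⊢ <;> omega
    · exact absurd h9 ho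

theorem finish01 (h : MainInv τ k j s f33 f35 f42 a) {i : Fin 2} (ho : a.o01 = some (i, 0)) :
    MainInv τ k j s f33 f35 f42 { a with o01 := none }.select01 := by
  obtain ⟨h1, h2, h3, h4, h5, h6, h7, h8⟩ := h
  obtain ⟨i', r, h9, h10, h11⟩ | ⟨h9, _⟩ := h6
  swap
  · simp [ho] at h9
  simp only [ho, Option.some.injEq, Prod.mk.injEq] at h9
  obtain ⟨rfl, rfl⟩ := h9
  unfold NetState.select01
  by_cases hw0 : 0 < a.w01 0
  · rw [if_pos hw0]
    refine ⟨h1, h2, h3, h4, h5, .inl ⟨_, _, rfl, ?_, h11⟩, ?_, h8⟩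
    · simp
      omega
    · simpa [ho] using h7
  rw [if_neg hw0]
  by_cases hw1 : 0 < a.w01 1
  · rw [if_pos hw1]
    refine ⟨h1, h2, h3, h4, h5, .inl ⟨_, _, rfl, ?_, h11⟩, ?_, h8⟩
    · simp
      omega
    · simpa [ho] using h7
  · rw [if_neg hw1]
    have h6' : SignalInv τ (signals τ (f33 0) (s 0)) (signals τ (f33 1) (s 1)) none a.w01 :=
      .inr ⟨rfl, by omega, by omega, .inr (by omega)⟩
    split
    · rename_i hw3
      replace hw3 : a.w03 = none := hw3
      refine ⟨h1, h2, h3, h4, h5, h6', ?_, h8⟩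
      simpa [ho, hw3] using h7
    · rename_i k' hw3
      replace hw3 : a.w03 = some k' := hw3
      refine ⟨h1, h2, h3, h4, h5, h6', ?_, h8⟩
      simp only [hw3, reduceCtorEq, false_and, and_false, exists_false, or_false, false_or,
        Option.some.injEq] at h7
      obtain ⟨h12, h13, rfl, _⟩ := h7
      refine .inr ⟨h12, h13, .inr (.inl ⟨rfl, 0, 9, rfl, le_rfl, ?_⟩)⟩
      have h14 : ∀ i, signals τ (f33 i) (s i) = s i := fun i => if_neg (by omega)
      rw [h14, h14] at h10
      unfold walkTime
      simp
      omega

/-- A service which ends at `S02` is that of the old state `k`, at time `271`. -/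
theorem finish02 (h : MainInv τ k j s f33 f35 f42 a) {k' : Fin m} (ho : a.o02 = some (k', 0)) :
    k' = k ∧ a.w03 = none ∧ a.walk = none ∧ (a.o01 = none → ∀ i, a.w01 i = 0) ∧
    MainInv τ k j s f33 f35 f42 (if a.o01 = none then { a with o02 := none, walk := some (0, k, 9) }
      else { a with o02 := none, w03 := some k }) := by
  obtain ⟨h1, h2, h3, h4, h5, h6, h7, h8⟩ := h
  obtain ⟨r, h9, h10, h11, h12⟩ | ⟨_, ⟨h9, _⟩ | ⟨r, h9, _⟩, _⟩ := h7
  rotate_left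
  · simp [ho] at h9
  · simp only [ho, Option.some.injEq, Prod.mk.injEq] at h9
    omega
  simp only [ho, Option.some.injEq, Prod.mk.injEq] at h9
  obtain ⟨rfl, rfl⟩ := h9
  have h13 : a.o01 = none → ∀ i, a.w01 i = 0 := by
    intro h14
    obtain ⟨i', r, h9, _⟩ | ⟨_, hw0, hw1, _⟩ := h6
    · simp [h14] at h9
    · exact Fin.forall_fin_two.2 ⟨hw0, hw1⟩
  refine ⟨rfl, h11, h12, h13, ?_⟩
  have h14 : ∀ i, signals τ (f33 i) (s i) = s i := fun i => if_neg (by omega)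
  split_ifs with h15
  · refine ⟨h1, h2, h3, h4, h5, h6, .inr ⟨by omega, .inl ⟨rfl, by omega⟩, .inr (.inl ⟨h11, 0, 9,
      rfl, le_rfl, ?_⟩)⟩, h8⟩
    obtain ⟨i', r, h9, _⟩ | ⟨_, hw0, hw1, h9⟩ := h6
    · simp [h15] at h9
    · rw [h14, h14] at h9
      unfold walkTime
      simp
      omega
  · exact ⟨h1, h2, h3, h4, h5, h6, .inr ⟨by omega, .inl ⟨rfl, by omega⟩, .inl ⟨rfl, h12, h15⟩⟩, h8⟩

theorem w01_eq_zero (h : MainInv τ k j s f33 f35 f42 a) (ho : a.o01 = none) (i : Fin 2) :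
    a.w01 i = 0 := by
  obtain ⟨i', r, h9, _⟩ | ⟨_, hw0, hw1, _⟩ := h.s01
  · simp [ho] at h9
  · revert i
    exact Fin.forall_fin_two.2 ⟨hw0, hw1⟩

theorem finish_walk (h : MainInv τ k j s f33 f35 f42 a) {p : Fin 4} {k' : Fin m}
    (ho : a.walk = some (p, k', 0)) :
    MainInv τ k j s f33 f35 f42 { a with walk := if p = 3 then none else some (p + 1, k', 9) } := by
  obtain ⟨h1, h2, h3, h4, h5, h6, h7, h8⟩ := h
  simp only [ho, reduceCtorEq, false_and, and_false, exists_false, or_false, false_or,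
    Option.some.injEq, Prod.mk.injEq] at h7
  obtain ⟨h9, h10, h11, p', r, ⟨rfl, rfl, rfl⟩, h12, h13⟩ := h7
  refine ⟨h1, h2, h3, h4, h5, h6, .inr ⟨h9, h10, .inr ?_⟩, h8⟩
  split_ifs with hp
  · subst hp
    exact .inr ⟨h11, rfl, by simp at h13; omega⟩
  · refine .inl ⟨h11, _, _, rfl, le_rfl, ?_⟩
    have : ((p + 1 : Fin 4) : ℕ) = p + 1 := by omega
    omega

theorem walk_eq_none_or (h : MainInv τ k j s f33 f35 f42 a) : a.w03 = none ∨ a.walk = none := by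
  obtain ⟨r, _, _, h, _⟩ | ⟨_, _, ⟨_, h, _⟩ | ⟨h, _⟩ | ⟨h, _⟩⟩ := h.token <;> simp [h]

theorem finish4 (h : MainInv τ k j s f33 f35 f42 a) {l : Fin m} (ho : a.o4 l = some 0) :
    MainInv τ k j s f33 f35 f42 { a with o4 := Function.update a.o4 l none } := by
  obtain ⟨h1, h2, h3, h4, h5, h6, h7, h8⟩ := h
  refine ⟨h1, h2, h3, h4, h5, h6, h7, ?_⟩
  intro l'
  by_cases hl : l' = l
  · subst hl
    right
    obtain ⟨r, h9, _⟩ | ⟨h9, _⟩ := h8 l'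
    · simp only [ho, Option.some.injEq] at h9
      simp
      omega
    · simp [ho] at h9
  · simpa [hl] using h8 l'

/-- At time `299` the walking job is in the class which belongs to the pattern of positive counters,
and hence at the server of the next state. -/
theorem walk_at (h : MainInv τ k j s f33 f35 f42 a) (hτ : τ = 299) :
    ∃ p r, a.walk = some (p, k, r) ∧ SCM.bits p = fun i => decide (0 < s i) := by
  obtain ⟨h1, h2, h3, h4, h5, h6, h7, h8⟩ := h
  have h14 : ∀ i, signals τ (f33 i) (s i) = s i := fun i => if_neg (by omega)
  rw [h14, h14] at h6
  obtain ⟨r, _, _, _⟩ | ⟨_, _, ⟨_, _, h9⟩ | ⟨_, p, r, h9, h10, h11⟩ | ⟨_, _, _⟩⟩ := h7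
  · omega
  · obtain ⟨_, _, _, _, _⟩ | ⟨h10, _⟩ := h6
    · omega
    · exact absurd h10 h9
  · refine ⟨p, r, h9, ?_⟩
    unfold walkTime at h11
    have h12 : (s 0 = 0 ∨ s 0 = 1) ∧ (s 1 = 0 ∨ s 1 = 1) := by omega
    obtain ⟨h12 | h12, h13 | h13⟩ := h12 <;> rw [h12, h13] at h11
    · obtain rfl : p = 3 := by omega
      funext i; fin_cases i <;> simp [SCM.bits, h12, h13]
    · obtain rfl : p = 1 := by omega
      funext i; fin_cases i <;> simp [SCM.bits, h12, h13]
    · obtain rfl : p = 2 := by omega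
      funext i; fin_cases i <;> simp [SCM.bits, h12, h13]
    · obtain rfl : p = 0 := by omega
      funext i; fin_cases i <;> simp [SCM.bits, h12, h13]
  · unfold walkTime at *
    omega

/-- The job which arrives to `m35 j` is dropped, because the walking job is at `S3 j`. -/
theorem arrive35_self (h : MainInv τ k j s f33 f35 f42 a) :
    MainInv τ k j s f33 (Function.update f35 j 0) f42 a := by
  obtain ⟨h1, h2, h3, h4, h5, h6, h7, h8⟩ := h
  refine ⟨h1, h2, h3, ?_, h5, h6, h7, ?_⟩
  · intro l
    rw [Function.update_apply]
    split_ifs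
    · exact .inl rfl
    · exact h4 l
  · intro l
    rw [Function.update_apply]
    split_ifs with hl
    · subst hl
      obtain ⟨r, _, h9, _⟩ | ⟨h9, _⟩ := h8 l
      · exact absurd rfl h9
      · exact .inr ⟨h9, .inl rfl⟩
    · exact h8 l

theorem o4_of_pending (h : MainInv τ k j s f33 f35 f42 a) {l : Fin m} (hf : f35 l = 1) :
    a.o4 l = none := by
  obtain ⟨r, _, _, _, _, _⟩ | ⟨h9, _⟩ := h.s4 l
  · omega
  · exact h9

theorem arrive35 (h : MainInv τ k j s f33 f35 f42 a) {l : Fin m} (hl : l ≠ j) (hf : f35 l = 1) :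
    MainInv τ k j s f33 (Function.update f35 l 0) f42
      { a with o4 := Function.update a.o4 l (some 2) } := by
  obtain ⟨h1, h2, h3, h4, h5, h6, h7, h8⟩ := h
  have hτ := h4 l
  refine ⟨h1, h2, h3, ?_, h5, h6, h7, ?_⟩
  · intro l
    rw [Function.update_apply]
    split_ifs
    · exact .inl rfl
    · exact h4 l
  · intro l'
    by_cases h : l' = l
    · subst h
      exact .inl ⟨2, by simp, hl, by omega, by omega, by simp⟩
    · simpa [h] using h8 l'

/-- At time `300` only the server `S4 j` is idle. -/
theorem o4_at (h : MainInv τ k j s f33 f35 f42 a) (hτ : τ = 300) (l : Fin m) :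
    a.o4 l = none ↔ l = j := by
  obtain ⟨r, h9, h10, _⟩ | ⟨h9, h10⟩ := h.s4 l
  · simp [h9, h10]
  · simp [h9]
    have := h.f35_eq l
    omega

theorem o02_of_pending (h : MainInv τ k j s f33 f35 f42 a) (hf : f42 = 1) : a.o02 = none := by
  have := h.f42_eq
  obtain ⟨r, _, _, _⟩ | ⟨_, ⟨h9, _⟩ | ⟨r, _, _, _, _⟩, h10⟩ := h.token
  · omega
  · exact h9
  · clear h10
    omega

/-- The job which passes through `m42 j` establishes the new state. -/
theorem arrive42 (h : MainInv τ k j s f33 f35 f42 a) (hf : f42 = 1) :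
    MainInv τ k j s f33 f35 0 { a with o02 := some (j, 271) } := by
  obtain ⟨h1, h2, h3, h4, h5, h6, h7, h8⟩ := h
  refine ⟨h1, h2, h3, h4, .inl rfl, h6, ?_, h8⟩
  have hτ : τ = 300 := by clear h7; omega
  obtain ⟨r, _, _, _⟩ | ⟨h9, _, h10⟩ := h7
  · omega
  · exact .inr ⟨h9, .inr ⟨271, rfl, by rw [hτ], hτ.ge, rfl⟩, h10⟩

/-- The state of the network after one hundredth of a unit of time. -/
def _root_.NetState.tick (a : NetState m) : NetState m where
  sub i := (a.sub i).tick
  o01 := a.o01.map fun p => (p.1, p.2 - 1)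
  w01 := a.w01
  w03 := a.w03
  o02 := a.o02.map fun p => (p.1, p.2 - 1)
  walk := a.walk.map fun p => (p.1, p.2.1, p.2.2 - 1)
  o4 l := (a.o4 l).map (· - 1)

/-- No service is due. -/
structure _root_.NetState.Settled (a : NetState m) : Prop where
  sub : ∀ i, (a.sub i).Settled
  o01 : ∀ i, a.o01 ≠ some (i, 0)
  o02 : ∀ k, a.o02 ≠ some (k, 0)
  walk : ∀ p k, a.walk ≠ some (p, k, 0)
  o4 : ∀ l, a.o4 l ≠ some 0

theorem tick (h : MainInv τ k j s f33 f35 f42 a) (ha : a.Settled) (hf33 : ∀ i, f33 i = 0)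
    (hf35 : ∀ l, f35 l = 0) (hf42 : f42 = 0) {g33 : Fin 2 → ℕ} {g35 : Fin m → ℕ} {g42 : ℕ}
    (hg33 : ∀ i, g33 i = 1 ∧ τ + 1 = 270 ∨ g33 i = 0 ∧ τ + 1 ≠ 270)
    (hg35 : ∀ i, g35 i = 1 ∧ τ + 1 = 299 ∨ g35 i = 0 ∧ τ + 1 ≠ 299)
    (hg42 : g42 = 1 ∧ τ + 1 = 300 ∨ g42 = 0 ∧ τ + 1 ≠ 300) (hτ : τ + 1 < 400) :
    MainInv (τ + 1) k j s g33 g35 g42 a.tick := by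
  obtain ⟨h1, h2, h3, h4, h5, h6, h7, h8⟩ := h
  have hs : ∀ i, signals (τ + 1) (g33 i) (s i) = signals τ (f33 i) (s i) := by
    intro i
    have := hf33 i
    have := hg33 i
    unfold signals
    congr 1
    simp only [eq_iff_iff]
    omega
  have hr : 100 ≤ τ + 1 ∧ τ + 1 < 400 := ⟨by omega, hτ⟩
  refine ⟨hr, h2, fun i => by have := hg33 i; clear h7 h8; omega,
    fun i => by have := hg35 i; clear h7 h8; omega, by clear h7 h8; omega, ?_, ?_, ?_⟩
  · rw [hs, hs]
    obtain ⟨i', r, h9, h10, h11⟩ | ⟨h9, hw0, hw1, h10⟩ := h6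
    · have : r ≠ 0 := by rintro rfl; exact ha.o01 _ h9
      exact .inl ⟨i', r - 1, by simp [NetState.tick, h9], by dsimp only [NetState.tick]; omega,
        by omega⟩
    · exact .inr ⟨by simp [NetState.tick, h9], hw0, hw1, by omega⟩
  · obtain ⟨r, h9, h10, h11, h12⟩ | ⟨h9, h10, h11⟩ := h7
    · have : r ≠ 0 := by rintro rfl; exact ha.o02 _ h9
      exact .inl ⟨r - 1, by simp [NetState.tick, h9], by omega, h11, by simp [NetState.tick, h12]⟩
    · refine .inr ⟨by omega, ?_, ?_⟩
      · obtain ⟨h12, h13⟩ | ⟨r, h12, h13, h14, _⟩ := h10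
        · exact .inl ⟨by simp [NetState.tick, h12], by omega⟩
        · have : r ≠ 0 := by rintro rfl; exact ha.o02 _ h12
          exact .inr ⟨r - 1, by simp [NetState.tick, h12], by omega, by omega, by omega⟩
      · obtain ⟨h12, h13, h14⟩ | ⟨h12, p, r, h13, h14, h15⟩ | ⟨h12, h13, h14⟩ := h11
        · exact .inl ⟨h12, by simp [NetState.tick, h13], by simpa [NetState.tick] using h14⟩
        · have : r ≠ 0 := by rintro rfl; exact ha.walk _ _ h13
          exact .inr (.inl ⟨h12, p, r - 1, by simp [NetState.tick, h13], by omega, by omega⟩)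
        · exact .inr (.inr ⟨h12, by simp [NetState.tick, h13], by omega⟩)
  · intro l
    have := hf35 l
    have := hg35 l
    obtain ⟨r, h9, h10, h11, h12, h13⟩ | ⟨h9, h10⟩ := h8 l
    · have : r ≠ 0 := by rintro h; exact ha.o4 l (h ▸ h9)
      exact .inl ⟨r - 1, by simp [NetState.tick, h9], h10, by omega, by omega, by omega⟩
    · refine .inr ⟨by simp [NetState.tick, h9], ?_⟩
      omega

/-- At the end of a cycle the main network is ready for the next cycle, with the new state. -/
theorem restart (h : MainInv τ k j s f33 f35 f42 a) (hτ : τ = 399) (j' : Fin m)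
    {s' : Fin 2 → ℕ} (hs' : s' 0 ≤ 1 ∧ s' 1 ≤ 1) {g33 : Fin 2 → ℕ} {g35 : Fin m → ℕ} {g42 : ℕ}
    (hg33 : ∀ i, g33 i = 0) (hg35 : ∀ i, g35 i = 0) (hg42 : g42 = 0) :
    MainInv 100 j j' s' g33 g35 g42 a.tick := by
  obtain ⟨h1, h2, h3, h4, h5, h6, h7, h8⟩ := h
  have hsig : ∀ i, signals τ (f33 i) (s i) = s i := fun i => if_neg (by omega)
  rw [hsig, hsig] at h6
  have ho01 : a.o01 = none ∧ a.w01 0 = 0 ∧ a.w01 1 = 0 := by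
    obtain ⟨i', r, h9, h10, h11⟩ | ⟨h9, hw0, hw1, h10⟩ := h6
    · omega
    · exact ⟨h9, hw0, hw1⟩
  refine ⟨by omega, hs', fun i => .inl (hg33 i), fun i => .inl (hg35 i), .inl hg42, ?_, .inl ?_, ?_⟩
  · refine .inr ⟨by simp [NetState.tick, ho01], ho01.2.1, ho01.2.2, .inl ?_⟩
    simp [signals]
  · have hw : walkTime s ≤ 297 := by unfold walkTime; omega
    obtain ⟨r, h9, h10, h11, h12⟩ | ⟨_, ⟨_, h9⟩ | ⟨r, h9, h10, _, _⟩, h11⟩ := h7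
    · omega
    · omega
    · refine ⟨r - 1, by simp [NetState.tick, h9], by omega, ?_⟩
      obtain ⟨_, _, h14⟩ | ⟨h12, p, r, h13, h14, h15⟩ | ⟨h12, h13, h14⟩ := h11
      · exact absurd ho01.1 h14
      · omega
      · exact ⟨h12, by simp [NetState.tick, h13]⟩
  · intro l
    obtain ⟨r, h9, h10, h11, h12, h13⟩ | ⟨h9, h10⟩ := h8 l
    · omega
    · exact .inr ⟨by simp [NetState.tick, h9], by omega⟩

end MainInv

/-! ### The invariant of the whole network during a cycle -/

namespace SCM

variable {m : ℕ}

open Classical in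
/-- `1` if the arrival of class `c` is pending, else `0`. -/
def flag (P : Set (Cls m)) (c : Cls m) : ℕ := if c ∈ P then 1 else 0

theorem flag_of_mem {P : Set (Cls m)} {c : Cls m} (h : c ∈ P) : flag P c = 1 := if_pos h

theorem flag_of_notMem {P : Set (Cls m)} {c : Cls m} (h : c ∉ P) : flag P c = 0 := if_neg h

theorem flag_diff (P : Set (Cls m)) (c d : Cls m) :
    flag (P \ {d}) c = if c = d then 0 else flag P c := by
  split_ifs with h
  · exact flag_of_notMem fun h' => h'.2 h
  · by_cases hc : c ∈ P
    · rw [flag_of_mem hc, flag_of_mem (show c ∈ P \ {d} from ⟨hc, h⟩)]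
    · rw [flag_of_notMem hc, flag_of_notMem fun h' => hc h'.1]

theorem flag_diff_of_ne {P : Set (Cls m)} {c d : Cls m} (h : c ≠ d) :
    flag (P \ {d}) c = flag P c := by
  rw [flag_diff, if_neg h]

theorem flag_diff_self (P : Set (Cls m)) (c : Cls m) : flag (P \ {c}) c = 0 := by
  rw [flag_diff, if_pos rfl]

/-- The pending arrivals of the `i`-th subnetwork, and of the class `m43 j`. -/
def subFlags (P : Set (Cls m)) (j : Fin m) (i : Fin 2) : SubFlags where
  f22 := flag P (.c22 i)
  f42 := flag P (.c42 i)
  f13 := flag P (.c13 i)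
  f23 := flag P (.c23 i)
  f14 := flag P (.c14 i)
  f32 := flag P (.c32 i)
  f43 := flag P (.m43 j)

/-- The classes with an external arrival at the instant `τ` of a cycle. -/
def due (τ : ℕ) : Set (Cls m) := {c | match c with
  | .c22 _ => τ % 100 = 0
  | .c42 _ => τ % 100 = 2
  | .c13 _ => τ = 160
  | .c23 _ => τ = 210
  | .c14 _ => τ = 260
  | .c32 _ => τ = 150
  | .c33 _ => τ = 270
  | .m35 _ => τ = 299
  | .m42 _ => τ = 300
  | .m43 _ => τ = 300
  | _ => False}

theorem flag_due {τ : ℕ} (c : Cls m) {p : Prop} (h : c ∈ due τ ↔ p) :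
    flag (due τ) c = 1 ∧ p ∨ flag (due τ) c = 0 ∧ ¬ p := by
  by_cases hc : c ∈ due τ
  · exact .inl ⟨flag_of_mem hc, h.1 hc⟩
  · exact .inr ⟨flag_of_notMem hc, fun h' => hc (h.2 h')⟩

theorem subFlags_due_fresh (τ : ℕ) (j : Fin m) (i : Fin 2) : (subFlags (due τ) j i).Fresh τ where
  f22 := flag_due _ Iff.rfl
  f42 := flag_due _ Iff.rfl
  f13 := flag_due _ Iff.rfl
  f23 := flag_due _ Iff.rfl
  f14 := flag_due _ Iff.rfl
  f32 := flag_due _ Iff.rfl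
  f43 := flag_due _ Iff.rfl

theorem flag_empty (c : Cls m) : flag ∅ c = 0 := flag_of_notMem (Set.notMem_empty c)

theorem subFlags_empty_done (j : Fin m) (i : Fin 2) : (subFlags ∅ j i).Done where
  f22 := flag_empty _
  f42 := flag_empty _
  f13 := flag_empty _
  f23 := flag_empty _
  f14 := flag_empty _
  f32 := flag_empty _
  f43 := flag_empty _

variable (M : SCM m)

/-- `1` if the counter `i` is incremented in the state `j`, else `0`. -/
def inc (j : Fin m) (i : Fin 2) : ℕ := if M.β j i = 1 then 1 else 0

/-- `1` if the counter `i` is decremented in the state `j`, else `0`. -/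
def dec (j : Fin m) (i : Fin 2) : ℕ := if M.β j i = -1 then 1 else 0

/-- The state of the machine after the configuration `(k, z)`. -/
def succ (k : Fin m) (z : Fin 2 → ℕ) : Fin m := M.α k fun i => decide (0 < z i)

theorem β_eq (j : Fin m) (i : Fin 2) : M.β j i = (M.inc j i : ℤ) - M.dec j i := by
  have h := M.β_mem j
  unfold inc dec
  simp only [Set.mem_insert_iff, Set.mem_singleton_iff] at h
  rcases h with h | h | h | h | h <;> rw [h] <;> fin_cases i <;> simp

theorem inc_le (j : Fin m) (i : Fin 2) : M.inc j i ≤ 1 := by unfold inc; split_ifs <;> omega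

theorem dec_le (j : Fin m) (i : Fin 2) : M.dec j i ≤ 1 := by unfold dec; split_ifs <;> omega

theorem dec_le_counter (k : Fin m) (z : Fin 2 → ℕ) (i : Fin 2) : M.dec (M.succ k z) i ≤ z i := by
  unfold dec
  split_ifs with h
  · have := M.consistent k (fun i => decide (0 < z i)) i h
    simp at this
    omega
  · exact Nat.zero_le _

/-- The invariant of the network during a cycle which begins with the configuration `(k, z)`: the
network is in the state `a` at the instant `τ` of the cycle, and the arrivals of the classes in `P`
are pending. -/
structure CycleInv (k : Fin m) (z : Fin 2 → ℕ) (τ : ℕ) (a : NetState m) (P : Set (Cls m)) :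
    Prop where
  pending : P ⊆ due τ
  sub : ∀ i, SubInv τ (z i) (M.inc (M.succ k z) i) (M.dec (M.succ k z) i)
    (subFlags P (M.succ k z) i) (a.sub i)
  main : MainInv τ k (M.succ k z) (fun i => if 0 < z i then 1 else 0) (fun i => flag P (.c33 i))
    (fun l => flag P (.m35 l)) (flag P (.m42 (M.succ k z))) a

namespace CycleInv

variable {M} {k : Fin m} {z : Fin 2 → ℕ} {τ : ℕ} {a : NetState m} {P : Set (Cls m)}

/-- An event of the `i`-th subnetwork preserves the invariant of the network if it preserves the
invariant of this subnetwork. -/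
theorem setSub (h : M.CycleInv k z τ a P) {i : Fin 2} {s : SubState} {Q : Set (Cls m)} (hQ : Q ⊆ P)
    (hs : SubInv τ (z i) (M.inc (M.succ k z) i) (M.dec (M.succ k z) i)
      (subFlags Q (M.succ k z) i) s)
    (hne : ∀ l, l ≠ i → subFlags Q (M.succ k z) l = subFlags P (M.succ k z) l)
    (h33 : ∀ l, flag Q (.c33 l) = flag P (.c33 l)) (h35 : ∀ l, flag Q (.m35 l) = flag P (.m35 l))
    (h42 : ∀ l, flag Q (.m42 l) = flag P (.m42 l)) : M.CycleInv k z τ (a.setSub i s) Q := by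
  refine ⟨hQ.trans h.pending, ?_, ?_⟩
  · intro l
    by_cases hl : l = i
    · subst hl
      simpa [NetState.setSub] using hs
    · rw [hne l hl]
      simpa [NetState.setSub, hl] using h.sub l
  · simp only [h33, h35, h42]
    obtain ⟨h1, h2, h3, h4, h5, h6, h7, h8⟩ := h.main
    exact ⟨h1, h2, h3, h4, h5, h6, h7, h8⟩

theorem setSub_same (h : M.CycleInv k z τ a P) {i : Fin 2} {s : SubState}
    (hs : SubInv τ (z i) (M.inc (M.succ k z) i) (M.dec (M.succ k z) i)
      (subFlags P (M.succ k z) i) s) : M.CycleInv k z τ (a.setSub i s) P :=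
  h.setSub subset_rfl hs (fun _ _ => rfl) (fun _ => rfl) (fun _ => rfl) fun _ => rfl

/-- An event of the main network preserves the invariant of the network if it preserves the
invariant of the main network. -/
theorem of_main (h : M.CycleInv k z τ a P) {b : NetState m} {Q : Set (Cls m)} (hQ : Q ⊆ P)
    (hb : b.sub = a.sub) (hf : ∀ i, subFlags Q (M.succ k z) i = subFlags P (M.succ k z) i)
    (hm : MainInv τ k (M.succ k z) (fun i => if 0 < z i then 1 else 0) (fun i => flag Q (.c33 i))
      (fun l => flag Q (.m35 l)) (flag Q (.m42 (M.succ k z))) b) : M.CycleInv k z τ b Q := by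
  refine ⟨hQ.trans h.pending, fun i => ?_, hm⟩
  rw [hb, hf]
  exact h.sub i

theorem arrive_sub (h : M.CycleInv k z τ a P) {i : Fin 2} {c : Cls m} {s : SubState}
    (hs : SubInv τ (z i) (M.inc (M.succ k z) i) (M.dec (M.succ k z) i)
      (subFlags (P \ {c}) (M.succ k z) i) s)
    (hc : c = .c22 i ∨ c = .c42 i ∨ c = .c13 i ∨ c = .c23 i ∨ c = .c14 i ∨ c = .c32 i) :
    M.CycleInv k z τ (a.setSub i s) (P \ {c}) := by
  refine h.setSub Set.sdiff_subset hs ?_ ?_ ?_ ?_ <;> intro l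
  · intro hl
    rcases hc with rfl | rfl | rfl | rfl | rfl | rfl <;> simp [subFlags, flag_diff, hl]
  all_goals rcases hc with rfl | rfl | rfl | rfl | rfl | rfl <;> simp [flag_diff]

theorem flag_c33_diff (P : Set (Cls m)) (i : Fin 2) :
    (fun l => flag (P \ {.c33 i}) (.c33 l)) = Function.update (fun l => flag P (.c33 l)) i 0 := by
  funext l
  rw [Function.update_apply]
  split_ifs with hl
  · rw [hl, flag_diff_self]
  · exact flag_diff_of_ne (by simpa using hl)

theorem flag_m35_diff (P : Set (Cls m)) (i : Fin m) :
    (fun l => flag (P \ {.m35 i}) (.m35 l)) = Function.update (fun l => flag P (.m35 l)) i 0 := by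
  funext l
  rw [Function.update_apply]
  split_ifs with hl
  · rw [hl, flag_diff_self]
  · exact flag_diff_of_ne (by simpa using hl)

/-- The invariant is preserved by external arrivals. -/
theorem arrive (h : M.CycleInv k z τ a P) {c : Cls m} (hc : c ∈ P) {y : QState (Srv m) (Cls m)}
    (hy : M.network.Flush (M.network.join c (M.conc a)) y) :
    ∃ b, y = M.conc b ∧ M.CycleInv k z τ b (P \ {c}) := by
  have hdue := h.pending hc
  have hfl := flag_of_mem hc
  cases c with
  | c22 i =>
    refine ⟨_, M.flush_join_c22 hy, h.arrive_sub ?_ (by simp)⟩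
    convert (h.sub i).arrive22 hfl using 1
    simp [subFlags, flag_diff]
  | c42 i =>
    have hs : SubInv τ (z i) (M.inc (M.succ k z) i) (M.dec (M.succ k z) i)
        (subFlags (P \ {.c42 i}) (M.succ k z) i)
        (if (a.sub i).o4 = none then (a.sub i).pass11 else a.sub i) := by
      convert (h.sub i).arrive42 hfl using 1
      simp [subFlags, flag_diff]
    refine ⟨_, M.flush_join_c42 hy, ?_⟩
    split_ifs at hs ⊢
    · exact h.arrive_sub hs (by simp)
    · simpa only [NetState.setSub_eq_self] using h.arrive_sub hs (by simp)
  | c13 i =>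
    have hs : SubInv τ (z i) (M.inc (M.succ k z) i) (M.dec (M.succ k z) i)
        (subFlags (P \ {.c13 i}) (M.succ k z) i) (if (a.sub i).o1 = none ∧ (a.sub i).w12 = 0 ∧
          (a.sub i).w11 = 0 then (a.sub i).join31 else a.sub i) := by
      convert (h.sub i).arrive13 hfl using 1
      simp [subFlags, flag_diff]
    refine ⟨_, M.flush_join_c13 hy, ?_⟩
    split_ifs at hs ⊢
    · exact h.arrive_sub hs (by simp)
    · simpa only [NetState.setSub_eq_self] using h.arrive_sub hs (by simp)
  | c14 i =>
    have hs : SubInv τ (z i) (M.inc (M.succ k z) i) (M.dec (M.succ k z) i)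
        (subFlags (P \ {.c14 i}) (M.succ k z) i) (if (a.sub i).o1 = none ∧ (a.sub i).w12 = 0 ∧
          (a.sub i).w11 = 0 then (a.sub i).join31 else a.sub i) := by
      convert (h.sub i).arrive14 hfl using 1
      simp [subFlags, flag_diff]
    refine ⟨_, M.flush_join_c14 hy, ?_⟩
    split_ifs at hs ⊢
    · exact h.arrive_sub hs (by simp)
    · simpa only [NetState.setSub_eq_self] using h.arrive_sub hs (by simp)
  | c23 i =>
    have hs : SubInv τ (z i) (M.inc (M.succ k z) i) (M.dec (M.succ k z) i)
        (subFlags (P \ {.c23 i}) (M.succ k z) i) (if (a.sub i).o2 = none ∧ (a.sub i).w21 = 0 ∧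
          (a.sub i).w22 = 0 then (a.sub i).join31 else a.sub i) := by
      convert (h.sub i).arrive23 hfl using 1
      simp [subFlags, flag_diff]
    refine ⟨_, M.flush_join_c23 hy, ?_⟩
    split_ifs at hs ⊢
    · exact h.arrive_sub hs (by simp)
    · simpa only [NetState.setSub_eq_self] using h.arrive_sub hs (by simp)
  | c32 i =>
    rw [M.join_c32 a i ((h.sub i).o3_eq_none hfl)] at hy
    refine ⟨_, M.flush_conc hy, h.arrive_sub ?_ (by simp)⟩
    convert (h.sub i).arrive32 hfl using 1
    simp [subFlags, flag_diff]
  | c33 i =>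
    have hthird := (h.sub i).third_at_signal (.inr (by
      have : (.c14 i : Cls m) ∉ P := by
        intro h14
        have h1 : τ = 260 := h.pending h14
        have h2 : τ = 270 := hdue
        omega
      exact flag_of_notMem this)) hdue
    have h35 : ∀ l, flag (P \ {.c33 i}) (.m35 l) = flag P (.m35 l) := fun l =>
      flag_diff_of_ne (by simp)
    have h42 : ∀ l, flag (P \ {.c33 i}) (.m42 l) = flag P (.m42 l) := fun l =>
      flag_diff_of_ne (by simp)
    by_cases hz : 0 < z i
    · obtain ⟨h1, h2⟩ := hthird.2 hz
      have hm : MainInv τ k (M.succ k z) (fun i => if 0 < z i then 1 else 0)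
          (fun l => flag (P \ {.c33 i}) (.c33 l)) (fun l => flag (P \ {.c33 i}) (.m35 l))
          (flag (P \ {.c33 i}) (.m42 (M.succ k z))) (a.signal i) := by
        rw [flag_c33_diff]
        simp only [h35, h42]
        exact h.main.arrive33 hfl (by simp [hz])
      refine ⟨a.signal i, ?_, h.of_main Set.sdiff_subset ?_ ?_ hm⟩
      · have hy' := M.flush_join_c33_idle hy h1 h2
        by_cases ho : a.o01 = none
        · rw [M.join_m01_idle a i (h.main.w01_eq_zero ho) ho] at hy'
          rw [NetState.signal, if_pos ho]
          exact M.flush_conc hy'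
        · rw [M.join_m01_busy a i ho] at hy'
          rw [NetState.signal, if_neg ho]
          exact M.flush_conc hy'
      · unfold NetState.signal
        split_ifs <;> rfl
      · intro l
        simp [subFlags, flag_diff]
    · refine ⟨a, M.flush_join_c33_busy hy (hthird.1 (by omega)), h.of_main Set.sdiff_subset rfl ?_ ?_⟩
      · intro l
        simp [subFlags, flag_diff]
      · rw [flag_c33_diff]
        simp only [h35, h42]
        exact h.main.arrive33_reject hfl (by simp [hz])
  | m35 l =>
    obtain ⟨p, r, hw, hp⟩ := h.main.walk_at hdue
    have hp' : M.α k (bits p) = M.succ k z := by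
      rw [hp]
      unfold succ
      congr 1
      funext i
      by_cases hz : 0 < z i <;> simp [hz]
    have h33 : ∀ i, flag (P \ {.m35 l}) (.c33 i) = flag P (.c33 i) := fun i =>
      flag_diff_of_ne (by simp)
    have h42 : ∀ i, flag (P \ {.m35 l}) (.m42 i) = flag P (.m42 i) := fun l =>
      flag_diff_of_ne (by simp)
    have hsf : ∀ i, subFlags (P \ {.m35 l}) (M.succ k z) i = subFlags P (M.succ k z) i := by
      intro i
      simp [subFlags, flag_diff]
    by_cases hl : l = M.succ k z
    · subst hl
      refine ⟨a, M.flush_join_m35_busy hy hw hp', h.of_main Set.sdiff_subset rfl hsf ?_⟩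
      rw [flag_m35_diff]
      simp only [h33, h42]
      exact h.main.arrive35_self
    · refine ⟨_, M.flush_join_m35_idle hy ?_ (h.main.o4_of_pending hfl),
        h.of_main Set.sdiff_subset rfl hsf ?_⟩
      · intro p' k' r' hw'
        rw [hw] at hw'
        simp only [Option.some.injEq, Prod.mk.injEq] at hw'
        obtain ⟨rfl, rfl, rfl⟩ := hw'
        rw [hp']
        exact Ne.symm hl
      · rw [flag_m35_diff]
        simp only [h33, h42]
        exact h.main.arrive35 hl hfl
  | m42 l =>
    have h33 : ∀ i, flag (P \ {.m42 l}) (.c33 i) = flag P (.c33 i) := fun i =>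
      flag_diff_of_ne (by simp)
    have h35 : ∀ i, flag (P \ {.m42 l}) (.m35 i) = flag P (.m35 i) := fun i =>
      flag_diff_of_ne (by simp)
    have hsf : ∀ i, subFlags (P \ {.m42 l}) (M.succ k z) i = subFlags P (M.succ k z) i := by
      intro i
      simp [subFlags, flag_diff]
    by_cases hl : l = M.succ k z
    · subst hl
      refine ⟨_, M.flush_join_m42_idle hy ((h.main.o4_at hdue _).2 rfl)
        (h.main.o02_of_pending hfl), h.of_main Set.sdiff_subset rfl hsf ?_⟩
      simp only [h33, h35, flag_diff_self]
      exact h.main.arrive42 hfl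
    · refine ⟨a, M.flush_join_m42_busy hy fun h' => hl ((h.main.o4_at hdue _).1 h'),
        h.of_main Set.sdiff_subset rfl hsf ?_⟩
      simp only [h33, h35]
      rw [flag_diff_of_ne (by simpa using Ne.symm hl)]
      exact h.main
  | m43 l =>
    have hmain : ∀ c : Cls m, c ≠ .m43 l → flag (P \ {.m43 l}) c = flag P c :=
      fun _ => flag_diff_of_ne
    by_cases hl : l = M.succ k z
    · subst hl
      refine ⟨_, M.flush_join_m43_idle hy ((h.main.o4_at hdue _).2 rfl)
        (fun i => (h.sub i).o4_eq_none hfl) (fun i => (h.sub i).o5_eq_none hfl),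
        Set.sdiff_subset.trans h.pending, ?_, ?_⟩
      · intro i
        convert (h.sub i).arrive43 hfl using 1
        · simp [subFlags, flag_diff]
        · simp [inc, dec]
      · simp only [hmain _ (by simp : Cls.c33 _ ≠ _), hmain _ (by simp : Cls.m35 _ ≠ _),
          hmain _ (by simp : Cls.m42 _ ≠ _)]
        obtain ⟨h1, h2, h3, h4, h5, h6, h7, h8⟩ := h.main
        exact ⟨h1, h2, h3, h4, h5, h6, h7, h8⟩
    · refine ⟨a, M.flush_join_m43_busy hy fun h' => hl ((h.main.o4_at hdue _).1 h'),
        h.of_main Set.sdiff_subset rfl ?_ ?_⟩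
      · intro i
        simp [subFlags, flag_diff, Ne.symm hl]
      · simp only [hmain _ (by simp : Cls.c33 _ ≠ _), hmain _ (by simp : Cls.m35 _ ≠ _),
          hmain _ (by simp : Cls.m42 _ ≠ _)]
        exact h.main
  | _ => exact hdue.elim

/-- The invariant is preserved by service completions. -/
theorem finish (h : M.CycleInv k z τ a P) {v : Srv m} {c : Cls m}
    (hv : (M.conc a).serving v = some (c, 0)) {x y : QState (Srv m) (Cls m)}
    (hx : M.network.Select v (M.network.route c (QNetwork.free v (M.conc a))) x)
    (hy : M.network.Flush x y) :
    ∃ b, y = M.conc b ∧ M.CycleInv k z τ b P := by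
  rcases v with ⟨i, l⟩ | _ | _ | l | l
  · fin_cases l <;> simp [conc, subServing, hund_eq_zero] at hv
    · obtain ⟨hv, rfl⟩ := hv
      exact ⟨_, M.flush_finish_c12 hx hy, h.setSub_same ((h.sub i).finish1 hv)⟩
    · obtain ⟨hv, rfl⟩ := hv
      exact ⟨_, M.flush_finish_c21 hx hy, h.setSub_same ((h.sub i).finish2 hv)⟩
    · obtain ⟨b, ho, rfl⟩ : ∃ b, (a.sub i).o3 = some (b, 0) ∧
          (if b then Cls.c32 i else Cls.c31 i) = c := by
        obtain hv | hv := hv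
        · exact ⟨false, hv.1, by simpa using hv.2⟩
        · exact ⟨true, hv.1, by simpa using hv.2⟩
      exact ⟨_, M.flush_finish_c31 hx hy, h.setSub_same ((h.sub i).finish3 ho)⟩
    · obtain ⟨hv, rfl⟩ := hv
      exact ⟨_, M.flush_finish_c41 hx hy, h.setSub_same ((h.sub i).finish4 hv)⟩
    · obtain ⟨hv, rfl⟩ := hv
      exact ⟨_, M.flush_finish_c51 hx hy, h.setSub_same ((h.sub i).finish5 hv)⟩
  · simp only [conc, Option.map_eq_some_iff, Prod.mk.injEq, hund_eq_zero] at hv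
    obtain ⟨⟨i, r⟩, hv, rfl, rfl⟩ := hv
    refine ⟨_, M.flush_finish_m01 hx hy h.main.walk_eq_none_or, h.of_main subset_rfl ?_
      (fun _ => rfl) (h.main.finish01 hv)⟩
    unfold NetState.select01
    split_ifs
    · rfl
    · rfl
    · split <;> rfl
  · simp only [conc, Option.map_eq_some_iff, Prod.mk.injEq, hund_eq_zero] at hv
    obtain ⟨⟨i, r⟩, hv, rfl, rfl⟩ := hv
    obtain ⟨rfl, h1, h2, h3, h4⟩ := h.main.finish02 hv
    refine ⟨_, M.flush_finish_m02 hx hy h1 h2 h3, h.of_main subset_rfl ?_ (fun _ => rfl) h4⟩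
    split_ifs <;> rfl
  · simp only [conc, Option.bind_eq_some_iff] at hv
    obtain ⟨⟨p, k', r⟩, hv, hv'⟩ := hv
    split_ifs at hv' with hl
    simp only [Option.some.injEq, Prod.mk.injEq, hund_eq_zero] at hv'
    obtain ⟨rfl, rfl⟩ := hv'
    subst hl
    exact ⟨_, M.flush_finish_probe hv hx hy, h.of_main subset_rfl rfl (fun _ => rfl)
      (h.main.finish_walk hv)⟩
  · simp only [conc, Option.map_eq_some_iff, Prod.mk.injEq, hund_eq_zero] at hv
    obtain ⟨r, hv, rfl, rfl⟩ := hv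
    exact ⟨_, M.flush_finish_m41 hx hy, h.of_main subset_rfl rfl (fun _ => rfl)
      (h.main.finish4 hv)⟩

end CycleInv

end SCM

/-! ### The passage of time -/

namespace SCM

variable {m : ℕ} (M : SCM m)

/-- The flow of the network on encoded states. The subtraction in `NetState.tick` does not truncate,
because no service is due. -/
theorem flow_tick (a : NetState m) (ha : a.Settled) :
    (M.conc a).flow (1 / 100) = M.conc a.tick := by
  have key : ∀ r : ℕ, r ≠ 0 → hund r - 1 / 100 = hund (r - 1) := by
    intro r hr
    obtain ⟨r, rfl⟩ := Nat.exists_eq_succ_of_ne_zero hr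
    exact hund_succ_sub r
  ext1
  · rfl
  funext v
  rcases v with ⟨i, l⟩ | _ | _ | l | l
  · obtain ⟨h1, h2, h3, h4, h5⟩ := ha.sub i
    fin_cases l <;> simp only [QState.flow, conc, subServing, NetState.tick, SubState.tick]
    · cases h : (a.sub i).o1 with
      | none => rfl
      | some r => simp [← key r (by rintro rfl; exact h1 h)]
    · cases h : (a.sub i).o2 with
      | none => rfl
      | some r => simp [← key r (by rintro rfl; exact h2 h)]
    · cases h : (a.sub i).o3 with
      | none => rfl
      | some p =>
        obtain ⟨b, r⟩ := p
        simp [← key r (by rintro rfl; exact h3 _ h)]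
    · cases h : (a.sub i).o4 with
      | none => rfl
      | some r => simp [← key r (by rintro rfl; exact h4 h)]
    · cases h : (a.sub i).o5 with
      | none => rfl
      | some r => simp [← key r (by rintro rfl; exact h5 h)]
  all_goals simp only [QState.flow, conc, NetState.tick]
  · cases h : a.o01 with
    | none => rfl
    | some p =>
      obtain ⟨b, r⟩ := p
      simp [← key r (by rintro rfl; exact ha.o01 _ h)]
  · cases h : a.o02 with
    | none => rfl
    | some p =>
      obtain ⟨b, r⟩ := p
      simp [← key r (by rintro rfl; exact ha.o02 _ h)]
  · cases h : a.walk with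
    | none => rfl
    | some p =>
      obtain ⟨b, k, r⟩ := p
      have := key r (by rintro rfl; exact ha.walk _ _ h)
      by_cases hl : M.α k (bits b) = l <;> simp [hl, ← this]
  · cases h : a.o4 l with
    | none => rfl
    | some r => simp [← key r (by rintro rfl; exact ha.o4 _ h)]

theorem settled_of_conc {a : NetState m} (h : ∀ v c, (M.conc a).serving v ≠ some (c, 0)) :
    a.Settled where
  sub i :=
    { o1 := fun h' => h (.sub i 0) (.c12 i) (by simp [conc, subServing, h', hund_zero])
      o2 := fun h' => h (.sub i 1) (.c21 i) (by simp [conc, subServing, h', hund_zero])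
      o3 := fun b h' => h (.sub i 2) (if b then .c32 i else .c31 i)
        (by simp [conc, subServing, h', hund_zero])
      o4 := fun h' => h (.sub i 3) (.c41 i) (by simp [conc, subServing, h', hund_zero])
      o5 := fun h' => h (.sub i 4) (.c51 i) (by simp [conc, subServing, h', hund_zero]) }
  o01 i h' := h .S01 (.m01 i) (by simp [conc, h', hund_zero])
  o02 k h' := h .S02 (.m02 k) (by simp [conc, h', hund_zero])
  walk p k h' := h (.S3 (M.α k (bits p))) (probe p k) (by simp [conc, h', hund_zero])
  o4 l h' := h (.S4 l) (.m41 l) (by simp [conc, h', hund_zero])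

/-! ### Arrival times -/

theorem hund_eq_arrival {a b : ℚ} {A B : ℤ} (ha : a = A / 100) (hb : b = B / 100) (N n : ℕ) :
    hund N = (a : ℝ) * n + (b : ℝ) ↔ (N : ℤ) = A * n + B := by
  subst ha hb
  unfold hund
  push_cast
  constructor
  · intro h
    have : (N : ℝ) = (A : ℝ) * n + B := by linarith
    exact_mod_cast this
  · intro h
    have : (N : ℝ) = (A : ℝ) * n + B := by exact_mod_cast h
    rw [this]
    ring

/-- The period and the delay of the external arrivals, in hundredths. -/
def arrHund : Cls m → Option (ℤ × ℤ)
  | .c22 _ => some (100, 0)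
  | .c42 _ => some (100, 2)
  | .c13 _ => some (300, 160)
  | .c23 _ => some (300, 210)
  | .c14 _ => some (300, 260)
  | .c32 _ => some (300, 150)
  | .c33 _ => some (300, 270)
  | .m35 _ => some (300, -1)
  | .m42 _ => some (300, 0)
  | .m43 _ => some (300, 0)
  | _ => none

theorem extArr_eq (c : Cls m) :
    extArr c = (arrHund c).map fun p => ((p.1 : ℚ) / 100, (p.2 : ℚ) / 100) := by
  cases c <;> norm_num [extArr, arrHund]

theorem mem_arrivals (u : ℝ) (c : Cls m) : c ∈ M.network.arrivals u ↔
    ∃ A B : ℤ, arrHund c = some (A, B) ∧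
      ∃ n : ℕ, u = (((A : ℚ) / 100 : ℚ) : ℝ) * n + (((B : ℚ) / 100 : ℚ) : ℝ) := by
  have : M.network.arrival = extArr := rfl
  simp only [QNetwork.arrivals, this, extArr_eq, Set.mem_ofPred_eq]
  constructor
  · rintro ⟨a, b, h, n, hn⟩
    simp only [Option.map_eq_some_iff, Prod.mk.injEq] at h
    obtain ⟨⟨A, B⟩, h, rfl, rfl⟩ := h
    exact ⟨A, B, h, n, hn⟩
  · rintro ⟨A, B, h, n, hn⟩
    exact ⟨_, _, by rw [h]; rfl, n, hn⟩

theorem mem_arrivals_hund (N : ℕ) (c : Cls m) : c ∈ M.network.arrivals (hund N) ↔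
    ∃ A B : ℤ, arrHund c = some (A, B) ∧ ∃ n : ℕ, (N : ℤ) = A * n + B := by
  rw [mem_arrivals]
  simp only [hund_eq_arrival rfl rfl]

theorem onLattice : M.network.OnLattice where
  service c := ⟨svcHund c, srvTime_eq c⟩
  arrival u c hu hc := by
    obtain ⟨A, B, h, n, rfl⟩ := (M.mem_arrivals u c).1 hc
    have h1 : (0 : ℝ) < A * n + B := by
      push_cast at hu
      linarith
    have h2 : 0 < A * n + B := by exact_mod_cast h1
    refine ⟨(A * n + B).toNat, ?_⟩
    rw [eq_comm, hund_eq_arrival rfl rfl, Int.toNat_of_nonneg h2.le]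

/-- The external arrivals have the period `300`, so those of every cycle are the same. -/
theorem arrivals_cycle {t τ : ℕ} (h1 : 100 ≤ τ) (h2 : τ < 400) :
    M.network.arrivals (hund (300 * t + τ)) = due τ := by
  ext c
  rw [mem_arrivals_hund]
  cases c <;> simp only [arrHund, due, Set.mem_ofPred_eq, reduceCtorEq, false_and, exists_false,
    Option.some.injEq, Prod.mk.injEq, and_assoc, exists_and_left, exists_eq_left']
  case c22 => exact ⟨fun ⟨n, h⟩ => by omega, fun h => ⟨3 * t + τ / 100, by omega⟩⟩
  case c42 => exact ⟨fun ⟨n, h⟩ => by omega, fun h => ⟨3 * t + τ / 100, by omega⟩⟩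
  case m35 => exact ⟨fun ⟨n, h⟩ => by omega, fun h => ⟨t + 1, by omega⟩⟩
  case m42 => exact ⟨fun ⟨n, h⟩ => by omega, fun h => ⟨t + 1, by omega⟩⟩
  case m43 => exact ⟨fun ⟨n, h⟩ => by omega, fun h => ⟨t + 1, by omega⟩⟩
  all_goals exact ⟨fun ⟨n, h⟩ => by omega, fun h => ⟨t, by omega⟩⟩

theorem arrivals_start {n : ℕ} (h1 : 0 < n) (h2 : n < 100) :
    M.network.arrivals (hund n) = {c | n = 2 ∧ ∃ i, c = .c42 i} := by
  ext c
  rw [mem_arrivals_hund]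
  cases c <;> simp only [arrHund, Set.mem_ofPred_eq, reduceCtorEq, false_and, and_false,
    exists_false, Option.some.injEq, Prod.mk.injEq, and_assoc, exists_and_left, exists_eq_left',
    iff_false, Cls.c42.injEq, exists_eq', and_true]
  case c42 => exact ⟨fun ⟨n, h⟩ => by omega, fun h => ⟨0, by omega⟩⟩
  all_goals rintro ⟨n, h⟩; omega

/-! ### One cycle -/

namespace CycleInv

variable {M} {k : Fin m} {z : Fin 2 → ℕ} {τ : ℕ} {a : NetState m}

/-- At the end of an instant, all arrivals have been carried out and no service is due. -/
theorem settles (h : M.CycleInv k z τ a (due τ)) {t : ℕ} {y : QState (Srv m) (Cls m)}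
    (hy : M.network.Settles (hund (300 * t + τ)) (M.conc a) y) (hreg : M.network.Regular y) :
    ∃ b, y = M.conc b ∧ b.Settled ∧ M.CycleInv k z τ b ∅ := by
  have hτ := h.main.range
  obtain ⟨h1, h2⟩ := hy
  rw [M.arrivals_cycle hτ.1 hτ.2] at h1
  obtain ⟨b, rfl, hb⟩ := QNetwork.invariant_of_flush
    (I := fun x P => ∃ b, x = M.conc b ∧ M.CycleInv k z τ b P)
    (by rintro x P ⟨b, rfl, _⟩; exact M.not_passing_conc b)
    (by rintro x P v c y z ⟨b, rfl, hb⟩ hv hy hz; exact hb.finish hv hy hz)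
    (by rintro x P c z ⟨b, rfl, hb⟩ hc hz; exact hb.arrive hc hz) h1 ⟨a, rfl, h⟩
    (fun v c hc r hv => (hreg v c r hv).1 hc)
  exact ⟨b, rfl, M.settled_of_conc h2, hb⟩

theorem tick (h : M.CycleInv k z τ a ∅) (ha : a.Settled) (hτ : τ + 1 < 400) :
    M.CycleInv k z (τ + 1) a.tick (due (τ + 1)) where
  pending := subset_rfl
  sub i := (h.sub i).tick (subFlags_empty_done _ i) (ha.sub i) (subFlags_due_fresh _ _ i) hτ
  main := h.main.tick ha (fun _ => flag_empty _) (fun _ => flag_empty _) (flag_empty _)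
    (fun _ => flag_due _ Iff.rfl) (fun _ => flag_due _ Iff.rfl) (flag_due _ Iff.rfl) hτ

/-- The cycle ends with the next configuration of the machine. -/
theorem restart (h : M.CycleInv k z τ a ∅) (ha : a.Settled) (hτ : τ = 399) :
    M.CycleInv (M.step (k, z)).1 (M.step (k, z)).2 100 a.tick (due 100) where
  pending := subset_rfl
  sub i := by
    refine (h.sub i).restart (subFlags_empty_done _ i) (ha.sub i) (subFlags_due_fresh _ _ i) hτ ?_
      ⟨M.inc_le _ _, M.dec_le _ _, M.dec_le_counter _ _ _⟩
    have h1 := M.step_counter (k, z) i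
    have h2 := M.β_eq (M.succ k z) i
    have h3 : (M.Γ k fun i => decide (0 < z i)).2 i = M.β (M.succ k z) i := rfl
    dsimp only at h1
    rw [h3] at h1
    omega
  main := by
    have h0 : ∀ c : Cls m, c ∈ due 100 ↔ ∃ i, c = .c22 i := by
      intro c
      cases c <;> simp [due]
    refine h.main.restart hτ _ ⟨?_, ?_⟩ (fun i => ?_) (fun l => ?_) ?_
    · split_ifs <;> omega
    · split_ifs <;> omega
    all_goals exact flag_of_notMem (by simp [h0])

end CycleInv

end SCM

namespace QNetwork

variable {S C : Type*} [DecidableEq S] [DecidableEq C] {N : QNetwork S C}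

theorem IsEvolution.regular (hN : N.OnLattice) {x₀ : QState S C} {X : ℝ → QState S C}
    (hX : N.IsEvolution x₀ X) (h0 : N.Regular x₀) (n : ℕ) : N.Regular (X (hund n)) := by
  induction n with
  | zero => rwa [hund_zero, hX.init]
  | succ n ih => exact (hX.lattice_step hN n ih).2.regular hN ih.tidy_flow

end QNetwork

namespace SCM

variable {m : ℕ} (M : SCM m)

/-! ### The first unit of time -/

/-- The network before the first cycle: apart from the job which represents the initial state, there
is at most one job in each subnetwork, in service in the class `c21 i`. -/
def startState (s₀ : Fin m) (r : ℕ) (o : Fin 2 → Option ℕ) : NetState m where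
  sub i := ⟨none, o i, 0, 0, 0, 0, none, 0, none, none⟩
  o01 := none
  w01 := 0
  w03 := none
  o02 := some (s₀, r)
  walk := none
  o4 _ := none

theorem startState_setSub (s₀ : Fin m) (r : ℕ) (o : Fin 2 → Option ℕ) (i : Fin 2) (n : Option ℕ) :
    (startState s₀ r o).setSub i ⟨none, n, 0, 0, 0, 0, none, 0, none, none⟩ =
      startState s₀ r (Function.update o i n) := by
  unfold NetState.setSub startState
  congr 1
  funext l
  by_cases hl : l = i
  · subst hl; simp
  · simp [hl]

theorem initialState_eq (s₀ : Fin m) : initialState s₀ = M.conc (startState s₀ 271 fun _ => none) := by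
  ext1
  · funext c
    cases c <;> simp [initialState, conc, startState]
  · funext v
    rcases v with ⟨i, l⟩ | _ | _ | _ | _
    · fin_cases l <;> simp [initialState, conc, startState, subServing]
    all_goals simp [initialState, conc, startState, srvTime_eq, svcHund]

/-- The second server of a subnetwork before the first cycle serves the job which arrives at time
`2`; here `f` tells whether this arrival is pending. -/
def StartInv (n f : ℕ) (o : Option ℕ) : Prop :=
  o = none ∧ (n < 2 ∨ n = 2 ∧ f = 1 ∨ 52 ≤ n) ∨ ∃ r, o = some r ∧ r + n = 52 ∧ 2 ≤ n ∧ f = 0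

theorem start_settles {s₀ : Fin m} {n r : ℕ} (hn : 0 < n) (hn' : n < 100) (hr : r + n = 271)
    {o : Fin 2 → Option ℕ} (ho : ∀ i, StartInv n (if n = 2 then 1 else 0) (o i))
    {y : QState (Srv m) (Cls m)} (hy : M.network.Settles (hund n) (M.conc (startState s₀ r o)) y)
    (hreg : M.network.Regular y) :
    ∃ o', y = M.conc (startState s₀ r o') ∧ (startState s₀ r o').Settled ∧
      ∀ i, StartInv n 0 (o' i) := by
  obtain ⟨h1, h2⟩ := hy
  rw [M.arrivals_start hn hn'] at h1
  obtain ⟨_, o', rfl, ho'⟩ := QNetwork.invariant_of_flush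
    (I := fun x P => P ⊆ {c | n = 2 ∧ ∃ i, c = .c42 i} ∧ ∃ o, x = M.conc (startState s₀ r o) ∧
      ∀ i, StartInv n (flag P (.c42 i)) (o i))
    (by rintro x P ⟨_, b, rfl, _⟩; exact M.not_passing_conc _)
    (by
      rintro x P v c y z ⟨hP, o, rfl, ho⟩ hv hy hz
      refine ⟨hP, ?_⟩
      rcases v with ⟨i, l⟩ | _ | _ | _ | _
      · fin_cases l <;> simp [conc, subServing, hund_eq_zero, startState] at hv
        obtain ⟨hv, rfl⟩ := hv
        refine ⟨Function.update o i none, ?_, fun l => ?_⟩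
        · rw [← startState_setSub]
          exact M.flush_finish_c21 hy hz
        · rw [Function.update_apply]
          split_ifs with hl
          · subst hl
            refine .inl ⟨rfl, ?_⟩
            obtain ⟨h, _⟩ | ⟨r', h, h3, _⟩ := ho l
            · simp [hv] at h
            · simp only [hv, Option.some.injEq] at h
              omega
          · exact ho l
      all_goals simp [conc, startState, hund_eq_zero] at hv
      omega)
    (by
      rintro x P c z ⟨hP, o, rfl, ho⟩ hc hz
      refine ⟨Set.sdiff_subset.trans hP, ?_⟩
      obtain ⟨h2, i, rfl⟩ := hP hc
      refine ⟨Function.update o i (some 50), ?_, fun l => ?_⟩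
      · rw [← startState_setSub, M.flush_join_c42 hz]
        have ho' : o i = none := by
          obtain ⟨h, _⟩ | ⟨r', _, _, _, h⟩ := ho i
          · exact h
          · rw [flag_of_mem hc] at h
            omega
        simp [startState, SubState.pass11, SubState.join21, ho']
      · by_cases hl : l = i
        · subst hl
          rw [flag_diff_self]
          exact .inr ⟨50, by simp, by omega, by omega, rfl⟩
        · rw [flag_diff_of_ne (by simpa using hl), Function.update_of_ne hl]
          exact ho l) h1
    ⟨subset_rfl, o, rfl, fun i => by
      have : flag {c | n = 2 ∧ ∃ i, c = .c42 i} (Cls.c42 i : Cls m) = if n = 2 then 1 else 0 := by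
        split_ifs with h
        · exact flag_of_mem ⟨h, i, rfl⟩
        · exact flag_of_notMem fun h' => h h'.1
      rw [this]
      exact ho i⟩
    (fun v c hc r hv => (hreg v c r hv).1 hc)
  refine ⟨o', rfl, M.settled_of_conc h2, fun i => ?_⟩
  rw [← flag_empty (.c42 i)]
  exact ho' i

theorem startState_tick (s₀ : Fin m) (r : ℕ) (o : Fin 2 → Option ℕ) :
    (startState s₀ (r + 1) o).tick = startState s₀ r fun i => (o i).map (· - 1) := rfl

theorem StartInv.tick {n : ℕ} {o : Option ℕ} (h : StartInv n 0 o) (ho : o ≠ some 0) :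
    StartInv (n + 1) (if n + 1 = 2 then 1 else 0) (o.map (· - 1)) := by
  obtain ⟨rfl, h⟩ | ⟨r, rfl, h1, h2, _⟩ := h
  · refine .inl ⟨rfl, ?_⟩
    split_ifs <;> omega
  · have : r ≠ 0 := by rintro rfl; exact ho rfl
    refine .inr ⟨r - 1, rfl, by omega, by omega, if_neg (by omega)⟩

/-! ### Induction over the cycles -/

section Evolution

variable {M} {s₀ : Fin m} {X : ℝ → QState (Srv m) (Cls m)}

theorem regular_initialState (s₀ : Fin m) : M.network.Regular (initialState s₀) := by
  intro v c r h
  by_cases hv : v = .S02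
  · subst hv
    simp only [initialState, Function.update_self, Option.some.injEq, Prod.mk.injEq] at h
    obtain ⟨rfl, rfl⟩ := h
    exact ⟨by simp [network, srvTime], 270, srvTime_eq _⟩
  · simp [initialState, hv] at h

/-- The states before the first cycle. -/
theorem start (hX : M.network.IsEvolution (initialState s₀) X) {n : ℕ} (hn : n < 100) :
    ∃ r o, r + n = 271 ∧ X (hund n) = M.conc (startState s₀ r o) ∧
      (startState s₀ r o).Settled ∧ ∀ i, StartInv n 0 (o i) := by
  have hreg := hX.regular M.onLattice (regular_initialState s₀)
  induction n with
  | zero =>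
    refine ⟨271, fun _ => none, rfl, ?_, ?_, fun i => .inl ⟨rfl, .inl (by omega)⟩⟩
    · rw [hund_zero, hX.init, M.initialState_eq]
    · constructor <;> simp [startState]
      constructor <;> simp
  | succ n ih =>
    obtain ⟨r, o, hr, h1, h2, h3⟩ := ih (by omega)
    obtain ⟨r, rfl⟩ : ∃ r', r = r' + 1 := ⟨r - 1, by omega⟩
    have h4 := (hX.lattice_step M.onLattice n (hreg n)).2
    rw [h1, M.flow_tick _ h2, startState_tick] at h4
    obtain ⟨o', h5⟩ := M.start_settles (by omega) hn (by omega)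
      (fun i => (h3 i).tick (h2.sub i).o2) h4 (hreg _)
    exact ⟨r, o', by omega, h5⟩

/-- Before the first cycle the network represents the initial state with both counters zero. -/
theorem startState_cycleInv (s₀ : Fin m) :
    M.CycleInv s₀ (fun _ => 0) 100 (startState s₀ 171 fun _ => none) (due 100) where
  pending := subset_rfl
  sub i := by
    obtain ⟨h1, h2, h3, h4, h5, h6, h7⟩ := subFlags_due_fresh 100 (M.succ s₀ fun _ => 0) i
    refine ⟨2, 50, 0, 0, 0, 0, 0, ?_, ?_, ?_, ?_, ?_, ⟨M.inc_le _ _, M.dec_le _ _, ?_⟩, ?_, ?_, ?_,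
      ?_⟩
    · simp [RSState, startState]
    · constructor <;> omega
    · exact .inl ⟨rfl, rfl, .inl ⟨.inl (by omega), rfl⟩⟩
    · exact .inr ⟨rfl, by omega⟩
    · exact .inr ⟨rfl, by omega⟩
    · exact M.dec_le_counter _ _ _
    · omega
    · omega
    · simp
    · simp
  main := by
    have h0 : ∀ c : Cls m, c ∈ due 100 ↔ ∃ i, c = .c22 i := by
      intro c
      cases c <;> simp [due]
    have hf : ∀ c : Cls m, (∀ i, c ≠ .c22 i) → flag (due 100) c = 0 := fun c hc =>
      flag_of_notMem (by simpa [h0] using hc)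
    refine ⟨by omega, by simp, fun i => .inl (hf _ (by simp)), fun i => .inl (hf _ (by simp)),
      .inl (hf _ (by simp)), .inr ⟨rfl, rfl, rfl, .inl ?_⟩, .inl ⟨171, rfl, rfl, rfl, rfl⟩,
      fun l => .inr ⟨rfl, by omega⟩⟩
    simp [signals]

variable (M) in
/-- At the beginning of the cycle with number `t`, the network represents the configuration of the
machine after `t` steps: one unit of time earlier, `S02` started to work on a job of its state, and
immediately before the events of this time the invariant holds with all arrivals pending. -/
structure Represents (s₀ : Fin m) (X : ℝ → QState (Srv m) (Cls m)) (t : ℕ) : Prop where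
  serving : (X (hund (300 * t))).serving .S02 = some (.m02 (M.run s₀ t).1, hund 271)
  before : ∃ a, (X (hund (300 * t + 99))).flow (1 / 100) = M.conc a ∧
    M.CycleInv (M.run s₀ t).1 (M.run s₀ t).2 100 a (due 100)

theorem represents_zero (hX : M.network.IsEvolution (initialState s₀) X) :
    M.Represents s₀ X 0 where
  serving := by
    rw [Nat.mul_zero, hund_zero, hX.init, initialState_eq M]
    rfl
  before := by
    obtain ⟨r, o, hr, h1, h2, h3⟩ := start hX (n := 99) (by omega)
    obtain rfl : r = 171 + 1 := by omega
    refine ⟨_, ?_, startState_cycleInv s₀⟩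
    rw [Nat.mul_zero, Nat.zero_add, h1, M.flow_tick _ h2, startState_tick]
    congr 2
    funext i
    obtain ⟨h, _⟩ | ⟨r, _, _, _⟩ := h3 i
    · rw [h]; rfl
    · omega

/-- If the network represents a configuration at the beginning of a cycle, the invariant holds during
the whole cycle. -/
theorem Represents.cycle (hX : M.network.IsEvolution (initialState s₀) X) {t : ℕ}
    (h : M.Represents s₀ X t) {τ : ℕ} (h1 : 100 ≤ τ) (h2 : τ < 400) :
    ∃ a, X (hund (300 * t + τ)) = M.conc a ∧ a.Settled ∧
      M.CycleInv (M.run s₀ t).1 (M.run s₀ t).2 τ a ∅ := by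
  have hreg := hX.regular M.onLattice (regular_initialState s₀)
  induction τ, h1 using Nat.le_induction with
  | base =>
    obtain ⟨a, ha, hinv⟩ := h.before
    have h4 := (hX.lattice_step M.onLattice (300 * t + 99) (hreg _)).2
    rw [ha] at h4
    exact hinv.settles h4 (hreg _)
  | succ τ h1 ih =>
    obtain ⟨a, ha, hs, hinv⟩ := ih (by omega)
    have h4 := (hX.lattice_step M.onLattice (300 * t + τ) (hreg _)).2
    rw [ha, M.flow_tick _ hs] at h4
    exact (hinv.tick hs h2).settles h4 (hreg _)

theorem Represents.succ (hX : M.network.IsEvolution (initialState s₀) X) {t : ℕ}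
    (h : M.Represents s₀ X t) : M.Represents s₀ X (t + 1) := by
  have hrun : M.run s₀ (t + 1) = M.step (M.run s₀ t) := Function.iterate_succ_apply' _ _ _
  constructor
  · obtain ⟨a, ha, hs, hinv⟩ := h.cycle hX (τ := 300) (by omega) (by omega)
    rw [show 300 * (t + 1) = 300 * t + 300 by ring, ha, hrun]
    obtain ⟨r, _, _, _⟩ | ⟨_, ⟨_, h1⟩ | ⟨r, h1, h2, _⟩, _⟩ := hinv.main.token
    · omega
    · rw [flag_empty] at h1
      omega
    · obtain rfl : r = 271 := by omega
      simp only [conc, h1]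
      rfl
  · obtain ⟨a, ha, hs, hinv⟩ := h.cycle hX (τ := 399) (by omega) (by omega)
    rw [show 300 * (t + 1) + 99 = 300 * t + 399 by ring, ha, hrun]
    exact ⟨a.tick, M.flow_tick _ hs, hinv.restart hs rfl⟩

theorem represents (hX : M.network.IsEvolution (initialState s₀) X) (t : ℕ) :
    M.Represents s₀ X t := by
  induction t with
  | zero => exact represents_zero hX
  | succ t ih => exact ih.succ hX

end Evolution

/-! ### The statuses -/

namespace CycleInv

variable {M} {k : Fin m} {z : Fin 2 → ℕ} {a : NetState m} {P : Set (Cls m)}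

/-- At the beginning of a cycle the job of the current state is the only one in the main network. -/
theorem queue_main (h : M.CycleInv k z 100 a P) (c : Cls m) (hc : IsMain c) :
    M.network.queue (M.conc a) c = if c = .m02 k then 1 else 0 := by
  obtain ⟨r, h1, h2, h3, h4⟩ := h.main.token.resolve_right (by omega)
  obtain ⟨_, _, _, _, _⟩ | ⟨h5, h6, h7, _⟩ := h.main.s01
  · omega
  have hw : ∀ i, a.w01 i = 0 := Fin.forall_fin_two.2 ⟨h6, h7⟩
  have h8 : ∀ l, a.o4 l = none := by
    intro l
    obtain ⟨_, _, _, _, _, _⟩ | ⟨h8, _⟩ := h.main.s4 l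
    · omega
    · exact h8
  cases c <;> first
    | exact hc.elim
    | simp [QNetwork.queue, conc, network, srv, h1, h3, h4, h5, hw, h8, eq_comm]

theorem queue_nonRS (h : M.CycleInv k z 100 a P) (i : Fin 2) (c : Cls m) (hc : IsNonRS i c) :
    M.network.queue (M.conc a) c = 0 := by
  obtain ⟨md, r, wa, wp, N, ap, am, hs, hc', h3, h4, h5, _⟩ := h.sub i
  have ho3 : (a.sub i).o3 = none ∧ (a.sub i).w31 = 0 := by
    obtain ⟨h6, h7, _⟩ | ⟨_, _, _, _, _⟩ | ⟨_, _, _, _, _⟩ := h3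
    · exact ⟨h6, h7⟩
    · omega
    · omega
  have ho4 : (a.sub i).o4 = none := by
    obtain ⟨_, _, _, _, _, _⟩ | ⟨h6, _⟩ := h4
    · omega
    · exact h6
  have ho5 : (a.sub i).o5 = none := by
    obtain ⟨_, _, _, _, _, _⟩ | ⟨h6, _⟩ := h5
    · omega
    · exact h6
  cases c <;> first
    | exact hc.elim
    | (obtain rfl : _ = i := hc
       obtain ⟨_, h6, h7, _⟩ | ⟨_, h6, h7, _⟩ | ⟨_, h6, h7, _⟩ := hs <;>
       simp [QNetwork.queue, conc, network, srv, subServing, ho3, ho4, ho5, h6, h7])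

theorem queue_RS (h : M.CycleInv k z 100 a P) (i : Fin 2) :
    M.network.queue (M.conc a) (.c12 i) * M.network.queue (M.conc a) (.c21 i) = 0 := by
  obtain ⟨md, r, wa, wp, N, ap, am, hs, _⟩ := h.sub i
  obtain ⟨_, h1, h2, h3, h4, h5, h6⟩ | ⟨_, h1, h2, h3, h4, h5, h6⟩ |
    ⟨_, h1, h2, h3, h4, h5, h6, _⟩ := hs <;>
  simp [QNetwork.queue, conc, network, srv, subServing, *]

/-- Immediately before the beginning of a cycle, the workload of the Rybko–Stolyar servers encodes
the counter. -/
theorem rsWorkload_eq (h : M.CycleInv k z 100 a (due 100)) (i : Fin 2) :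
    M.rsWorkload i (M.conc a) = (z i : ℝ) / 2 := by
  obtain ⟨md, r, wa, wp, N, ap, am, hs, hc, _⟩ := h.sub i
  obtain ⟨f1, f2, f3, f4, f5, f6, f7⟩ := subFlags_due_fresh 100 (M.succ k z) i
  have hcount := hc.count
  have hslot := hc.slot
  have hadj := hc.adjust
  obtain ⟨rfl, h1, h2, h3, h4, h5, h6⟩ | ⟨rfl, h1, h2, h3, h4, h5, h6⟩ |
    ⟨rfl, h1, h2, h3, h4, h5, h6, rfl, rfl, rfl⟩ := hs
  · have hz : 50 * (wa + wp) + r = 50 * z i := by omega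
    have hz' : (50 : ℝ) * (wa + wp) + r = 50 * z i := by exact_mod_cast hz
    simp [rsWorkload, QNetwork.workload, QNetwork.queue, conc, network, srv, subServing, srvTime_eq,
      svcHund, hund, h1, h2, h3, h4, h5, h6]
    linear_combination hz' / 100
  · have hz : 50 * (wa + wp) + r = 50 * z i := by omega
    have hz' : (50 : ℝ) * (wa + wp) + r = 50 * z i := by exact_mod_cast hz
    simp [rsWorkload, QNetwork.workload, QNetwork.queue, conc, network, srv, subServing, srvTime_eq,
      svcHund, hund, h1, h2, h3, h4, h5, h6]
    linear_combination hz' / 100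
  · have hz : z i = 0 := by omega
    simp [rsWorkload, QNetwork.workload, QNetwork.queue, conc, network, srv, subServing, srvTime_eq,
      h1, h2, h3, h4, h5, h6, hz]

end CycleInv

theorem workload_flow (x : QState (Srv m) (Cls m)) (c : Cls m) :
    Continuous fun d => M.network.workload (x.flow d) c := by
  cases h : x.serving (M.network.server c) with
  | none =>
    simp only [QNetwork.workload, QState.flow, h, Option.map_none]
    exact continuous_const
  | some p =>
    simp only [QNetwork.workload, QState.flow, h, Option.map_some]
    split_ifs
    · exact continuous_const.add (continuous_const.sub continuous_id)
    · exact continuous_const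

theorem queue_flow (x : QState (Srv m) (Cls m)) (c : Cls m) (d : ℝ) :
    M.network.queue (x.flow d) c = M.network.queue x c := by
  have : (∃ r, (x.flow d).serving (M.network.server c) = some (c, r)) ↔
      ∃ r, x.serving (M.network.server c) = some (c, r) := by
    cases h : x.serving (M.network.server c) with
    | none => simp [QState.flow, h]
    | some p =>
      obtain ⟨c', r⟩ := p
      simp [QState.flow, h]
  classical
  exact congrArg (x.waiting c + ·) (if_congr this rfl rfl)

theorem continuous_rsWorkload_flow (i : Fin 2) (x : QState (Srv m) (Cls m)) :
    Continuous fun d => M.rsWorkload i (x.flow d) := by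
  unfold rsWorkload
  simp only [queue_flow]
  have h1 := M.workload_flow x (.c12 i)
  have h2 := M.workload_flow x (.c21 i)
  fun_prop

/-- If nothing happens between two consecutive lattice times, the workload immediately before the
second of these times is that of the state before the events of this time. -/
theorem leftLim_rsWorkload {X : ℝ → QState (Srv m) (Cls m)} {n : ℕ} {x : QState (Srv m) (Cls m)}
    (h : ∀ r ∈ Set.Ico (hund n) (hund (n + 1)), X r = x.flow (r - hund n)) (i : Fin 2) :
    Function.leftLim (fun s => M.rsWorkload i (X s)) (hund (n + 1)) =
      M.rsWorkload i (x.flow (1 / 100)) := by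
  have hn : hund n < hund (n + 1) := hund_lt.2 n.lt_succ_self
  apply leftLim_eq_of_tendsto
  have h1 : Filter.Tendsto (fun s => M.rsWorkload i (x.flow (s - hund n))) (𝓝[<] (hund (n + 1)))
      (𝓝 (M.rsWorkload i (x.flow (hund (n + 1) - hund n)))) :=
    (((M.continuous_rsWorkload_flow i x).comp
      (continuous_id.sub continuous_const)).tendsto _).mono_left nhdsWithin_le_nhds
  rw [hund_succ, add_sub_cancel_left, ← hund_succ] at h1
  refine h1.congr' ?_
  filter_upwards [Ico_mem_nhdsLT hn] with s hs
  rw [h s hs]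

end SCM

theorem theorem4 {m : ℕ} (M : SCM m) (s₀ : Fin m) :
    (∃ X : ℝ → QState (Srv m) (Cls m),
      M.network.IsEvolution (SCM.initialState s₀) X) ∧
    ∀ X : ℝ → QState (Srv m) (Cls m),
      M.network.IsEvolution (SCM.initialState s₀) X →
      ∀ (t : ℕ) (q : Fin m) (z : Fin 2 → ℕ), M.run s₀ t = (q, z) →
        M.statusMN X (3 * (t : ℝ) + 1) = ((q : ℕ) : ℤ) + 1 ∧
        ∀ i : Fin 2, M.statusSN i X (3 * (t : ℝ) + 1) = (z i : ℝ) := by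
  have hreg := SCM.regular_initialState (M := M) s₀
  constructor
  · have := Fintype.ofFinite (Srv m)
    have := Fintype.ofFinite (Cls m)
    exact QNetwork.exists_isEvolution M.onLattice M.isRank_zeroRank hreg
  intro X hX t q z hrun
  have hrep := SCM.represents hX t
  obtain ⟨b, hb, hinv'⟩ := hrep.before
  obtain ⟨a, ha, -, hinv⟩ := hrep.cycle hX (τ := 100) le_rfl (by omega)
  have hserv := hrep.serving
  rw [hrun] at hinv hinv' hserv
  have ht : 3 * (t : ℝ) + 1 = hund (300 * t + 100) := by
    unfold hund
    push_cast
    ring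
  have ht' : 3 * (t : ℝ) + 1 - 1 = hund (300 * t) := by
    unfold hund
    push_cast
    ring
  constructor
  · have hq : M.MainAt X (3 * (t : ℝ) + 1) q := by
      refine ⟨?_, ?_⟩
      · rw [ht', hserv, SCM.srvTime_eq]
        rfl
      · rw [ht, ha]
        exact hinv.queue_main
    have hex : ∃ k, M.MainAt X (3 * (t : ℝ) + 1) k := ⟨q, hq⟩
    -- the state whose service began one unit of time earlier is unique
    have hk : hex.choose = q := by
      have := hex.choose_spec.1
      rw [hq.1] at this
      simp only [Option.some.injEq, Prod.mk.injEq, Cls.m02.injEq] at this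
      exact this.1.symm
    rw [SCM.statusMN, dif_pos hex, hk]
  · intro i
    have h1 := (hX.lattice_step M.onLattice (300 * t + 99) (hX.regular M.onLattice hreg _)).1
    rw [SCM.statusSN, ht, ha, if_pos ⟨hinv.queue_RS i, hinv.queue_nonRS i⟩,
      M.leftLim_rsWorkload h1, hb, hinv'.rsWorkload_eq i]
    ring

end
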